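/- Fix $p>\frac32$, $m>\frac92\,\frac{p-1}{p-3/2}$ and $M>0$, and set $$\beta=\frac23-\frac3m,\qquad \gamma=\frac{2(p-3/2)}{3m}\Big[m-\frac{9(p-1)}{2(p-3/2)}\Big].$$ Then there is a constant $C=C(M,m,p)$ with the following property. Let $f_{in}$ be a non-negative Schwartz function on $\mathbb R^3$ with $$\int_{\mathbb R^3} f_{in}\,dv=1,\qquad \int_{\mathbb R^3} v\,f_{in}\,dv=0,\qquad \int_{\mathbb R^3}|v|^2f_{in}\,dv=3,$$ $$\int_{\mathbb R^3} f_{in}\,(1+|v|^2)^{m/2}\,dv\le M,\qquad \int_{\mathbb R^3} f_{in}\,|\log f_{in}|\,dv\le M .$$ Let $0<T^*\le\infty$ and let $f:[0,T^*)\times\mathbb R^3\to[0,\infty)$ be a Schwartz class solution with $f(0)=f_{in}$ of the Landau–Coulomb equation $$\partial_t f=\nabla\cdot\big(A[f]\nabla f-f\,\nabla a[f]\big)\quad\text{on }(0,T^*)\times\mathbb R^3,$$ $$A[f]=\frac{1}{8\pi|v|}\Big(\mathrm{Id}-\frac{v\otimes v}{|v|^2}\Big)*f,\qquad a[f]=\frac{1}{4\pi|v|}*f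 ,$$ that is, $f\in C([0,T^*);\mathcal S(\mathbb R^3))\cap C^\infty((0,T^*);\mathcal S(\mathbb R^3))$ satisfies the equation pointwise (in particular, $f$ may be the unique such solution on its maximal interval of existence $[0,T^*)$). Then for every $0<t<\min(1,T^*)$, $$\|f(t)\|_{L^\infty(\mathbb R^3)}\le C\Big(A_0^{\frac{\beta}{\gamma}}+A_0^{\frac{\beta}{1+\gamma+\beta}}\,t^{-\frac{1+\beta}{1+\gamma+\beta}}\Big),\qquad A_0:=\int_0^t\int_{\mathbb R^3}f^{p+1}\,dv\,ds .$$ -/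

import Mathlib

open MeasureTheory
open scoped SchwartzMap

noncomputable section

namespace LandauCoulomb

/-- Velocity space `ℝ³` with its Euclidean norm. -/
abbrev V : Type := EuclideanSpace ℝ (Fin 3)

/-- The matrix `Π(z) = Id - (z ⊗ z) / |z|²`. -/
def proj (z : V) : Matrix (Fin 3) (Fin 3) ℝ :=
  fun i j => (if i = j then 1 else 0) - z i * z j / ‖z‖ ^ 2

/-- The diffusion matrix `A[g] = (Π(v) / (8π|v|)) ∗ g`. -/
def diffusionMatrix (g : V → ℝ) (v : V) : Matrix (Fin 3) (Fin 3) ℝ :=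
  fun i j => ∫ w, proj (v - w) i j / (8 * Real.pi * ‖v - w‖) * g w

/-- The Newtonian potential `a[g] = (-Δ)⁻¹ g = (1 / (4π|v|)) ∗ g`. -/
def potential (g : V → ℝ) (v : V) : ℝ :=
  ∫ w, 1 / (4 * Real.pi * ‖v - w‖) * g w

/-- The flux `A[g] ∇g - g ∇a[g]`. -/
def flux (g : V → ℝ) (v : V) : V :=
  WithLp.toLp 2 fun i =>
    (∑ j, diffusionMatrix g v i j * gradient g v j) - g v * gradient (potential g) v i

/-- The divergence of a vector field on `ℝ³`. -/
def divergence (F : V → V) (v : V) : ℝ :=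
  ∑ i, fderiv ℝ (fun w => F w i) v (EuclideanSpace.single i 1)

/-- The Landau-Coulomb collision operator in divergence form,
`∇ · (A[g] ∇g - g ∇a[g])`. -/
def collision (g : V → ℝ) (v : V) : ℝ :=
  divergence (flux g) v

/-- `f ∈ C^∞(0, T; 𝓢(ℝ³))`: on the open interval `(0, T)`, the curve `f` has time derivatives of all
orders with respect to the Schwartz topology; `D n` is the derivative of order `n`. -/
def IsSmoothCurve (T : EReal) (f : ℝ → 𝓢(V, ℝ)) : Prop :=
  ∃ D : ℕ → ℝ → 𝓢(V, ℝ), D 0 = f ∧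
    ∀ n : ℕ, ∀ t : ℝ, 0 < t → (t : EReal) < T → HasDerivAt (D n) (D (n + 1) t) t

/-- `f` is a non-negative Schwartz class solution on `[0, T)`, `0 < T ≤ ∞`, of the Landau-Coulomb
equation `∂ₜ f = ∇ · (A[f] ∇f - f ∇a[f])` with initial datum `f_in`. The values of `f` outside of
`[0, T)` play no role. -/
structure IsSchwartzSolution (T : EReal) (f_in : 𝓢(V, ℝ)) (f : ℝ → 𝓢(V, ℝ)) : Prop where
  pos : 0 < T
  initial : f 0 = f_in
  nonneg : ∀ t : ℝ, 0 ≤ t → (t : EReal) < T → ∀ v, 0 ≤ f t v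
  continuous : ContinuousOn f {t : ℝ | 0 ≤ t ∧ (t : EReal) < T}
  smooth : IsSmoothCurve T f
  equation : ∀ t : ℝ, 0 < t → (t : EReal) < T → ∀ v,
    HasDerivAt (fun s => f s v) (collision (f t) v) t

/-- The normalization of mass, momentum and energy: `∫ (1, v, |v|²) g(v) dv = (1, 0, 3)`. -/
def IsNormalized (g : V → ℝ) : Prop :=
  ∫ v, g v = 1 ∧ ∫ v, g v • v = 0 ∧ ∫ v, ‖v‖ ^ 2 * g v = 3

/-- The Japanese bracket `⟨v⟩ = (1 + |v|²)^{1/2}`. -/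
def bracket (v : V) : ℝ := Real.sqrt (1 + ‖v‖ ^ 2)

/-- The norm of the weighted space `L¹ₘ(ℝ³)`: `∫ |g(v)| ⟨v⟩ᵐ dv`. -/
def weightedL1Norm (m : ℝ) (g : V → ℝ) : ℝ := ∫ v, |g v| * bracket v ^ m

/-- The quantity `∫ g |log g| dv`. -/
def absEntropy (g : V → ℝ) : ℝ := ∫ v, g v * |Real.log (g v)|

/-- The exponent `β = 2/3 - 3/m`. -/
def betaExp (m : ℝ) : ℝ := 2 / 3 - 3 / m

/-- The exponent `γ = (2(p - 3/2) / (3m)) [m - 9(p - 1) / (2(p - 3/2))]`. -/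
def gammaExp (p m : ℝ) : ℝ :=
  2 * (p - 3 / 2) / (3 * m) * (m - 9 * (p - 1) / (2 * (p - 3 / 2)))

/-- The control quantity `∫₀ᵗ ∫ f^{p+1} dv ds`. -/
def controlQuantity (p : ℝ) (f : ℝ → 𝓢(V, ℝ)) (t : ℝ) : ℝ :=
  ∫ s in (0 : ℝ)..t, ∫ v, f s v ^ (p + 1)

end LandauCoulomb

end

open LandauCoulomb

noncomputable section

open scoped LineDeriv

namespace LandauCoulomb

/-! ### Schwartz bounds, weights and convolutions with singular kernels -/

section

/-! The proof is a De Giorgi iteration on truncations of the solution. Its gain comes from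
interpolating against the `m`-th moment, so the ingredients are a priori bounds up to time one,
ellipticity, an energy inequality and a nonlinear recursion.

A priori bounds. Mass and energy are conserved and the entropy `H` does not increase. For the moment
`M_m`, the weak form of the collision operator is symmetrised in `(v, w)` and the kernel is split
into a regular and a singular part. The regular part is integrated by parts and costs `C M_m`. The
singular part lives on `|v - w| < 1`, where the increment of `∇⟨v⟩ᵐ` is `O(|v - w|)`. Young's
inequality against the entropy dissipation `D`, with a parameter of order `1 / M_m`, gives `M_m (D +
C)`. Thus `(log M_m + H)' ≤ C`: the dissipation cancels. Since `-H` is bounded by mass and energy,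
`M_m` stays bounded (`moment_production_le`, `IsSchwartzSolution.log_moment_add_entropy_le`,
`IsSchwartzSolution.bounds`). Because `f` may vanish, the score is taken as `∇f / (f + ε)`. The
errors are `O(ε^{1/4})` uniformly on compact time intervals, and `ε → 0` at the end.

Ellipticity. Bounded energy and entropy prevent the mass from concentrating at infinity or near a
line, hence `A[f] ≥ c ⟨v⟩⁻³` (`exists_coercive`).

Energy inequality. Let `Φ` be a truncated power vanishing below the level `κ`, with `G = √Φ`, `X = ∫
Φ(f)`, `P = ∫ (f Φ'(f) - Φ(f)) f`, and let `Z` be the square of the `L⁶` norm of `⟨v⟩^{-3/2} G(f)`.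
Ellipticity, `-Δa = c f` and Sobolev's inequality give `X' + c Z ≤ C (P + X)`
(`exists_energy_inequality`).

Interpolation. Hölder with exponents `1/3`, `β`, `3/m`, which add up to one by the choice of `β`,
yields `∫ G^{2+2β} f^{3/m} ≤ Z X^β M_m^{3/m}`, the velocity weights cancelling exactly. Above a
slightly higher level the integrand dominates a multiple of `f^{p+1+γ}`; this is the origin of `γ`.
So at levels comparable to `K` the next `X` and `P` are at most `K^{-1-γ}` and `K^{-γ}` times `Z
X^β`, up to geometric factors (`level_step`), while the first level is linear in `∫ f^{p+1}`
(`initial_step`).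

Iteration. Along levels increasing to `K` and times increasing to `t` the energies decay
geometrically (`deGiorgi_iteration`), provided `K^{-γ} (1 + 1/(Kt))^{1+β} A₀^β` is small. The
regimes `Kt ≥ 1` and `Kt < 1` produce the two terms of the estimate (`threshold_small`). Geometric
decay forces `f(t) ≤ K`. -/

/-- The partial derivative `∂ᵢ g` of a Schwartz function, as a Schwartz function. -/
def pd (i : Fin 3) (g : 𝓢(V, ℝ)) : 𝓢(V, ℝ) := ∂_{(EuclideanSpace.single i 1 : V)} g

theorem continuous_pd (i : Fin 3) : Continuous (pd i) :=
  (LineDeriv.lineDerivOpCLM ℝ 𝓢(V, ℝ) (EuclideanSpace.single i 1 : V)).continuous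

theorem sum_smul_single (w : V) : w = ∑ i, w i • (EuclideanSpace.single i 1 : V) := by
  ext j
  simp [Finset.sum_apply, Pi.single_apply]

theorem clm_apply_eq_sum (L : V →L[ℝ] ℝ) (w : V) :
    L w = ∑ i, L (EuclideanSpace.single i 1) * w i := by
  conv_lhs => rw [sum_smul_single w]
  simp [map_sum, mul_comm]

theorem fderiv_apply_eq_sum (g : 𝓢(V, ℝ)) (v w : V) :
    fderiv ℝ g v w = ∑ i, pd i g v * w i := clm_apply_eq_sum _ _

theorem gradient_apply {g : V → ℝ} (v : V) (i : Fin 3) :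
    gradient g v i = fderiv ℝ g v (EuclideanSpace.single i 1) := by
  have h : inner ℝ (gradient g v) (EuclideanSpace.single i (1 : ℝ)) =
      fderiv ℝ g v (EuclideanSpace.single i 1) := by
    rw [gradient, InnerProductSpace.toDual_symm_apply]
  rw [← h, EuclideanSpace.inner_single_right]
  simp

theorem schwartz_gradient_apply (g : 𝓢(V, ℝ)) (v : V) (i : Fin 3) :
    gradient g v i = pd i g v := gradient_apply v i

theorem inner_eq_sum (a b : V) : inner ℝ a b = ∑ i, a i * b i := by
  simp [PiLp.inner_apply, mul_comm]

theorem continuous_gradient (g : 𝓢(V, ℝ)) : Continuous (gradient g) := by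
  have h : gradient g = fun v => (WithLp.toLp 2 fun i => pd i g v : V) := by
    ext v i
    exact schwartz_gradient_apply g v i
  rw [h]
  exact (PiLp.continuous_toLp 2 _).comp (continuous_pi fun i => (pd i g).continuous)

/-- A continuous seminorm on Schwartz space controlling `(1 + |v|)^N |g(v)|`. -/
def bd (N : ℕ) (g : 𝓢(V, ℝ)) : ℝ :=
  2 ^ N * ∑ m ∈ Finset.Iic (N, 0), SchwartzMap.seminorm ℝ m.1 m.2 g

theorem bd_nonneg (N : ℕ) (g : 𝓢(V, ℝ)) : 0 ≤ bd N g :=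
  mul_nonneg (by positivity) (Finset.sum_nonneg fun _ _ => apply_nonneg _ _)

theorem continuous_bd (N : ℕ) : Continuous (bd N) := by
  refine continuous_const.mul ?_
  exact continuous_finsetSum _ fun m _ =>
    (schwartz_withSeminorms ℝ V ℝ).continuous_seminorm m

theorem mul_abs_le_bd (N : ℕ) (g : 𝓢(V, ℝ)) (v : V) : (1 + ‖v‖) ^ N * |g v| ≤ bd N g := by
  have := SchwartzMap.one_add_le_sup_seminorm_apply (𝕜 := ℝ) (m := (N, 0)) le_rfl le_rfl g v
  have h2 := Seminorm.finset_sup_le_sum (fun m : ℕ × ℕ => SchwartzMap.seminorm ℝ m.1 m.2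
    (E := V) (F := ℝ)) (Finset.Iic (N, 0)) g
  rw [norm_iteratedFDeriv_zero, Real.norm_eq_abs] at this
  refine this.trans (mul_le_mul_of_nonneg_left ?_ (by positivity))
  simpa using h2

theorem abs_le_bd_mul (N : ℕ) (g : 𝓢(V, ℝ)) (v : V) : |g v| ≤ bd N g * ((1 + ‖v‖) ^ N)⁻¹ := by
  rw [← div_eq_mul_inv, le_div_iff₀ (by positivity), mul_comm]
  exact mul_abs_le_bd N g v

/-- The integrable weight `(1 + |v|)⁻⁴`. -/
def wt (v : V) : ℝ := ((1 + ‖v‖) ^ 4)⁻¹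

theorem wt_pos (v : V) : 0 < wt v := by unfold wt; positivity

theorem wt_le_one (v : V) : wt v ≤ 1 := by
  unfold wt
  apply inv_le_one_of_one_le₀
  apply one_le_pow₀
  linarith [norm_nonneg v]

theorem continuous_wt : Continuous wt := by
  unfold wt
  refine Continuous.inv₀ (by fun_prop) fun v => ?_
  positivity

theorem integrable_wt : Integrable wt := by
  have h := integrable_one_add_norm (E := V) (μ := volume) (r := 4) (by simp; norm_num)
  refine h.congr (Filter.Eventually.of_forall fun v => ?_)
  simp only [wt]
  rw [Real.rpow_neg (by positivity)]
  norm_cast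

theorem abs_le_bd_wt (g : 𝓢(V, ℝ)) (v : V) : |g v| ≤ bd 4 g * wt v := abs_le_bd_mul 4 g v

/-- In polar coordinates of `ℝ³` the integrand becomes `r² · r⁻¹ = r`. -/
theorem integrableOn_inv_norm : IntegrableOn (fun z : V => ‖z‖⁻¹) (Metric.ball 0 1) := by
  rw [integrableOn_fun_norm_addHaar (E := V) volume (f := fun y => y⁻¹)]
  have : IntegrableOn (fun y : ℝ => y) (Set.Ioo 0 1) :=
    (continuous_id.integrableOn_Icc (a := 0) (b := 1)).mono_set Set.Ioo_subset_Icc_self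
  refine this.congr_fun (fun y hy => ?_) measurableSet_Ioo
  have hy0 : y ≠ 0 := hy.1.ne'
  simp
  field_simp

/-- An upper bound for `sup_v ∫ |v - w|⁻¹ (1 + |w|)⁻⁴ dw`. -/
def rieszConst : ℝ := (∫ z in Metric.ball (0 : V) 1, ‖z‖⁻¹) + ∫ z, wt z

/-- Near `v` the weight is at most one and the singularity is integrable; away from `v` the kernel
is at most one and the weight is integrable. The resulting bound has an integral independent of `v`.
-/
theorem inv_norm_mul_wt_le (v w : V) :
    ‖v - w‖⁻¹ * wt w ≤ (Metric.ball (0 : V) 1).indicator (fun z => ‖z‖⁻¹) (v - w) + wt w := by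
  by_cases h : v - w ∈ Metric.ball (0 : V) 1
  · rw [Set.indicator_of_mem h]
    have := mul_le_mul_of_nonneg_left (wt_le_one w) (inv_nonneg.2 (norm_nonneg (v - w)))
    linarith [wt_pos w]
  · rw [Set.indicator_of_notMem h]
    simp only [mem_ball_zero_iff, not_lt] at h
    have := mul_le_mul_of_nonneg_right (inv_le_one_of_one_le₀ h) (wt_pos w).le
    linarith

theorem measurable_inv_norm_sub (v : V) : Measurable fun w : V => ‖v - w‖⁻¹ := by fun_prop

theorem integrable_inv_norm_dom (v : V) : Integrable fun w =>
    (Metric.ball (0 : V) 1).indicator (fun z => ‖z‖⁻¹) (v - w) + wt w := by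
  refine Integrable.add ?_ integrable_wt
  exact (integrableOn_inv_norm.integrable_indicator measurableSet_ball).comp_sub_left v

theorem integrable_inv_norm_mul_wt (v : V) : Integrable fun w => ‖v - w‖⁻¹ * wt w := by
  refine (integrable_inv_norm_dom v).mono'
    ((measurable_inv_norm_sub v).mul continuous_wt.measurable).aestronglyMeasurable
    (Filter.Eventually.of_forall fun w => ?_)
  rw [Real.norm_of_nonneg (mul_nonneg (by positivity) (wt_pos w).le)]
  exact inv_norm_mul_wt_le v w

theorem integral_inv_norm_mul_wt_le (v : V) : ∫ w, ‖v - w‖⁻¹ * wt w ≤ rieszConst := by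
  refine (integral_mono (integrable_inv_norm_mul_wt v) (integrable_inv_norm_dom v)
    (inv_norm_mul_wt_le v)).trans ?_
  rw [integral_add ((integrableOn_inv_norm.integrable_indicator measurableSet_ball).comp_sub_left v)
    integrable_wt, integral_sub_left_eq_self (fun z => (Metric.ball (0 : V) 1).indicator
      (fun z => ‖z‖⁻¹) z) volume v, integral_indicator measurableSet_ball]
  rfl

/-- The common dominating function for all double integrals in the symmetrised weak forms. -/
theorem integrable_prod_wt :
    Integrable (fun x : V × V => wt x.1 * wt x.2 * ‖x.1 - x.2‖⁻¹) (volume.prod volume) := by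
  have hm : Measurable (fun x : V × V => wt x.1 * wt x.2 * ‖x.1 - x.2‖⁻¹) := by
    have := continuous_wt.measurable
    fun_prop
  rw [integrable_prod_iff hm.aestronglyMeasurable]
  have e : ∀ v w : V, wt v * wt w * ‖v - w‖⁻¹ = wt v * (‖v - w‖⁻¹ * wt w) := fun v w => by ring
  constructor
  · refine Filter.Eventually.of_forall fun v => ?_
    simp only [e]
    exact (integrable_inv_norm_mul_wt v).const_mul _
  · refine (integrable_wt.mul_const rieszConst).mono'
      hm.norm.stronglyMeasurable.integral_prod_right'.aestronglyMeasurable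
      (Filter.Eventually.of_forall fun v => ?_)
    have hn : ∀ w, ‖wt v * wt w * ‖v - w‖⁻¹‖ = wt v * (‖v - w‖⁻¹ * wt w) := fun w => by
      rw [Real.norm_of_nonneg, e]
      have := wt_pos v
      have := wt_pos w
      positivity
    simp only [hn]
    rw [integral_const_mul, Real.norm_of_nonneg]
    · exact mul_le_mul_of_nonneg_left (integral_inv_norm_mul_wt_le v) (wt_pos v).le
    · exact mul_nonneg (wt_pos v).le (integral_nonneg fun w =>
        mul_nonneg (by positivity) (wt_pos w).le)

/-- The convolution `∫ k(v - w) g(w) dw`. -/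
def cnv (k : V → ℝ) (g : V → ℝ) (v : V) : ℝ := ∫ w, k (v - w) * g w

/-- A measurable kernel bounded by `c / |z|`. -/
structure IsKernel (c : ℝ) (k : V → ℝ) : Prop where
  meas : Measurable k
  bound : ∀ z, |k z| ≤ c * ‖z‖⁻¹

variable {c : ℝ} {k : V → ℝ}

theorem IsKernel.abs_mul_le (hk : IsKernel c k) (g : 𝓢(V, ℝ)) (v w : V) :
    ‖k (v - w) * g w‖ ≤ c * bd 4 g * (‖v - w‖⁻¹ * wt w) := by
  rw [Real.norm_eq_abs, abs_mul]
  calc |k (v - w)| * |g w| ≤ (c * ‖v - w‖⁻¹) * (bd 4 g * wt w) :=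
        mul_le_mul (hk.bound _) (abs_le_bd_wt g w) (abs_nonneg _)
          ((abs_nonneg _).trans (hk.bound _))
    _ = _ := by ring

theorem IsKernel.integrable (hk : IsKernel c k) (g : 𝓢(V, ℝ)) (v : V) :
    Integrable fun w => k (v - w) * g w := by
  have := hk.meas
  have := g.continuous.measurable
  exact ((integrable_inv_norm_mul_wt v).const_mul _).mono'
    (by fun_prop) (Filter.Eventually.of_forall (hk.abs_mul_le g v))

theorem IsKernel.abs_cnv_le (hk : IsKernel c k) (hc : 0 ≤ c) (g : 𝓢(V, ℝ)) (v : V) :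
    |cnv k g v| ≤ c * bd 4 g * rieszConst := by
  refine (norm_integral_le_of_norm_le ((integrable_inv_norm_mul_wt v).const_mul _)
    (Filter.Eventually.of_forall (hk.abs_mul_le g v))).trans ?_
  rw [integral_const_mul]
  exact mul_le_mul_of_nonneg_left (integral_inv_norm_mul_wt_le v) (mul_nonneg hc (bd_nonneg _ _))

/-- Moves the dependence on `v` to the smooth factor, so that derivatives in `v` never meet the
singularity of the kernel. -/
theorem cnv_eq (k g : V → ℝ) (v : V) : cnv k g v = ∫ z, k z * g (v - z) := by
  rw [cnv, ← integral_sub_left_eq_self (fun z => k z * g (v - z)) volume v]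
  simp

theorem norm_clm_le (L : V →L[ℝ] ℝ) : ‖L‖ ≤ ∑ i, |L (EuclideanSpace.single i 1)| := by
  refine L.opNorm_le_bound (Finset.sum_nonneg fun _ _ => abs_nonneg _) fun w => ?_
  rw [clm_apply_eq_sum, Finset.sum_mul]
  refine (Finset.abs_sum_le_sum_abs _ _).trans (Finset.sum_le_sum fun i _ => ?_)
  rw [abs_mul]
  exact mul_le_mul_of_nonneg_left (PiLp.norm_apply_le w i) (abs_nonneg _)

theorem norm_fderiv_le (g : 𝓢(V, ℝ)) (v : V) :
    ‖fderiv ℝ g v‖ ≤ (∑ i, bd 4 (pd i g)) * wt v := by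
  refine (norm_clm_le _).trans ?_
  rw [Finset.sum_mul]
  exact Finset.sum_le_sum fun i _ => abs_le_bd_wt (pd i g) v

/-- Makes the domination uniform for `v` near `v₀`; the constant is `2⁴`. -/
theorem wt_le_of_mem_ball {v v₀ : V} (h : v ∈ Metric.ball v₀ 1) (z : V) :
    wt (v - z) ≤ 16 * wt (v₀ - z) := by
  have h1 : ‖v₀ - z‖ ≤ 1 + ‖v - z‖ := by
    have h2 : ‖v₀ - v‖ < 1 := by rwa [mem_ball_iff_norm'] at h
    have h3 : v₀ - z = (v₀ - v) + (v - z) := by abel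
    rw [h3]
    exact (norm_add_le _ _).trans (by linarith)
  unfold wt
  rw [inv_le_iff_one_le_mul₀ (by positivity)]
  rw [mul_assoc, mul_comm _ ((1 + ‖v - z‖) ^ 4), ← mul_assoc, ← div_eq_mul_inv,
    le_div_iff₀ (by positivity), one_mul]
  calc (1 + ‖v₀ - z‖) ^ 4 ≤ (2 * (1 + ‖v - z‖)) ^ 4 := by
        gcongr
        linarith [norm_nonneg (v - z)]
    _ = _ := by ring

/-- Differentiation under the integral with the derivative falling on `g`: only the bound `c / |z|`
on the kernel is used, and the derivative is again a convolution with the same kernel. -/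
theorem IsKernel.hasFDerivAt_cnv (hk : IsKernel c k) (hc : 0 ≤ c) (g : 𝓢(V, ℝ)) (v₀ : V) :
    HasFDerivAt (cnv k g) (∑ i, cnv k (pd i g) v₀ • (EuclideanSpace.proj i : V →L[ℝ] ℝ)) v₀ := by
  have hkm := hk.meas
  have hgm := g.continuous.measurable
  have key : HasFDerivAt (fun v => ∫ z, k z * g (v - z))
      (∫ z, k z • fderiv ℝ g (v₀ - z)) v₀ := by
    refine hasFDerivAt_integral_of_dominated_of_fderiv_le (𝕜 := ℝ)
      (F := fun v z => k z * g (v - z)) (F' := fun v z => k z • fderiv ℝ g (v - z))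
      -- The variable `z` is written as `v₀ - (v₀ - z)` so that the bound is a reflected copy of a
      -- function already known to be integrable.
      (bound := fun z => 16 * c * (∑ i, bd 4 (pd i g)) * (‖v₀ - (v₀ - z)‖⁻¹ * wt (v₀ - z)))
      (Metric.ball_mem_nhds v₀ one_pos) ?_ ?_ ?_ ?_ ?_ ?_
    · exact Filter.Eventually.of_forall fun v => by fun_prop
    · have := (hk.integrable g v₀).comp_sub_left v₀
      simpa using this
    · have : Continuous (fderiv ℝ g) := (SchwartzMap.fderivCLM ℝ V ℝ g).continuous
      exact (hkm.aestronglyMeasurable).smul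
        ((this.comp (continuous_const.sub continuous_id)).aestronglyMeasurable)
    · refine Filter.Eventually.of_forall fun z v hv => ?_
      rw [norm_smul]
      calc ‖k z‖ * ‖fderiv ℝ g (v - z)‖
          ≤ (c * ‖z‖⁻¹) * ((∑ i, bd 4 (pd i g)) * (16 * wt (v₀ - z))) := by
            refine mul_le_mul (hk.bound z) ((norm_fderiv_le g _).trans ?_) (norm_nonneg _)
              (by positivity)
            exact mul_le_mul_of_nonneg_left (wt_le_of_mem_ball hv z)
              (Finset.sum_nonneg fun i _ => bd_nonneg _ _)
        _ = _ := by rw [sub_sub_cancel]; ring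
    · exact ((integrable_inv_norm_mul_wt v₀).comp_sub_left v₀).const_mul _
    · refine Filter.Eventually.of_forall fun z v _ => ?_
      have h1 : HasFDerivAt (fun v => g (v - z)) (fderiv ℝ g (v - z)) v := by
        have h2 := (g.hasFDerivAt (v - z)).comp v ((hasFDerivAt_id v).sub_const z)
        rwa [ContinuousLinearMap.comp_id] at h2
      exact h1.const_mul (k z)
  have e : cnv k g = fun v => ∫ z, k z * g (v - z) := funext fun v => cnv_eq k g v
  rw [e]
  convert key using 1
  have hint : Integrable fun z => k z • fderiv ℝ g (v₀ - z) := by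
    have : Continuous (fderiv ℝ g) := (SchwartzMap.fderivCLM ℝ V ℝ g).continuous
    refine (((integrable_inv_norm_mul_wt v₀).comp_sub_left v₀).const_mul
      (c * (∑ i, bd 4 (pd i g)))).mono' ((hkm.aestronglyMeasurable).smul
        ((this.comp (continuous_const.sub continuous_id)).aestronglyMeasurable))
      (Filter.Eventually.of_forall fun z => ?_)
    rw [norm_smul]
    calc ‖k z‖ * ‖fderiv ℝ g (v₀ - z)‖ ≤ (c * ‖z‖⁻¹) * ((∑ i, bd 4 (pd i g)) * wt (v₀ - z)) :=
          mul_le_mul (hk.bound z) (norm_fderiv_le g _) (norm_nonneg _) (by positivity)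
      _ = _ := by rw [sub_sub_cancel]; ring
  ext w
  rw [ContinuousLinearMap.integral_apply hint]
  simp only [sum_apply, smul_apply, smul_eq_mul,
    fderiv_apply_eq_sum, Finset.mul_sum]
  rw [integral_finsetSum]
  · refine Finset.sum_congr rfl fun i _ => ?_
    rw [cnv_eq, ← integral_mul_const]
    simp only [mul_assoc]
    rfl
  · intro i _
    have := ((hk.integrable (pd i g) v₀).comp_sub_left v₀).mul_const (w i)
    simpa [mul_assoc] using this

end

/-! ### Functions of polynomial growth and integration by parts -/

section

/-- Measurable functions of at most polynomial growth. -/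
structure Tame (k : V → ℝ) : Prop where
  meas : Measurable k
  bound : ∃ C : ℝ, ∃ N : ℕ, 0 ≤ C ∧ ∀ v, |k v| ≤ C * (1 + ‖v‖) ^ N

theorem Tame.of_bounded {k : V → ℝ} (hk : Measurable k) {C : ℝ} (h : ∀ v, |k v| ≤ C) : Tame k :=
  ⟨hk, C, 0, (abs_nonneg _).trans (h 0), by simpa using h⟩

theorem tame_const (c : ℝ) : Tame fun _ => c := .of_bounded measurable_const fun _ => le_rfl

theorem tame_schwartz (g : 𝓢(V, ℝ)) : Tame g :=
  .of_bounded g.continuous.measurable fun v => by simpa using mul_abs_le_bd 0 g v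

theorem tame_coord (i : Fin 3) : Tame fun v : V => v i :=
  ⟨by fun_prop, 1, 1, zero_le_one, fun v => by
    have := PiLp.norm_apply_le v i
    rw [Real.norm_eq_abs] at this
    simp only [pow_one, one_mul]
    linarith⟩

theorem tame_norm : Tame fun v : V => ‖v‖ :=
  ⟨by fun_prop, 1, 1, zero_le_one, fun v => by simp⟩

theorem one_add_norm_pow_le (v : V) {M N : ℕ} (h : M ≤ N) : (1 + ‖v‖) ^ M ≤ (1 + ‖v‖) ^ N :=
  pow_le_pow_right₀ (by linarith [norm_nonneg v]) h

theorem Tame.add {k l : V → ℝ} (hk : Tame k) (hl : Tame l) : Tame fun v => k v + l v := by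
  obtain ⟨C, N, hC, h⟩ := hk.bound
  obtain ⟨D, M, hD, h'⟩ := hl.bound
  refine ⟨hk.meas.add hl.meas, C + D, max N M, by positivity, fun v => ?_⟩
  rw [add_mul]
  refine (abs_add_le _ _).trans (add_le_add ((h v).trans ?_) ((h' v).trans ?_))
  · exact mul_le_mul_of_nonneg_left (one_add_norm_pow_le v (le_max_left _ _)) hC
  · exact mul_le_mul_of_nonneg_left (one_add_norm_pow_le v (le_max_right _ _)) hD

theorem Tame.mul {k l : V → ℝ} (hk : Tame k) (hl : Tame l) : Tame fun v => k v * l v := by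
  obtain ⟨C, N, hC, h⟩ := hk.bound
  obtain ⟨D, M, hD, h'⟩ := hl.bound
  refine ⟨hk.meas.mul hl.meas, C * D, N + M, by positivity, fun v => ?_⟩
  rw [abs_mul, pow_add]
  calc |k v| * |l v| ≤ (C * (1 + ‖v‖) ^ N) * (D * (1 + ‖v‖) ^ M) :=
        mul_le_mul (h v) (h' v) (abs_nonneg _) (by positivity)
    _ = _ := by ring

theorem Tame.neg {k : V → ℝ} (hk : Tame k) : Tame fun v => - k v := by
  simpa using (tame_const (-1)).mul hk

theorem Tame.sub {k l : V → ℝ} (hk : Tame k) (hl : Tame l) : Tame fun v => k v - l v := by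
  simpa [sub_eq_add_neg] using hk.add hl.neg

theorem Tame.pow {k : V → ℝ} (hk : Tame k) (n : ℕ) : Tame fun v => k v ^ n := by
  induction n with
  | zero => simpa using tame_const 1
  | succ n ih => simpa [pow_succ] using ih.mul hk

theorem Tame.sum {ι : Type*} (s : Finset ι) {k : ι → V → ℝ} (hk : ∀ i, Tame (k i)) :
    Tame fun v => ∑ i ∈ s, k i v := by
  classical
  induction s using Finset.induction_on with
  | empty => simpa using tame_const 0
  | insert a s ha ih => simpa [Finset.sum_insert ha] using (hk a).add ih

theorem Tame.of_le {k l : V → ℝ} (hl : Tame l) (hk : Measurable k) (h : ∀ v, |k v| ≤ |l v|) :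
    Tame k := by
  obtain ⟨C, N, hC, h'⟩ := hl.bound
  exact ⟨hk, C, N, hC, fun v => (h v).trans (h' v)⟩

theorem Tame.comp_sub_left {k : V → ℝ} (hk : Tame k) (v : V) : Tame fun w => k (v - w) := by
  obtain ⟨C, N, hC, h⟩ := hk.bound
  refine ⟨hk.meas.comp (measurable_const.sub measurable_id), C * (1 + ‖v‖) ^ N, N, by positivity,
    fun w => (h _).trans ?_⟩
  rw [mul_assoc, ← mul_pow]
  have := norm_sub_le v w
  gcongr
  nlinarith [norm_nonneg v, norm_nonneg w]

theorem Tame.exists_mul_le {k : V → ℝ} (hk : Tame k) (g : 𝓢(V, ℝ)) :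
    ∃ C, 0 ≤ C ∧ ∀ v, |k v * g v| ≤ C * wt v := by
  obtain ⟨C, N, hC, h⟩ := hk.bound
  refine ⟨C * bd (N + 4) g, mul_nonneg hC (bd_nonneg _ _), fun v => ?_⟩
  rw [abs_mul]
  calc |k v| * |g v| ≤ (C * (1 + ‖v‖) ^ N) * (bd (N + 4) g * ((1 + ‖v‖) ^ (N + 4))⁻¹) :=
        mul_le_mul (h v) (abs_le_bd_mul _ g v) (abs_nonneg _) (by positivity)
    _ = _ := by
      rw [wt, pow_add]
      have : (1 + ‖v‖) ≠ 0 := by positivity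
      field_simp

theorem Tame.integrable_mul {k : V → ℝ} (hk : Tame k) (g : 𝓢(V, ℝ)) :
    Integrable fun v => k v * g v := by
  obtain ⟨C, _, h⟩ := hk.exists_mul_le g
  exact (integrable_wt.const_mul C).mono' (hk.meas.mul g.continuous.measurable).aestronglyMeasurable
    (Filter.Eventually.of_forall h)

/-- The linear form with coefficients `a`. -/
def dualForm (a : Fin 3 → ℝ) : V →L[ℝ] ℝ := ∑ i, a i • (EuclideanSpace.proj i : V →L[ℝ] ℝ)

theorem dualForm_apply (a : Fin 3 → ℝ) (w : V) : dualForm a w = ∑ i, a i * w i := by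
  simp [dualForm, sum_apply]

@[simp] theorem dualForm_single (a : Fin 3 → ℝ) (i : Fin 3) :
    dualForm a (EuclideanSpace.single i 1) = a i := by
  simp [dualForm_apply]

/-- `k` is differentiable on `ℝ³` with partial derivatives `k'`. -/
def HasGrad (k : V → ℝ) (k' : V → Fin 3 → ℝ) : Prop := ∀ v, HasFDerivAt k (dualForm (k' v)) v

theorem HasGrad.fderiv_single {k : V → ℝ} {k' : V → Fin 3 → ℝ} (h : HasGrad k k') (v : V)
    (i : Fin 3) : fderiv ℝ k v (EuclideanSpace.single i 1) = k' v i := by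
  rw [(h v).fderiv, dualForm_single]

theorem HasGrad.congr {k : V → ℝ} {k' l' : V → Fin 3 → ℝ} (h : HasGrad k k')
    (e : ∀ v i, k' v i = l' v i) : HasGrad k l' := by
  have : k' = l' := by
    ext v i
    exact e v i
  rwa [← this]

theorem dualForm_of_clm (L : V →L[ℝ] ℝ) : dualForm (fun i => L (EuclideanSpace.single i 1)) = L := by
  ext w
  rw [dualForm_apply, clm_apply_eq_sum L w]

theorem HasGrad.of_hasFDerivAt {k : V → ℝ} {L : V → V →L[ℝ] ℝ} (h : ∀ v, HasFDerivAt k (L v) v) :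
    HasGrad k fun v i => L v (EuclideanSpace.single i 1) := fun v => by
  simpa [dualForm_of_clm] using h v

theorem hasGrad_schwartz (g : 𝓢(V, ℝ)) : HasGrad g fun v i => pd i g v :=
  HasGrad.of_hasFDerivAt g.hasFDerivAt

theorem hasGrad_const (c : ℝ) : HasGrad (fun _ => c) fun _ _ => 0 :=
  (HasGrad.of_hasFDerivAt fun v => hasFDerivAt_const c v).congr (by simp)

theorem hasGrad_coord (j : Fin 3) : HasGrad (fun v => v j) fun _ i => if i = j then 1 else 0 :=
  (HasGrad.of_hasFDerivAt fun v => (EuclideanSpace.proj j : V →L[ℝ] ℝ).hasFDerivAt).congr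
    fun v i => by simp [eq_comm]

theorem HasGrad.add {k l : V → ℝ} {k' l' : V → Fin 3 → ℝ} (hk : HasGrad k k') (hl : HasGrad l l') :
    HasGrad (fun v => k v + l v) fun v i => k' v i + l' v i :=
  (HasGrad.of_hasFDerivAt fun v => (hk v).add (hl v)).congr (by simp)

theorem HasGrad.sub {k l : V → ℝ} {k' l' : V → Fin 3 → ℝ} (hk : HasGrad k k') (hl : HasGrad l l') :
    HasGrad (fun v => k v - l v) fun v i => k' v i - l' v i :=
  (HasGrad.of_hasFDerivAt fun v => (hk v).sub (hl v)).congr (by simp)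

theorem HasGrad.mul {k l : V → ℝ} {k' l' : V → Fin 3 → ℝ} (hk : HasGrad k k') (hl : HasGrad l l') :
    HasGrad (fun v => k v * l v) fun v i => k v * l' v i + l v * k' v i :=
  (HasGrad.of_hasFDerivAt fun v => (hk v).mul (hl v)).congr (by simp)

theorem HasGrad.sum {ι : Type*} (s : Finset ι) {k : ι → V → ℝ} {k' : ι → V → Fin 3 → ℝ}
    (hk : ∀ i, HasGrad (k i) (k' i)) :
    HasGrad (fun v => ∑ j ∈ s, k j v) fun v i => ∑ j ∈ s, k' j v i :=
  (HasGrad.of_hasFDerivAt fun v => HasFDerivAt.fun_sum fun j _ => hk j v).congr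
    (by simp [sum_apply])

theorem HasGrad.comp {k : V → ℝ} {k' : V → Fin 3 → ℝ} (hk : HasGrad k k') {φ φ' : ℝ → ℝ}
    (hφ : ∀ v, HasDerivAt φ (φ' (k v)) (k v)) :
    HasGrad (fun v => φ (k v)) fun v i => φ' (k v) * k' v i :=
  (HasGrad.of_hasFDerivAt fun v => (hφ v).comp_hasFDerivAt v (hk v)).congr (by simp)

theorem HasGrad.comp_sub_const {k : V → ℝ} {k' : V → Fin 3 → ℝ} (hk : HasGrad k k') (w : V) :
    HasGrad (fun v => k (v - w)) fun v i => k' (v - w) i := fun v => by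
  have h := (hk (v - w)).comp v ((hasFDerivAt_id v).sub_const w)
  rwa [ContinuousLinearMap.comp_id] at h

theorem HasGrad.comp_sub_left {k : V → ℝ} {k' : V → Fin 3 → ℝ} (hk : HasGrad k k') (v : V) :
    HasGrad (fun w => k (v - w)) fun w i => - k' (v - w) i :=
  (HasGrad.of_hasFDerivAt fun w =>
    (hk (v - w)).comp w ((hasFDerivAt_id w).const_sub v)).congr (by simp)

theorem HasGrad.continuous {k : V → ℝ} {k' : V → Fin 3 → ℝ} (hk : HasGrad k k') : Continuous k :=
  continuous_iff_continuousAt.2 fun v => (hk v).continuousAt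

theorem hasGrad_norm_sq : HasGrad (fun v => ‖v‖ ^ 2) fun v i => 2 * v i :=
  (HasGrad.of_hasFDerivAt fun v => (hasStrictFDerivAt_norm_sq v).hasFDerivAt).congr fun v i => by
    simp [EuclideanSpace.inner_single_right]

theorem IsKernel.hasGrad_cnv {c : ℝ} {k : V → ℝ} (hk : IsKernel c k) (hc : 0 ≤ c) (g : 𝓢(V, ℝ)) :
    HasGrad (cnv k g) fun v i => cnv k (pd i g) v := hk.hasFDerivAt_cnv hc g

theorem IsKernel.tame_cnv {c : ℝ} {k : V → ℝ} (hk : IsKernel c k) (hc : 0 ≤ c) (g : 𝓢(V, ℝ)) :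
    Tame (cnv k g) :=
  .of_bounded (hk.hasGrad_cnv hc g).continuous.measurable (hk.abs_cnv_le hc g)

/-- Integration by parts in direction `i`. -/
theorem integral_mul_partial {k l : V → ℝ} {k' l' : V → Fin 3 → ℝ} (hk : HasGrad k k')
    (hl : HasGrad l l') (i : Fin 3) (h1 : Integrable fun v => k v * l v)
    (h2 : Integrable fun v => k' v i * l v) (h3 : Integrable fun v => k v * l' v i) :
    ∫ v, k v * l' v i = - ∫ v, k' v i * l v := by
  have := integral_mul_fderiv_eq_neg_fderiv_mul_of_integrable (μ := (volume : Measure V))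
    (f := k) (g := l) (v := EuclideanSpace.single i 1)
    (by simpa only [hk.fderiv_single] using h2) (by simpa only [hl.fderiv_single] using h3) h1
    (fun v _ => (hk v).differentiableAt) (fun v _ => (hl v).differentiableAt)
  simpa only [hk.fderiv_single, hl.fderiv_single] using this

theorem integral_mul_pd {k : V → ℝ} {k' : V → Fin 3 → ℝ} (hk : HasGrad k k') (i : Fin 3)
    (htk : Tame k) (htk' : Tame fun v => k' v i) (g : 𝓢(V, ℝ)) :
    ∫ v, k v * pd i g v = - ∫ v, k' v i * g v :=
  integral_mul_partial hk (hasGrad_schwartz g) i (htk.integrable_mul g) (htk'.integrable_mul g)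
    (htk.integrable_mul (pd i g))

/-- Transfers a derivative from `g` to the kernel. It requires a differentiable kernel, hence the
regularisation by `δ` below. -/
theorem cnv_pd_eq {k : V → ℝ} {k' : V → Fin 3 → ℝ} (hk : HasGrad k k') (i : Fin 3)
    (htk : Tame k) (htk' : Tame fun v => k' v i) (g : 𝓢(V, ℝ)) (v : V) :
    cnv k (pd i g) v = cnv (fun z => k' z i) g v := by
  have := integral_mul_pd (hk.comp_sub_left v) i (htk.comp_sub_left v)
    ((htk'.comp_sub_left v).neg) g
  rw [cnv, this, cnv, ← integral_neg]
  simp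

/-! ### Regularised kernels and their differential identities -/

/-- `(|z|² + δ²)ᵃ`. -/
def regPow (δ a : ℝ) (z : V) : ℝ := (‖z‖ ^ 2 + δ ^ 2) ^ a

theorem hasGrad_regPow {δ : ℝ} (hδ : 0 < δ) (a : ℝ) :
    HasGrad (regPow δ a) fun z i => 2 * a * z i * regPow δ (a - 1) z := by
  have h := (hasGrad_norm_sq.add (hasGrad_const (δ ^ 2))).comp (φ := fun x => x ^ a)
    (φ' := fun x => a * x ^ (a - 1)) fun v => Real.hasDerivAt_rpow_const (Or.inl (by positivity))
  refine HasGrad.congr h fun v i => ?_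
  simp only [regPow]
  ring

theorem regPow_nonneg (δ a : ℝ) (z : V) : 0 ≤ regPow δ a z := by unfold regPow; positivity

theorem tame_regPow {δ : ℝ} (hδ : 0 < δ) {a : ℝ} (ha : a ≤ 0) : Tame (regPow δ a) := by
  refine .of_bounded (C := (δ ^ 2) ^ a) (hasGrad_regPow hδ a).continuous.measurable fun z => ?_
  rw [abs_of_nonneg (regPow_nonneg _ _ _)]
  exact Real.rpow_le_rpow_of_nonpos (by positivity) (by linarith [sq_nonneg ‖z‖]) ha

theorem sq_mul_regPow {δ : ℝ} (hδ : 0 < δ) (a : ℝ) (z : V) :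
    (‖z‖ ^ 2 + δ ^ 2) * regPow δ (a - 1) z = regPow δ a z := by
  unfold regPow
  have h : 0 < ‖z‖ ^ 2 + δ ^ 2 := by positivity
  rw [mul_comm, Real.rpow_sub_one h.ne', div_mul_cancel₀ _ h.ne']

/-- The regularized diffusion kernel, without the factor `1 / (8π)`. -/
def regK (δ : ℝ) (i j : Fin 3) (z : V) : ℝ :=
  ((if i = j then 1 else 0) * ‖z‖ ^ 2 - z i * z j) * regPow δ (-3 / 2) z

theorem hasGrad_regK {δ : ℝ} (hδ : 0 < δ) (i j : Fin 3) :
    HasGrad (regK δ i j) fun z l =>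
      ((if i = j then 1 else 0) * ‖z‖ ^ 2 - z i * z j) * (2 * (-3 / 2) * z l *
        regPow δ (-3 / 2 - 1) z) + regPow δ (-3 / 2) z * ((if i = j then 1 else 0) * (2 * z l) -
          (z i * (if l = j then 1 else 0) + z j * (if l = i then 1 else 0))) := by
  refine HasGrad.congr (((((hasGrad_const (if i = j then 1 else 0)).mul hasGrad_norm_sq).sub
    ((hasGrad_coord i).mul (hasGrad_coord j)))).mul (hasGrad_regPow hδ (-3 / 2))) fun v l => ?_
  simp

theorem sum_fin_three_norm_sq (z : V) : ‖z‖ ^ 2 = z 0 ^ 2 + z 1 ^ 2 + z 2 ^ 2 := by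
  rw [EuclideanSpace.real_norm_sq_eq, Fin.sum_univ_three]

/-- The matrix `|z|² Id - z ⊗ z` annihilates `z`, so the derivative of the radial factor contributes
nothing; its own row divergence is `2zᵢ - 4zᵢ = -2zᵢ`. Hence the identity is exact for every `δ`,
with no remainder to pass to the limit. -/
theorem sum_regK_partial {δ : ℝ} (i : Fin 3) (z : V) :
    ∑ j, (((if i = j then 1 else 0) * ‖z‖ ^ 2 - z i * z j) * (2 * (-3 / 2) * z j *
        regPow δ (-3 / 2 - 1) z) + regPow δ (-3 / 2) z * ((if i = j then 1 else 0) * (2 * z j) -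
          (z i * (if j = j then 1 else 0) + z j * (if j = i then 1 else 0)))) =
      - 2 * z i * regPow δ (-3 / 2) z := by
  rw [sum_fin_three_norm_sq]
  fin_cases i <;> simp [Fin.sum_univ_three] <;> ring

theorem cnv_finset_sum {ι : Type*} (s : Finset ι) {k : ι → V → ℝ} (g : 𝓢(V, ℝ)) (v : V)
    (h : ∀ i, Integrable fun w => k i (v - w) * g w) :
    ∑ i ∈ s, cnv (k i) g v = cnv (fun z => ∑ i ∈ s, k i z) g v := by
  simp only [cnv, Finset.sum_mul]
  rw [integral_finsetSum _ fun i _ => h i]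

theorem cnv_const_mul (c : ℝ) (k g : V → ℝ) (v : V) :
    cnv (fun z => c * k z) g v = c * cnv k g v := by
  simp only [cnv, mul_assoc, integral_const_mul]

theorem tame_ite (i j : Fin 3) : Tame fun _ => if i = j then (1 : ℝ) else 0 := tame_const _

theorem tame_regK {δ : ℝ} (hδ : 0 < δ) (i j : Fin 3) : Tame (regK δ i j) :=
  (((tame_ite i j).mul (tame_norm.pow 2)).sub ((tame_coord i).mul (tame_coord j))).mul
    (tame_regPow hδ (by norm_num))

theorem tame_regK_partial {δ : ℝ} (hδ : 0 < δ) (i j l : Fin 3) : Tame fun z =>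
      ((if i = j then 1 else 0) * ‖z‖ ^ 2 - z i * z j) * (2 * (-3 / 2) * z l *
        regPow δ (-3 / 2 - 1) z) + regPow δ (-3 / 2) z * ((if i = j then 1 else 0) * (2 * z l) -
          (z i * (if l = j then 1 else 0) + z j * (if l = i then 1 else 0))) :=
  ((((tame_ite i j).mul (tame_norm.pow 2)).sub ((tame_coord i).mul (tame_coord j))).mul
    (((tame_const _).mul (tame_coord l)).mul (tame_regPow hδ (by norm_num)))).add
    ((tame_regPow hδ (by norm_num)).mul (((tame_ite i j).mul ((tame_const 2).mul
      (tame_coord l))).sub (((tame_coord i).mul (tame_ite l j)).add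
        ((tame_coord j).mul (tame_ite l i)))))

/-- The regularized form of `∇ · A = ∇ a`. -/
theorem sum_cnv_regK {δ : ℝ} (hδ : 0 < δ) (g : 𝓢(V, ℝ)) (i : Fin 3) (v : V) :
    ∑ j, cnv (regK δ i j) (pd j g) v = 2 * cnv (regPow δ (-1 / 2)) (pd i g) v := by
  have h1 : ∀ j, cnv (regK δ i j) (pd j g) v = _ := fun j =>
    cnv_pd_eq (hasGrad_regK hδ i j) j (tame_regK hδ i j) (tame_regK_partial hδ i j j) g v
  have h2 := cnv_pd_eq (hasGrad_regPow hδ (-1 / 2)) i (tame_regPow hδ (by norm_num))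
    (((tame_const _).mul (tame_coord i)).mul (tame_regPow hδ (by norm_num))) g v
  rw [Finset.sum_congr rfl fun j _ => h1 j, cnv_finset_sum, h2, ← cnv_const_mul]
  · congr 1
    ext z
    rw [sum_regK_partial]
    norm_num
    ring
  · intro j
    exact ((tame_regK_partial hδ i j j).comp_sub_left v).integrable_mul g

/-- The regularized form of `-Δ a = g`. -/
theorem sum_cnv_regPow {δ : ℝ} (hδ : 0 < δ) (g : 𝓢(V, ℝ)) (v : V) :
    ∑ i, cnv (regPow δ (-1 / 2)) (pd i (pd i g)) v =
      - cnv (fun z => 3 * δ ^ 2 * regPow δ (-5 / 2) z) g v := by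
  have t1 := tame_regPow hδ (a := -1 / 2 - 1) (by norm_num)
  have t2 := tame_regPow hδ (a := -1 / 2 - 1 - 1) (by norm_num)
  have h1 : ∀ i, cnv (regPow δ (-1 / 2)) (pd i (pd i g)) v = _ := fun i =>
    cnv_pd_eq (hasGrad_regPow hδ (-1 / 2)) i (tame_regPow hδ (by norm_num))
    (((tame_const _).mul (tame_coord i)).mul t1) (pd i g) v
  have hg : ∀ i : Fin 3, HasGrad (fun z : V => 2 * (-1 / 2) * z i * regPow δ (-1 / 2 - 1) z) _ :=
    fun i => (((hasGrad_const _).mul (hasGrad_coord i)).mul (hasGrad_regPow hδ _))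
  have tt : ∀ i : Fin 3, Tame fun z : V => 2 * (-1 / 2) * z i *
      (2 * (-1 / 2 - 1) * z i * regPow δ (-1 / 2 - 1 - 1) z) +
      regPow δ (-1 / 2 - 1) z * (2 * (-1 / 2) * (if i = i then 1 else 0) + z i * 0) := fun i =>
    (((tame_const _).mul (tame_coord i)).mul (((tame_const _).mul (tame_coord i)).mul t2)).add
      (t1.mul (((tame_const _).mul (tame_ite i i)).add ((tame_coord i).mul (tame_const 0))))
  have h2 : ∀ i, cnv (fun z : V => 2 * (-1 / 2) * z i * regPow δ (-1 / 2 - 1) z) (pd i g) v = _ :=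
    fun i => cnv_pd_eq (hg i) i (((tame_const _).mul (tame_coord i)).mul t1) (tt i) g v
  rw [Finset.sum_congr rfl fun i _ => (h1 i).trans (h2 i), cnv_finset_sum,
    neg_eq_neg_one_mul (cnv _ _ _), ← cnv_const_mul]
  · congr 1
    ext z
    have := sq_mul_regPow hδ (-1 / 2 - 1) z
    rw [sum_fin_three_norm_sq] at this
    simp only [Fin.sum_univ_three, if_true]
    rw [← this]
    norm_num
    ring
  · exact fun i => ((tt i).comp_sub_left v).integrable_mul g

end

/-! ### The Landau-Coulomb kernels -/

section

open Filter Topology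

/-- The Newtonian kernel. -/
def kerG (z : V) : ℝ := 1 / (4 * Real.pi * ‖z‖)

/-- The entries of the Landau-Coulomb kernel. -/
def kerK (i j : Fin 3) (z : V) : ℝ := proj z i j / (8 * Real.pi * ‖z‖)

theorem potential_eq (g : V → ℝ) : potential g = cnv kerG g := rfl

theorem diffusionMatrix_eq (g : V → ℝ) (v : V) (i j : Fin 3) :
    diffusionMatrix g v i j = cnv (kerK i j) g v := rfl

theorem abs_coord_le (z : V) (i : Fin 3) : |z i| ≤ ‖z‖ := PiLp.norm_apply_le z i

theorem abs_proj_le (z : V) (i j : Fin 3) : |proj z i j| ≤ 2 := by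
  unfold proj
  have h1 : |(if i = j then (1 : ℝ) else 0)| ≤ 1 := by split_ifs <;> simp
  have h2 : |z i * z j / ‖z‖ ^ 2| ≤ 1 := by
    rw [abs_div, abs_mul, abs_of_nonneg (sq_nonneg ‖z‖)]
    refine div_le_one_of_le₀ ?_ (sq_nonneg _)
    rw [sq]
    exact mul_le_mul (abs_coord_le z i) (abs_coord_le z j) (abs_nonneg _) (norm_nonneg _)
  exact (abs_sub _ _).trans (by linarith)

theorem isKernel_kerG : IsKernel 1 kerG where
  meas := by unfold kerG; fun_prop
  bound z := by
    unfold kerG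
    rw [abs_of_nonneg (by positivity), one_div, mul_inv]
    refine mul_le_mul_of_nonneg_right (inv_le_one_of_one_le₀ ?_) (by positivity)
    linarith [Real.pi_gt_three]

theorem isKernel_kerK (i j : Fin 3) : IsKernel 1 (kerK i j) where
  meas := by unfold kerK proj; fun_prop
  bound z := by
    unfold kerK
    rw [abs_div, abs_of_nonneg (by positivity : 0 ≤ 8 * Real.pi * ‖z‖), div_eq_mul_inv, mul_inv,
      ← mul_assoc]
    refine mul_le_mul_of_nonneg_right ?_ (by positivity)
    rw [← div_eq_mul_inv]
    refine div_le_one_of_le₀ ((abs_proj_le z i j).trans ?_) (by positivity)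
    linarith [Real.pi_gt_three]

theorem ae_ne_zero_sub (v : V) : ∀ᵐ w : V, v - w ≠ 0 := by
  have : ∀ᵐ w : V, w ≠ v := by
    rw [ae_iff]
    simp
  filter_upwards [this] with w hw
  exact sub_ne_zero.2 hw.symm

/-- Dominated convergence: the regularised kernels are below `c / |z|` uniformly in `δ`, and the
exceptional point `w = v` is null. -/
theorem tendsto_cnv {k : ℝ → V → ℝ} {k₀ : V → ℝ} {c : ℝ} (hm : ∀ δ, Measurable (k δ))
    (hb : ∀ δ, 0 < δ → ∀ z, z ≠ 0 → |k δ z| ≤ c * ‖z‖⁻¹)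
    (hl : ∀ z, z ≠ 0 → Tendsto (fun δ => k δ z) (𝓝[>] 0) (𝓝 (k₀ z))) (g : 𝓢(V, ℝ)) (v : V) :
    Tendsto (fun δ => cnv (k δ) g v) (𝓝[>] 0) (𝓝 (cnv k₀ g v)) := by
  have hgm := g.continuous.measurable
  refine tendsto_integral_filter_of_dominated_convergence
    (fun w => c * bd 4 g * (‖v - w‖⁻¹ * wt w)) ?_ ?_ ?_ ?_
  · exact Eventually.of_forall fun δ =>
      ((hm δ).comp (measurable_const.sub measurable_id)).mul hgm |>.aestronglyMeasurable
  · filter_upwards [self_mem_nhdsWithin] with δ hδ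
    filter_upwards [ae_ne_zero_sub v] with w hw
    rw [Real.norm_eq_abs, abs_mul]
    calc |k δ (v - w)| * |g w| ≤ (c * ‖v - w‖⁻¹) * (bd 4 g * wt w) :=
          mul_le_mul (hb δ hδ _ hw) (abs_le_bd_wt g w) (abs_nonneg _)
            ((abs_nonneg _).trans (hb δ hδ _ hw))
      _ = _ := by ring
  · exact (integrable_inv_norm_mul_wt v).const_mul _
  · filter_upwards [ae_ne_zero_sub v] with w hw
    exact (hl _ hw).mul_const _

theorem measurable_regPow (δ a : ℝ) : Measurable (regPow δ a) := by
  unfold regPow; fun_prop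

theorem tendsto_regPow (a : ℝ) {z : V} (hz : z ≠ 0) :
    Tendsto (fun δ => regPow δ a z) (𝓝[>] 0) (𝓝 ((‖z‖ ^ 2) ^ a)) := by
  have h1 : Tendsto (fun δ : ℝ => ‖z‖ ^ 2 + δ ^ 2) (𝓝[>] 0) (𝓝 (‖z‖ ^ 2)) := by
    have : Continuous fun δ : ℝ => ‖z‖ ^ 2 + δ ^ 2 := by fun_prop
    have := (this.tendsto 0).mono_left (nhdsWithin_le_nhds (s := Set.Ioi 0))
    simpa using this
  exact h1.rpow_const (Or.inl (by positivity))

theorem norm_sq_rpow (z : V) (a : ℝ) : (‖z‖ ^ 2) ^ a = ‖z‖ ^ (2 * a) := by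
  rw [← Real.rpow_natCast, ← Real.rpow_mul (norm_nonneg z)]
  norm_num

theorem norm_sq_rpow_neg_half (z : V) : (‖z‖ ^ 2) ^ (-1 / 2 : ℝ) = ‖z‖⁻¹ := by
  rw [norm_sq_rpow, show (2 : ℝ) * (-1 / 2) = -1 by norm_num, Real.rpow_neg_one]

theorem norm_sq_rpow_neg_three_half (z : V) : (‖z‖ ^ 2) ^ (-3 / 2 : ℝ) = (‖z‖ ^ 3)⁻¹ := by
  rw [norm_sq_rpow, show (2 : ℝ) * (-3 / 2) = -((3 : ℕ) : ℝ) by norm_num,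
    Real.rpow_neg (norm_nonneg z), Real.rpow_natCast]

theorem regPow_le {δ : ℝ} {a : ℝ} (ha : a ≤ 0) {z : V} (hz : z ≠ 0) :
    regPow δ a z ≤ (‖z‖ ^ 2) ^ a :=
  Real.rpow_le_rpow_of_nonpos (by positivity) (by linarith [sq_nonneg δ]) ha

theorem abs_regK_le {δ : ℝ} (i j : Fin 3) {z : V} (hz : z ≠ 0) :
    |regK δ i j z| ≤ 2 * ‖z‖⁻¹ := by
  unfold regK
  rw [abs_mul, abs_of_nonneg (regPow_nonneg _ _ _)]
  have hn : 0 < ‖z‖ := norm_pos_iff.2 hz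
  have h1 : |(if i = j then (1 : ℝ) else 0) * ‖z‖ ^ 2| ≤ ‖z‖ ^ 2 := by
    split_ifs <;> simp
  have h2 : |z i * z j| ≤ ‖z‖ ^ 2 := by
    rw [abs_mul, sq]
    exact mul_le_mul (abs_coord_le z i) (abs_coord_le z j) (abs_nonneg _) (norm_nonneg _)
  calc _ ≤ (2 * ‖z‖ ^ 2) * (‖z‖ ^ 3)⁻¹ := by
        refine mul_le_mul ((abs_sub _ _).trans (by linarith)) ?_ (regPow_nonneg _ _ _)
          (by positivity)
        rw [← norm_sq_rpow_neg_three_half]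
        exact regPow_le (by norm_num) hz
    _ = _ := by field_simp

theorem tendsto_cnv_regPow (g : 𝓢(V, ℝ)) (v : V) :
    Tendsto (fun δ => cnv (regPow δ (-1 / 2)) g v) (𝓝[>] 0) (𝓝 (4 * Real.pi * cnv kerG g v)) := by
  rw [← cnv_const_mul]
  refine tendsto_cnv (c := 1) (fun δ => measurable_regPow _ _) ?_ ?_ g v
  · intro δ _ z hz
    rw [abs_of_nonneg (regPow_nonneg _ _ _), one_mul, ← norm_sq_rpow_neg_half]
    exact regPow_le (by norm_num) hz
  · intro z hz
    convert! tendsto_regPow (-1 / 2) hz using 2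
    rw [norm_sq_rpow_neg_half, kerG]
    have hn : 0 < ‖z‖ := norm_pos_iff.2 hz
    field_simp

theorem tendsto_cnv_regK (i j : Fin 3) (g : 𝓢(V, ℝ)) (v : V) :
    Tendsto (fun δ => cnv (regK δ i j) g v) (𝓝[>] 0)
      (𝓝 (8 * Real.pi * cnv (kerK i j) g v)) := by
  rw [← cnv_const_mul]
  refine tendsto_cnv (c := 2) (fun δ => ?_) (fun δ _ z hz => abs_regK_le i j hz) ?_ g v
  · have := measurable_regPow δ (-3 / 2)
    unfold regK
    fun_prop
  · intro z hz
    have := (tendsto_regPow (-3 / 2) hz).const_mul ((if i = j then 1 else 0) * ‖z‖ ^ 2 - z i * z j)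
    convert! this using 2
    rw [norm_sq_rpow_neg_three_half, kerK, proj]
    have hn : 0 < ‖z‖ := norm_pos_iff.2 hz
    have := Real.pi_pos
    field_simp

/-- `∇ · A = ∇ a`. -/
theorem sum_cnv_kerK (g : 𝓢(V, ℝ)) (i : Fin 3) (v : V) :
    ∑ j, cnv (kerK i j) (pd j g) v = cnv kerG (pd i g) v := by
  have h1 : Tendsto (fun δ => ∑ j, cnv (regK δ i j) (pd j g) v) (𝓝[>] 0)
      (𝓝 (∑ j, 8 * Real.pi * cnv (kerK i j) (pd j g) v)) :=
    tendsto_finsetSum _ fun j _ => tendsto_cnv_regK i j (pd j g) v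
  have h2 := (tendsto_cnv_regPow (pd i g) v).const_mul 2
  have h3 : (fun δ => ∑ j, cnv (regK δ i j) (pd j g) v) =ᶠ[𝓝[>] 0]
      fun δ => 2 * cnv (regPow δ (-1 / 2)) (pd i g) v := by
    filter_upwards [self_mem_nhdsWithin] with δ hδ
    exact sum_cnv_regK hδ g i v
  have h4 := tendsto_nhds_unique (h1.congr' h3) h2
  rw [← Finset.mul_sum] at h4
  have := Real.pi_pos
  have h5 : 8 * Real.pi * (∑ j, cnv (kerK i j) (pd j g) v) =
    8 * Real.pi * cnv kerG (pd i g) v := by linarith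
  exact mul_left_cancel₀ (by positivity) h5

/-- The constant `c` in `-Δ a = c g`. -/
def newtonConst : ℝ := (4 * Real.pi)⁻¹ * ∫ y : V, 3 * regPow 1 (-5 / 2) y

/-- The constant equals one, but its value is not needed: the reaction term is only estimated up to
a constant, for which the sign suffices. -/
theorem newtonConst_nonneg : 0 ≤ newtonConst :=
  mul_nonneg (by have := Real.pi_pos; positivity)
    (integral_nonneg fun y => mul_nonneg (by norm_num) (regPow_nonneg _ _ _))

theorem integrable_regPow_one : Integrable (regPow 1 (-5 / 2)) := by
  have h := integrable_rpow_neg_one_add_norm_sq (E := V) (μ := volume) (r := 5) (by simp; norm_num)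
  refine h.congr (Eventually.of_forall fun v => ?_)
  simp only [regPow]
  rw [add_comm]
  norm_num

/-- The factor `δ² · (δ²)^{-5/2} = δ⁻³` is that of an approximate identity on `ℝ³`, so the
regularised Laplacian of the potential tends to a multiple of `g`. -/
theorem regPow_smul {δ : ℝ} (hδ : 0 < δ) (y : V) :
    3 * δ ^ 2 * regPow δ (-5 / 2) (δ • y) = |(δ ^ 3)⁻¹| * (3 * regPow 1 (-5 / 2) y) := by
  unfold regPow
  rw [norm_smul, Real.norm_of_nonneg hδ.le, show (δ * ‖y‖) ^ 2 + δ ^ 2 = δ ^ 2 * (‖y‖ ^ 2 + 1 ^ 2)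
    by ring, Real.mul_rpow (by positivity) (by positivity), abs_of_pos (by positivity)]
  have : (δ ^ 2) ^ (-5 / 2 : ℝ) = (δ ^ 5)⁻¹ := by
    rw [← Real.rpow_natCast, ← Real.rpow_mul hδ.le, ← Real.rpow_natCast, ← Real.rpow_neg hδ.le]
    norm_num
  rw [this]
  field_simp

theorem cnv_approx_identity {δ : ℝ} (hδ : 0 < δ) (g : V → ℝ) (v : V) :
    cnv (fun z => 3 * δ ^ 2 * regPow δ (-5 / 2) z) g v =
      ∫ y, 3 * regPow 1 (-5 / 2) y * g (v - δ • y) := by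
  have h := Measure.integral_comp_smul (μ := (volume : Measure V))
    (fun z => 3 * δ ^ 2 * regPow δ (-5 / 2) z * g (v - z)) δ
  simp only [regPow_smul hδ, mul_assoc |(δ ^ 3)⁻¹|, integral_const_mul, smul_eq_mul] at h
  rw [cnv_eq]
  have hf : Module.finrank ℝ V = 3 := by simp
  rw [hf] at h
  exact (mul_left_cancel₀ (by positivity) h).symm

/-- `-Δ a = c g`, with the Laplacian moved onto `g`. -/
theorem sum_cnv_kerG (g : 𝓢(V, ℝ)) (v : V) :
    ∑ i, cnv kerG (pd i (pd i g)) v = - (newtonConst * g v) := by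
  have h1 : Tendsto (fun δ => ∑ i, cnv (regPow δ (-1 / 2)) (pd i (pd i g)) v) (𝓝[>] 0)
      (𝓝 (∑ i, 4 * Real.pi * cnv kerG (pd i (pd i g)) v)) :=
    tendsto_finsetSum _ fun i _ => tendsto_cnv_regPow (pd i (pd i g)) v
  have h2 : Tendsto (fun δ : ℝ => - ∫ y, 3 * regPow 1 (-5 / 2) y * g (v - δ • y)) (𝓝[>] 0)
      (𝓝 (- ∫ y, 3 * regPow 1 (-5 / 2) y * g v)) := by
    refine Tendsto.neg ?_
    refine tendsto_integral_filter_of_dominated_convergence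
      (fun y => 3 * regPow 1 (-5 / 2) y * bd 0 g) ?_ ?_ ?_ ?_
    · have := measurable_regPow 1 (-5 / 2)
      have := g.continuous.measurable
      exact Eventually.of_forall fun δ => by fun_prop
    · refine Eventually.of_forall fun δ => Eventually.of_forall fun y => ?_
      rw [norm_mul, Real.norm_of_nonneg (mul_nonneg (by norm_num) (regPow_nonneg _ _ _))]
      refine mul_le_mul_of_nonneg_left ?_ (mul_nonneg (by norm_num) (regPow_nonneg _ _ _))
      simpa using mul_abs_le_bd 0 g (v - δ • y)
    · exact (integrable_regPow_one.const_mul 3).mul_const _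
    · refine Eventually.of_forall fun y => ?_
      have hc : Continuous fun δ : ℝ => 3 * regPow 1 (-5 / 2) y * g (v - δ • y) := by
        have := g.continuous
        fun_prop
      have := (hc.tendsto 0).mono_left (nhdsWithin_le_nhds (s := Set.Ioi 0))
      simpa using this
  have h3 : (fun δ => ∑ i, cnv (regPow δ (-1 / 2)) (pd i (pd i g)) v) =ᶠ[𝓝[>] 0]
      fun δ => - ∫ y, 3 * regPow 1 (-5 / 2) y * g (v - δ • y) := by
    filter_upwards [self_mem_nhdsWithin] with δ hδ
    rw [sum_cnv_regPow hδ, cnv_approx_identity hδ]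
  have h4 := tendsto_nhds_unique (h1.congr' h3) h2
  rw [← Finset.mul_sum, integral_mul_const] at h4
  have := Real.pi_pos
  have h5 : 4 * Real.pi * (∑ i, cnv kerG (pd i (pd i g)) v) =
      4 * Real.pi * (- (newtonConst * g v)) := by
    rw [h4, newtonConst]
    field_simp
  exact mul_left_cancel₀ (by positivity) h5

end

/-! ### Weak form of the collision operator -/

section

open Filter Topology

/-- Measurable functions decaying faster than any polynomial. -/
structure Rapid (F : V → ℝ) : Prop where
  meas : Measurable F
  bound : ∀ N : ℕ, ∃ C, ∀ v, (1 + ‖v‖) ^ N * |F v| ≤ C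

theorem rapid_schwartz (g : 𝓢(V, ℝ)) : Rapid g :=
  ⟨g.continuous.measurable, fun N => ⟨bd N g, mul_abs_le_bd N g⟩⟩

theorem Rapid.add {F G : V → ℝ} (hF : Rapid F) (hG : Rapid G) : Rapid fun v => F v + G v := by
  refine ⟨hF.meas.add hG.meas, fun N => ?_⟩
  obtain ⟨C, hC⟩ := hF.bound N
  obtain ⟨D, hD⟩ := hG.bound N
  refine ⟨C + D, fun v => ?_⟩
  calc (1 + ‖v‖) ^ N * |F v + G v| ≤ (1 + ‖v‖) ^ N * (|F v| + |G v|) :=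
        mul_le_mul_of_nonneg_left (abs_add_le _ _) (by positivity)
    _ ≤ C + D := by rw [mul_add]; exact add_le_add (hC v) (hD v)

theorem Tame.mul_rapid {k F : V → ℝ} (hk : Tame k) (hF : Rapid F) : Rapid fun v => k v * F v := by
  refine ⟨hk.meas.mul hF.meas, fun N => ?_⟩
  obtain ⟨D, M, hD, h⟩ := hk.bound
  obtain ⟨C, hC⟩ := hF.bound (N + M)
  refine ⟨D * C, fun v => ?_⟩
  rw [abs_mul]
  calc (1 + ‖v‖) ^ N * (|k v| * |F v|) ≤ (1 + ‖v‖) ^ N * ((D * (1 + ‖v‖) ^ M) * |F v|) := by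
        gcongr
        exact h v
    _ = D * ((1 + ‖v‖) ^ (N + M) * |F v|) := by ring
    _ ≤ D * C := mul_le_mul_of_nonneg_left (hC v) hD

theorem Rapid.sub {F G : V → ℝ} (hF : Rapid F) (hG : Rapid G) : Rapid fun v => F v - G v := by
  simpa [sub_eq_add_neg] using hF.add ((tame_const (-1)).mul_rapid hG)

theorem Rapid.sum {ι : Type*} (s : Finset ι) {k : ι → V → ℝ} (hk : ∀ i, Rapid (k i)) :
    Rapid fun v => ∑ i ∈ s, k i v := by
  classical
  induction s using Finset.induction_on with
  | empty => exact ⟨by simp, fun N => ⟨0, by simp⟩⟩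
  | insert a s ha ih => simpa [Finset.sum_insert ha] using (hk a).add ih

theorem Rapid.exists_le_wt {F : V → ℝ} (hF : Rapid F) : ∃ C, 0 ≤ C ∧ ∀ v, |F v| ≤ C * wt v := by
  obtain ⟨C, hC⟩ := hF.bound 4
  refine ⟨C, ?_, fun v => ?_⟩
  · exact le_trans (by positivity) (hC 0)
  · rw [wt, ← div_eq_mul_inv, le_div_iff₀ (by positivity), mul_comm]
    exact hC v

theorem Rapid.integrable {F : V → ℝ} (hF : Rapid F) : Integrable F := by
  obtain ⟨C, _, h⟩ := hF.exists_le_wt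
  exact (integrable_wt.const_mul C).mono' hF.meas.aestronglyMeasurable (Eventually.of_forall h)

theorem gradient_potential (g : 𝓢(V, ℝ)) (v : V) (i : Fin 3) :
    gradient (potential g) v i = cnv kerG (pd i g) v := by
  rw [gradient_apply, potential_eq, (isKernel_kerG.hasGrad_cnv zero_le_one g).fderiv_single]

theorem flux_apply (g : 𝓢(V, ℝ)) (v : V) (i : Fin 3) :
    flux g v i = (∑ j, cnv (kerK i j) g v * pd j g v) - g v * cnv kerG (pd i g) v := by
  simp only [flux, gradient_potential, schwartz_gradient_apply, diffusionMatrix_eq]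

/-- The partial derivatives of the components of the flux. -/
def fluxPartial (g : 𝓢(V, ℝ)) (i : Fin 3) (v : V) (l : Fin 3) : ℝ :=
  (∑ j, (cnv (kerK i j) g v * pd l (pd j g) v + pd j g v * cnv (kerK i j) (pd l g) v)) -
    (g v * cnv kerG (pd l (pd i g)) v + cnv kerG (pd i g) v * pd l g v)

theorem rapid_mul_cnvK (g h : 𝓢(V, ℝ)) (i j : Fin 3) : Rapid fun v => cnv (kerK i j) g v * h v :=
  ((isKernel_kerK i j).tame_cnv zero_le_one g).mul_rapid (rapid_schwartz h)

theorem rapid_mul_cnvG (g h : 𝓢(V, ℝ)) : Rapid fun v => cnv kerG g v * h v :=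
  (isKernel_kerG.tame_cnv zero_le_one g).mul_rapid (rapid_schwartz h)

theorem rapid_flux (g : 𝓢(V, ℝ)) (i : Fin 3) : Rapid fun v => flux g v i := by
  simp only [flux_apply, mul_comm (g _)]
  exact (Rapid.sum _ fun j => rapid_mul_cnvK g (pd j g) i j).sub (rapid_mul_cnvG (pd i g) g)

theorem rapid_fluxPartial (g : 𝓢(V, ℝ)) (i l : Fin 3) : Rapid fun v => fluxPartial g i v l := by
  simp only [fluxPartial, mul_comm (g _), mul_comm (pd _ g _)]
  refine (Rapid.sum _ fun j => (rapid_mul_cnvK _ _ i j).add ?_).sub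
    ((rapid_mul_cnvG _ _).add ?_)
  · exact rapid_mul_cnvK _ _ i j
  · simpa only [mul_comm] using rapid_mul_cnvG (pd i g) (pd l g)

theorem hasGrad_flux (g : 𝓢(V, ℝ)) (i : Fin 3) :
    HasGrad (fun v => flux g v i) (fluxPartial g i) := by
  simp only [flux_apply]
  exact (HasGrad.sum _ fun j => ((isKernel_kerK i j).hasGrad_cnv zero_le_one g).mul
    (hasGrad_schwartz (pd j g))).sub ((hasGrad_schwartz g).mul
      (isKernel_kerG.hasGrad_cnv zero_le_one (pd i g)))

theorem collision_eq (g : 𝓢(V, ℝ)) (v : V) : collision g v = ∑ i, fluxPartial g i v i := by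
  simp only [collision, divergence]
  exact Finset.sum_congr rfl fun i _ => (hasGrad_flux g i).fderiv_single v i

/-- The weak form of the collision operator. -/
theorem integral_mul_collision {ψ : V → ℝ} {ψ' : V → Fin 3 → ℝ} (hψ : HasGrad ψ ψ')
    (ht : Tame ψ) (ht' : ∀ i, Tame fun v => ψ' v i) (g : 𝓢(V, ℝ)) :
    ∫ v, ψ v * collision g v = - ∫ v, ∑ i, ψ' v i * flux g v i := by
  simp only [collision_eq, Finset.mul_sum]
  rw [integral_finsetSum _ fun i _ => (ht.mul_rapid (rapid_fluxPartial g i i)).integrable,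
    integral_finsetSum _ fun i _ => ((ht' i).mul_rapid (rapid_flux g i)).integrable,
    ← Finset.sum_neg_distrib]
  exact Finset.sum_congr rfl fun i _ => integral_mul_partial hψ (hasGrad_flux g i) i
    (ht.mul_rapid (rapid_flux g i)).integrable ((ht' i).mul_rapid (rapid_flux g i)).integrable
    (ht.mul_rapid (rapid_fluxPartial g i i)).integrable

/-! ### The kernel as a quadratic form and the symmetrised weak form -/

/-- The bilinear form of the Landau-Coulomb kernel. -/
def kq (z a b : V) : ℝ := (inner ℝ a b - inner ℝ z a * inner ℝ z b / ‖z‖ ^ 2) / (8 * Real.pi * ‖z‖)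

theorem kq_eq_sum (z a b : V) : kq z a b = ∑ i, ∑ j, kerK i j z * a i * b j := by
  simp only [kq, kerK, proj, inner_eq_sum]
  simp [Fin.sum_univ_three]
  ring

theorem kq_comm (z a b : V) : kq z a b = kq z b a := by
  simp only [kq, real_inner_comm]
  ring

theorem kq_neg_left (z a b : V) : kq (-z) a b = kq z a b := by
  simp [kq]

theorem kq_add_right (z a b c : V) : kq z a (b + c) = kq z a b + kq z a c := by
  simp only [kq, inner_add_right]
  ring

theorem kq_sub_right (z a b c : V) : kq z a (b - c) = kq z a b - kq z a c := by
  simp only [kq, inner_sub_right]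
  ring

theorem kq_smul_right (z a b : V) (r : ℝ) : kq z a (r • b) = r * kq z a b := by
  simp only [kq, inner_smul_right]
  ring

theorem kq_sub_left (z a b c : V) : kq z (a - b) c = kq z a c - kq z b c := by
  rw [kq_comm, kq_sub_right, kq_comm z c a, kq_comm z c b]

theorem kq_smul_left (z a b : V) (r : ℝ) : kq z (r • a) b = r * kq z a b := by
  rw [kq_comm, kq_smul_right, kq_comm]

theorem kq_neg_right (z a b : V) : kq z a (-b) = - kq z a b := by
  simpa using kq_smul_right z a b (-1)

/-- The direction `v - w` is in the kernel of the form; this is the source of energy conservation.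
-/
theorem kq_self_left (z b : V) : kq z z b = 0 := by
  rcases eq_or_ne z 0 with rfl | hz
  · simp [kq]
  · have hn : 0 < ‖z‖ := norm_pos_iff.2 hz
    simp only [kq, real_inner_self_eq_norm_sq]
    field_simp
    simp

theorem inner_mul_inner_div_le (z a b : V) : |inner ℝ z a * inner ℝ z b / ‖z‖ ^ 2| ≤ ‖a‖ * ‖b‖ := by
  rcases eq_or_ne z 0 with rfl | hz
  · simp; positivity
  · have hn : 0 < ‖z‖ := norm_pos_iff.2 hz
    rw [abs_div, abs_mul, abs_of_nonneg (sq_nonneg ‖z‖), div_le_iff₀ (by positivity)]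
    calc |inner ℝ z a| * |inner ℝ z b| ≤ (‖z‖ * ‖a‖) * (‖z‖ * ‖b‖) :=
          mul_le_mul (abs_real_inner_le_norm z a) (abs_real_inner_le_norm z b) (abs_nonneg _)
            (by positivity)
      _ = _ := by ring

theorem kq_self_nonneg (z a : V) : 0 ≤ kq z a a := by
  unfold kq
  have := (abs_le.1 (inner_mul_inner_div_le z a a)).2
  rw [real_inner_self_eq_norm_sq]
  exact div_nonneg (by nlinarith) (by have := Real.pi_pos; positivity)

theorem abs_kq_le (z a b : V) : |kq z a b| ≤ ‖z‖⁻¹ * (‖a‖ * ‖b‖) := by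
  unfold kq
  have h1 := inner_mul_inner_div_le z a b
  have h2 := abs_real_inner_le_norm a b
  have h3 := abs_sub (inner ℝ a b) (inner ℝ z a * inner ℝ z b / ‖z‖ ^ 2)
  have hpi := Real.pi_gt_three
  rw [abs_div, abs_of_nonneg (by positivity : 0 ≤ 8 * Real.pi * ‖z‖), div_eq_mul_inv, mul_inv,
    mul_comm, mul_comm (8 * Real.pi)⁻¹, mul_assoc]
  refine mul_le_mul_of_nonneg_left ?_ (by positivity)
  rw [mul_comm, ← div_eq_mul_inv, div_le_iff₀ (by positivity)]
  nlinarith [mul_nonneg (norm_nonneg a) (norm_nonneg b)]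

/-- Young's inequality for the kernel form. -/
theorem abs_kq_le_young (z a b : V) {r : ℝ} (hr : 0 < r) :
    |kq z a b| ≤ r / 2 * kq z a a + 1 / (2 * r) * kq z b b := by
  -- Positivity on `r a - b` and on `r a + b` bounds the cross term from both sides.
  have h1 := kq_self_nonneg z (r • a - b)
  have h2 := kq_self_nonneg z (r • a + b)
  rw [← sub_neg_eq_add] at h2
  simp only [kq_sub_left, kq_sub_right, kq_smul_left, kq_smul_right, kq_neg_right,
    kq_comm z (-b)] at h1 h2
  rw [kq_comm z b a] at h1
  have e : r / 2 * kq z a a + 1 / (2 * r) * kq z b b =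
      (r * (r * kq z a a) + kq z b b) / (2 * r) := by
    field_simp
  rw [e, le_div_iff₀ (by positivity)]
  rcases abs_cases (kq z a b) with ⟨h, _⟩ | ⟨h, _⟩ <;> rw [h] <;> nlinarith

theorem measurable_kq {α : Type*} [MeasurableSpace α] {z a b : α → V} (hz : Measurable z)
    (ha : Measurable a) (hb : Measurable b) : Measurable fun x => kq (z x) (a x) (b x) := by
  unfold kq
  have h1 := ha.inner (𝕜 := ℝ) hb
  have h2 := hz.inner (𝕜 := ℝ) ha
  have h3 := hz.inner (𝕜 := ℝ) hb
  fun_prop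

/-- The two-point current `g(w) ∇g(v) - g(v) ∇g(w)`. -/
def current (g : 𝓢(V, ℝ)) (v w : V) : V := g w • gradient g v - g v • gradient g w

theorem current_swap (g : 𝓢(V, ℝ)) (v w : V) : current g w v = - current g v w := by
  simp [current]

/-- Since `∇a = ∇ · A`, the drift `g ∇a` is the convolution of the same matrix kernel with `∇g`; the
whole flux is therefore a single integral against the kernel. -/
theorem inner_flux (g : 𝓢(V, ℝ)) (v a : V) :
    ∑ i, a i * flux g v i = ∫ w, kq (v - w) a (current g v w) := by
  have hI : ∀ i j, Integrable fun w => kerK i j (v - w) * g w := fun i j =>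
    (isKernel_kerK i j).integrable g v
  have hI' : ∀ i j, Integrable fun w => kerK i j (v - w) * pd j g w := fun i j =>
    (isKernel_kerK i j).integrable (pd j g) v
  have e : ∀ w, kq (v - w) a (current g v w) = ∑ i, ∑ j,
      (a i * pd j g v * (kerK i j (v - w) * g w) - a i * g v * (kerK i j (v - w) * pd j g w)) := by
    intro w
    rw [kq_eq_sum]
    refine Finset.sum_congr rfl fun i _ => Finset.sum_congr rfl fun j _ => ?_
    simp only [current, PiLp.sub_apply, PiLp.smul_apply, smul_eq_mul, schwartz_gradient_apply]
    ring
  have hS : ∀ i j, Integrable fun w => a i * pd j g v * (kerK i j (v - w) * g w) -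
      a i * g v * (kerK i j (v - w) * pd j g w) := fun i j =>
    ((hI i j).const_mul _).sub ((hI' i j).const_mul _)
  simp only [e]
  rw [integral_finsetSum _ fun i _ => integrable_finsetSum _ fun j _ => hS i j]
  refine Finset.sum_congr rfl fun i _ => ?_
  rw [integral_finsetSum _ fun j _ => hS i j]
  have e2 : ∀ j, ∫ w, (a i * pd j g v * (kerK i j (v - w) * g w) -
      a i * g v * (kerK i j (v - w) * pd j g w)) =
      a i * (cnv (kerK i j) g v * pd j g v) - a i * g v * cnv (kerK i j) (pd j g) v := by
    intro j
    rw [integral_sub ((hI i j).const_mul _) ((hI' i j).const_mul _), integral_const_mul,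
      integral_const_mul, cnv, cnv]
    ring
  simp only [e2]
  rw [Finset.sum_sub_distrib, ← Finset.mul_sum, ← Finset.mul_sum, sum_cnv_kerK, flux_apply]
  ring

theorem integrable_of_le_wt {F : V × V → ℝ} (hF : Measurable F) {C : ℝ}
    (h : ∀ v w, |F (v, w)| ≤ C * (wt v * wt w * ‖v - w‖⁻¹)) :
    Integrable F (volume.prod volume) :=
  (integrable_prod_wt.const_mul C).mono' hF.aestronglyMeasurable
    (Eventually.of_forall fun x => h x.1 x.2)

theorem norm_le_sum_abs (a : V) : ‖a‖ ≤ ∑ i, |a i| := by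
  conv_lhs => rw [sum_smul_single a]
  refine (norm_sum_le _ _).trans (Finset.sum_le_sum fun i _ => ?_)
  simp [norm_smul]

theorem rapid_norm_gradient (g : 𝓢(V, ℝ)) : Rapid fun v => ‖gradient g v‖ := by
  refine ⟨(continuous_gradient g).norm.measurable, fun N => ⟨∑ i, bd N (pd i g), fun v => ?_⟩⟩
  rw [abs_norm]
  calc (1 + ‖v‖) ^ N * ‖gradient g v‖ ≤ (1 + ‖v‖) ^ N * ∑ i, |gradient g v i| :=
        mul_le_mul_of_nonneg_left (norm_le_sum_abs _) (by positivity)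
    _ ≤ _ := by
      rw [Finset.mul_sum]
      refine Finset.sum_le_sum fun i _ => ?_
      rw [schwartz_gradient_apply]
      exact mul_abs_le_bd N (pd i g) v

theorem measurable_current (g : 𝓢(V, ℝ)) : Measurable fun x : V × V => current g x.1 x.2 := by
  have h1 := g.continuous.measurable
  have h2 := (continuous_gradient g).measurable
  unfold current
  fun_prop

/-- The kernel form applied to a vector field of polynomial growth and the two-point current is
integrable on the product space. -/
theorem integrable_kq_current (g : 𝓢(V, ℝ)) {X : V → V} (hX : Measurable X)
    (ht : Tame fun v => ‖X v‖) :
    Integrable (fun x : V × V => kq (x.1 - x.2) (X x.1) (current g x.1 x.2))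
      (volume.prod volume) := by
  obtain ⟨C₁, hC₁, h1⟩ := (ht.mul_rapid (rapid_norm_gradient g)).exists_le_wt
  obtain ⟨C₂, hC₂, h2⟩ := (ht.mul_rapid (rapid_schwartz g)).exists_le_wt
  obtain ⟨C₃, hC₃, h3⟩ := (rapid_norm_gradient g).exists_le_wt
  obtain ⟨C₄, hC₄, h4⟩ := (rapid_schwartz g).exists_le_wt
  refine integrable_of_le_wt (C := C₁ * C₄ + C₂ * C₃) (measurable_kq (by fun_prop) (by fun_prop)
    (measurable_current g)) fun v w => ?_
  refine (abs_kq_le _ _ _).trans ?_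
  rw [← mul_assoc, mul_comm]
  simp only [abs_mul, abs_norm] at h1 h2 h3
  have hb : ‖current g v w‖ ≤ |g w| * ‖gradient g v‖ + |g v| * ‖gradient g w‖ := by
    refine (norm_sub_le _ _).trans ?_
    simp [norm_smul]
  calc ‖current g v w‖ * (‖v - w‖⁻¹ * ‖X v‖)
      ≤ (|g w| * ‖gradient g v‖ + |g v| * ‖gradient g w‖) * (‖v - w‖⁻¹ * ‖X v‖) :=
        mul_le_mul_of_nonneg_right hb (by positivity)
    _ = ((‖X v‖ * ‖gradient g v‖) * |g w| + (‖X v‖ * |g v|) * ‖gradient g w‖) * ‖v - w‖⁻¹ := by ring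
    _ ≤ ((C₁ * wt v) * (C₄ * wt w) + (C₂ * wt v) * (C₃ * wt w)) * ‖v - w‖⁻¹ := by
        refine mul_le_mul_of_nonneg_right (add_le_add ?_ ?_) (by positivity)
        · exact mul_le_mul (h1 v) (h4 w) (abs_nonneg _) (mul_nonneg hC₁ (wt_pos v).le)
        · exact mul_le_mul (h2 v) (h3 w) (norm_nonneg _) (mul_nonneg hC₂ (wt_pos v).le)
    _ = _ := by ring

theorem integrable_kq_current_sub (g : 𝓢(V, ℝ)) {X : V → V} (hX : Measurable X)
    (ht : Tame fun v => ‖X v‖) :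
    Integrable (fun x : V × V => kq (x.1 - x.2) (X x.1 - X x.2) (current g x.1 x.2))
      (volume.prod volume) := by
  have h := integrable_kq_current g hX ht
  have h' := h.swap
  refine (h.add h').congr (Eventually.of_forall fun x => ?_)
  simp only [Pi.add_apply, Function.comp_apply, Prod.fst_swap, Prod.snd_swap]
  rw [kq_sub_left, current_swap g x.1 x.2, kq_neg_right, ← neg_sub x.1 x.2, kq_neg_left]
  ring

/-- The symmetrized weak form of the collision operator. -/
theorem integral_inner_flux (g : 𝓢(V, ℝ)) {X : V → V} (hX : Measurable X)
    (ht : Tame fun v => ‖X v‖) :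
    ∫ v, ∑ i, X v i * flux g v i = 1 / 2 * ∫ x : V × V,
      kq (x.1 - x.2) (X x.1 - X x.2) (current g x.1 x.2) ∂(volume.prod volume) := by
  have h := integrable_kq_current g hX ht
  have h' : Integrable (fun x : V × V => kq (x.2 - x.1) (X x.2) (current g x.2 x.1))
      (volume.prod volume) := h.swap
  have e1 : ∫ v, ∑ i, X v i * flux g v i = ∫ x : V × V,
      kq (x.1 - x.2) (X x.1) (current g x.1 x.2) ∂(volume.prod volume) := by
    rw [integral_prod _ h]
    simp only [inner_flux]
  -- Exchanging `v` and `w` leaves the kernel unchanged and reverses the current, so averaging the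
  -- two forms replaces the field by its increment.
  have e2 : ∫ x : V × V, kq (x.1 - x.2) (X x.1 - X x.2) (current g x.1 x.2) ∂(volume.prod volume) =
      2 * ∫ x : V × V, kq (x.1 - x.2) (X x.1) (current g x.1 x.2) ∂(volume.prod volume) := by
    rw [two_mul]
    nth_rw 3 [← integral_prod_swap]
    simp only [Prod.fst_swap, Prod.snd_swap]
    rw [← integral_add h h']
    congr 1
    ext x
    rw [kq_sub_left, current_swap g x.1 x.2, kq_neg_right, ← neg_sub x.1, kq_neg_left]
    ring
  rw [e1, e2]
  ring

end

/-! ### Time derivatives and conservation laws -/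

section

open Filter Topology

theorem Tame.mul_bd_le {k : V → ℝ} {C : ℝ} {N : ℕ} (h : ∀ v, |k v| ≤ C * (1 + ‖v‖) ^ N)
    (hC : 0 ≤ C) (g : 𝓢(V, ℝ)) (v : V) : |k v| * |g v| ≤ C * bd (N + 4) g * wt v := by
  calc |k v| * |g v| ≤ (C * (1 + ‖v‖) ^ N) * (bd (N + 4) g * ((1 + ‖v‖) ^ (N + 4))⁻¹) :=
        mul_le_mul (h v) (abs_le_bd_mul _ g v) (abs_nonneg _) (by positivity)
    _ = _ := by
      rw [wt, pow_add]
      have : (1 + ‖v‖) ≠ 0 := by positivity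
      field_simp

theorem abs_le_bd_zero (g : 𝓢(V, ℝ)) (v : V) : |g v| ≤ bd 0 g := by
  simpa using mul_abs_le_bd 0 g v

/-- Continuity in the Schwartz topology turns the decay of each `f(s)` into decay uniform over
compact time intervals, which justifies every exchange of limits below. -/
theorem exists_bd_le {f : ℝ → 𝓢(V, ℝ)} {K : Set ℝ} (hK : IsCompact K) (hf : ContinuousOn f K)
    (N : ℕ) : ∃ B, 0 ≤ B ∧ ∀ s ∈ K, bd N (f s) ≤ B := by
  obtain ⟨B, hB⟩ := hK.exists_bound_of_continuousOn ((continuous_bd N).comp_continuousOn hf)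
  refine ⟨max B 0, le_max_right _ _, fun s hs => le_trans ?_ (le_max_left _ _)⟩
  exact (le_abs_self _).trans (hB s hs)

theorem continuous_eval (v : V) : Continuous fun g : 𝓢(V, ℝ) => g v := by
  have h := (SchwartzMap.toBoundedContinuousFunctionCLM ℝ V ℝ).continuous
  exact (BoundedContinuousFunction.lipschitz_eval_const v).continuous.comp h

/-- Evaluation at a point is a continuous linear functional on Schwartz space. -/
def evalAt (v : V) : 𝓢(V, ℝ) →L[ℝ] ℝ where
  toFun g := g v
  map_add' _ _ := rfl
  map_smul' _ _ := rfl
  cont := continuous_eval v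

/-- `θ` is continuous on `[0, ∞)` and `θ(x) = O(x)` locally uniformly. -/
structure LinBound (θ : ℝ → ℝ) : Prop where
  meas : Measurable θ
  cont : ContinuousOn θ (Set.Ici 0)
  bound : ∀ R : ℝ, ∃ C, 0 ≤ C ∧ ∀ x, 0 ≤ x → x ≤ R → |θ x| ≤ C * x

theorem LinBound.id : LinBound fun x => x :=
  ⟨measurable_id, continuousOn_id, fun _ => ⟨1, zero_le_one, fun x hx _ => by
    rw [abs_of_nonneg hx, one_mul]⟩⟩

theorem continuousOn_integral_comp {f : ℝ → 𝓢(V, ℝ)} {K : Set ℝ} (hK : IsCompact K)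
    (hf : ContinuousOn f K) (hpos : ∀ s ∈ K, ∀ v, 0 ≤ f s v) {θ : ℝ → ℝ} (hθ : LinBound θ)
    {ω : V → ℝ} (hω : Tame ω) : ContinuousOn (fun s => ∫ v, θ (f s v) * ω v) K := by
  obtain ⟨C, N, hC, h⟩ := hω.bound
  obtain ⟨B, hB, hB'⟩ := exists_bd_le hK hf (N + 4)
  obtain ⟨B₀, _, hB₀'⟩ := exists_bd_le hK hf 0
  obtain ⟨D, hD, hD'⟩ := hθ.bound B₀
  refine continuousOn_of_dominated (bound := fun v => D * (C * B * wt v)) ?_ ?_ ?_ ?_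
  · exact fun s _ => ((hθ.meas.comp (f s).continuous.measurable).mul hω.meas).aestronglyMeasurable
  · refine fun s hs => Eventually.of_forall fun v => ?_
    rw [norm_mul, Real.norm_eq_abs, Real.norm_eq_abs]
    have h1 := hD' (f s v) (hpos s hs v)
      ((le_abs_self _).trans ((abs_le_bd_zero _ v).trans (hB₀' s hs)))
    calc |θ (f s v)| * |ω v| ≤ D * |f s v| * |ω v| := by
          refine mul_le_mul_of_nonneg_right ?_ (abs_nonneg _)
          rwa [abs_of_nonneg (hpos s hs v)]
      _ = D * (|ω v| * |f s v|) := by ring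
      _ ≤ D * (C * B * wt v) := by
          refine mul_le_mul_of_nonneg_left ((Tame.mul_bd_le h hC (f s) v).trans ?_) hD
          refine mul_le_mul_of_nonneg_right ?_ (wt_pos v).le
          exact mul_le_mul_of_nonneg_left (hB' s hs) hC
  · exact (integrable_wt.const_mul _).const_mul _
  · refine Eventually.of_forall fun v => ContinuousOn.mul ?_ continuousOn_const
    exact hθ.cont.comp ((continuous_eval v).comp_continuousOn hf) fun s hs => hpos s hs v

theorem integrable_comp {g : 𝓢(V, ℝ)} (hpos : ∀ v, 0 ≤ g v) {θ : ℝ → ℝ} (hθ : LinBound θ)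
    {ω : V → ℝ} (hω : Tame ω) : Integrable fun v => θ (g v) * ω v := by
  obtain ⟨D, hD, hD'⟩ := hθ.bound (bd 0 g)
  refine ((hω.integrable_mul g).norm.const_mul D).mono'
    ((hθ.meas.comp g.continuous.measurable).mul hω.meas).aestronglyMeasurable
    (Eventually.of_forall fun v => ?_)
  have h1 := hD' (g v) (hpos v) ((le_abs_self _).trans (abs_le_bd_zero g v))
  rw [norm_mul, norm_mul, Real.norm_eq_abs, Real.norm_eq_abs, Real.norm_of_nonneg (hpos v)]
  calc |θ (g v)| * |ω v| ≤ D * g v * |ω v| := mul_le_mul_of_nonneg_right h1 (abs_nonneg _)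
    _ = _ := by ring

variable {T : EReal} {f_in : 𝓢(V, ℝ)} {f : ℝ → 𝓢(V, ℝ)}

theorem IsSchwartzSolution.continuousOn_Icc (hf : IsSchwartzSolution T f_in f) {t : ℝ}
    (ht : (t : EReal) < T) : ContinuousOn f (Set.Icc 0 t) :=
  hf.continuous.mono fun _ hs => ⟨hs.1, lt_of_le_of_lt (EReal.coe_le_coe_iff.2 hs.2) ht⟩

theorem IsSchwartzSolution.nonneg_of_mem (hf : IsSchwartzSolution T f_in f) {t : ℝ}
    (ht : (t : EReal) < T) : ∀ s ∈ Set.Icc 0 t, ∀ v, 0 ≤ f s v := fun _ hs =>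
  hf.nonneg _ hs.1 (lt_of_le_of_lt (EReal.coe_le_coe_iff.2 hs.2) ht)

/-- Schwartz space is not normed, so the chain rule is run on the little-o relation of topological
vector spaces. -/
theorem hasDerivAt_clm_comp (L : 𝓢(V, ℝ) →L[ℝ] ℝ) {F : ℝ → 𝓢(V, ℝ)} {F' : 𝓢(V, ℝ)} {t : ℝ}
    (h : HasDerivAt F F' t) : HasDerivAt (fun s => L (F s)) (L F') t := by
  have h1 : HasFDerivAt (fun s => L (F s)) (L ∘L ContinuousLinearMap.toSpanSingleton ℝ F') t := by
    refine .of_isLittleOTVS ?_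
    refine (L.isBigOTVS_fun_comp.trans_isLittleOTVS h.hasFDerivAt.isLittleOTVS).congr_left ?_
    intro p
    simp [map_sub]
  simpa using h1.hasDerivAt

/-- The time derivative of a Schwartz solution in Schwartz space. -/
theorem IsSchwartzSolution.exists_deriv (hf : IsSchwartzSolution T f_in f) :
    ∃ D : ℝ → 𝓢(V, ℝ), ∀ t : ℝ, 0 < t → (t : EReal) < T →
      ContinuousAt D t ∧ (∀ v, HasDerivAt (fun s => f s v) (D t v) t) ∧
      ∀ v, D t v = collision (f t) v := by
  obtain ⟨D, h0, h⟩ := hf.smooth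
  refine ⟨D 1, fun t ht htT => ⟨(h 1 t ht htT).hasFDerivAt.continuousAt, ?_⟩⟩
  have key : ∀ v, HasDerivAt (fun s => f s v) (D 1 t v) t := fun v => by
    have h1 := h 0 t ht htT
    rw [h0] at h1
    exact hasDerivAt_clm_comp (evalAt v) h1
  exact ⟨key, fun v => (key v).unique (hf.equation t ht htT v)⟩

/-- A differentiable nonlinearity vanishing at the origin, with continuous derivative on
`[0, ∞)`. -/
structure SmoothNonlin (θ θ' : ℝ → ℝ) : Prop where
  meas : Measurable θ
  meas' : Measurable θ'
  zero : θ 0 = 0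
  deriv : ∀ x, 0 ≤ x → HasDerivAt θ (θ' x) x
  cont' : ContinuousOn θ' (Set.Ici 0)

theorem exists_bound_of_continuousOn_Ici {θ : ℝ → ℝ} (h : ContinuousOn θ (Set.Ici 0)) (R : ℝ) :
    ∃ C, 0 ≤ C ∧ ∀ x, 0 ≤ x → x ≤ R → |θ x| ≤ C := by
  obtain ⟨C, hC⟩ := (isCompact_Icc (a := 0) (b := R)).exists_bound_of_continuousOn
    (h.mono Set.Icc_subset_Ici_self)
  exact ⟨max C 0, le_max_right _ _, fun x hx hR => (hC x ⟨hx, hR⟩).trans (le_max_left _ _)⟩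

theorem SmoothNonlin.linBound {θ θ' : ℝ → ℝ} (h : SmoothNonlin θ θ') : LinBound θ where
  meas := h.meas
  cont := fun x hx => (h.deriv x hx).continuousAt.continuousWithinAt
  bound R := by
    obtain ⟨C, hC, hb⟩ := exists_bound_of_continuousOn_Ici h.cont' R
    refine ⟨C, hC, fun x hx hR => ?_⟩
    have := (convex_Icc 0 x).norm_image_sub_le_of_norm_hasDerivWithin_le
      (f := θ) (f' := θ') (C := C) (fun y hy => (h.deriv y hy.1).hasDerivWithinAt)
      (fun y hy => hb y hy.1 (hy.2.trans hR)) (Set.left_mem_Icc.2 hx) (Set.right_mem_Icc.2 hx)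
    rw [h.zero, sub_zero, sub_zero, Real.norm_eq_abs, Real.norm_of_nonneg hx] at this
    exact this

theorem SmoothNonlin.id : SmoothNonlin (fun x => x) fun _ => 1 :=
  ⟨measurable_id, measurable_const, rfl, fun x _ => hasDerivAt_id x, continuousOn_const⟩

/-- Differentiation of `∫ θ(f(s, v)) ω(v) dv` in time along a Schwartz solution. -/
theorem IsSchwartzSolution.hasDerivAt_integral (hf : IsSchwartzSolution T f_in f) {t : ℝ}
    (ht : 0 < t) (htT : (t : EReal) < T) {θ θ' : ℝ → ℝ} (hθ : SmoothNonlin θ θ') {ω : V → ℝ}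
    (hω : Tame ω) :
    HasDerivAt (fun s => ∫ v, θ (f s v) * ω v)
      (∫ v, θ' (f t v) * ω v * collision (f t) v) t := by
  obtain ⟨D, hD⟩ := hf.exists_deriv
  -- `[t/2, b]` is a compact neighbourhood of `t` inside `(0, T)`, on which the solution and its
  -- time derivative are uniformly bounded.
  obtain ⟨b, htb, hbT⟩ := EReal.lt_iff_exists_real_btwn.1 htT
  have htb' : t < b := EReal.coe_lt_coe_iff.1 htb
  have hsub : ∀ s ∈ Set.Icc (t / 2) b, 0 < s ∧ (s : EReal) < T := fun s hs =>
    ⟨lt_of_lt_of_le (by linarith) hs.1, lt_of_le_of_lt (EReal.coe_le_coe_iff.2 hs.2) hbT⟩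
  have hfc : ContinuousOn f (Set.Icc (t / 2) b) :=
    hf.continuous.mono fun s hs => ⟨(hsub s hs).1.le, (hsub s hs).2⟩
  have hDc : ContinuousOn D (Set.Icc (t / 2) b) := fun s hs =>
    (hD s (hsub s hs).1 (hsub s hs).2).1.continuousWithinAt
  obtain ⟨C, N, hC, h⟩ := hω.bound
  obtain ⟨B, hB, hB'⟩ := exists_bd_le isCompact_Icc hDc (N + 4)
  obtain ⟨B₀, _, hB₀'⟩ := exists_bd_le isCompact_Icc hfc 0
  obtain ⟨E, hE, hE'⟩ := exists_bound_of_continuousOn_Ici hθ.cont' B₀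
  have hpos : ∀ s ∈ Set.Icc (t / 2) b, ∀ v, 0 ≤ f s v := fun s hs =>
    hf.nonneg s (hsub s hs).1.le (hsub s hs).2
  have key := (hasDerivAt_integral_of_dominated_loc_of_deriv_le (𝕜 := ℝ)
    (F := fun s v => θ (f s v) * ω v) (F' := fun s v => θ' (f s v) * ω v * D s v)
    (bound := fun v => E * (C * B * wt v)) (x₀ := t) (μ := (volume : Measure V))
    (Icc_mem_nhds (half_lt_self ht) htb') ?_ ?_ ?_ ?_ ?_ ?_).2
  · simpa only [(hD t ht htT).2.2] using key
  · exact Eventually.of_forall fun s =>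
      ((hθ.meas.comp (f s).continuous.measurable).mul hω.meas).aestronglyMeasurable
  · exact integrable_comp (hpos t ⟨by linarith, htb'.le⟩) hθ.linBound hω
  · exact (((hθ.meas'.comp (f t).continuous.measurable).mul hω.meas).mul
      (D t).continuous.measurable).aestronglyMeasurable
  · refine Eventually.of_forall fun v s hs => ?_
    rw [norm_mul, norm_mul, Real.norm_eq_abs, Real.norm_eq_abs, Real.norm_eq_abs, mul_assoc]
    refine mul_le_mul (hE' _ (hpos s hs v)
      ((le_abs_self _).trans ((abs_le_bd_zero _ v).trans (hB₀' s hs)))) ?_ (by positivity) hE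
    refine (Tame.mul_bd_le h hC (D s) v).trans ?_
    exact mul_le_mul_of_nonneg_right (mul_le_mul_of_nonneg_left (hB' s hs) hC) (wt_pos v).le
  · exact (integrable_wt.const_mul _).const_mul _
  · refine Eventually.of_forall fun v s hs => ?_
    have h1 := (hD s (hsub s hs).1 (hsub s hs).2).2.1 v
    have h2 := (hθ.deriv (f s v) (hpos s hs v)).comp s h1
    convert! h2.mul_const (ω v) using 1
    ring

/-- The weak form of the equation, tested against a weight `ω`. -/
theorem IsSchwartzSolution.hasDerivAt_moment (hf : IsSchwartzSolution T f_in f) {t : ℝ}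
    (ht : 0 < t) (htT : (t : EReal) < T) {ω : V → ℝ} {X : V → V}
    (hω : HasGrad ω fun v i => X v i) (ht1 : Tame ω) (hX : Measurable X)
    (ht2 : Tame fun v => ‖X v‖) :
    HasDerivAt (fun s => ∫ v, f s v * ω v) (-(1 / 2 * ∫ x : V × V,
      kq (x.1 - x.2) (X x.1 - X x.2) (current (f t) x.1 x.2) ∂(volume.prod volume))) t := by
  have h := hf.hasDerivAt_integral ht htT SmoothNonlin.id ht1
  rw [← integral_inner_flux (f t) hX ht2, ← integral_mul_collision hω ht1 ?_ (f t)]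
  · simpa using h
  · intro i
    refine ht2.of_le (by fun_prop) fun v => ?_
    rw [abs_norm]
    exact abs_coord_le (X v) i

theorem eq_of_hasDerivAt_zero {F : ℝ → ℝ} {t : ℝ} (ht : 0 ≤ t) (hc : ContinuousOn F (Set.Icc 0 t))
    (hd : ∀ s ∈ Set.Ioo 0 t, HasDerivAt F 0 s) : F t = F 0 := by
  rcases ht.eq_or_lt with rfl | ht
  · rfl
  · obtain ⟨c, hc', h⟩ := exists_hasDerivAt_eq_slope F (fun _ => 0) ht hc hd
    have : F t - F 0 = 0 := by
      have h2 := h.symm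
      rw [div_eq_zero_iff] at h2
      rcases h2 with h2 | h2
      · exact h2
      · linarith
    linarith

theorem IsSchwartzSolution.continuousOn_moment (hf : IsSchwartzSolution T f_in f) {t : ℝ}
    (htT : (t : EReal) < T) {ω : V → ℝ} (hω : Tame ω) :
    ContinuousOn (fun s => ∫ v, f s v * ω v) (Set.Icc 0 t) :=
  continuousOn_integral_comp isCompact_Icc (hf.continuousOn_Icc htT) (hf.nonneg_of_mem htT)
    LinBound.id hω

theorem coe_lt_of_mem {T : EReal} {s t : ℝ} (hs : s < t) (ht : (t : EReal) < T) :
    (s : EReal) < T := lt_trans (EReal.coe_lt_coe_iff.2 hs) ht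

/-- The constant weight has zero gradient, so its production vanishes. -/
theorem IsSchwartzSolution.mass_eq (hf : IsSchwartzSolution T f_in f) {t : ℝ} (ht : 0 ≤ t)
    (htT : (t : EReal) < T) : ∫ v, f t v = ∫ v, f_in v := by
  have h := eq_of_hasDerivAt_zero ht (hf.continuousOn_moment htT (tame_const 1)) fun s hs => by
    have := hf.hasDerivAt_moment hs.1 (coe_lt_of_mem hs.2 htT) (ω := fun _ => 1) (X := fun _ => 0)
      (by simpa using hasGrad_const 1) (tame_const 1) measurable_const (by simpa using tame_const 0)
    convert! this using 1
    simp [kq]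
  simpa [hf.initial] using h

/-- The gradient of `|v|²` has increment `2(v - w)`, the null direction of the kernel. -/
theorem IsSchwartzSolution.energy_eq (hf : IsSchwartzSolution T f_in f) {t : ℝ} (ht : 0 ≤ t)
    (htT : (t : EReal) < T) : ∫ v, f t v * ‖v‖ ^ 2 = ∫ v, f_in v * ‖v‖ ^ 2 := by
  have h := eq_of_hasDerivAt_zero ht (hf.continuousOn_moment htT (tame_norm.pow 2)) fun s hs => by
    have := hf.hasDerivAt_moment hs.1 (coe_lt_of_mem hs.2 htT) (ω := fun v => ‖v‖ ^ 2)
      (X := fun v => (2 : ℝ) • v) (by simpa using hasGrad_norm_sq) (tame_norm.pow 2) (by fun_prop)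
      (by simpa [norm_smul] using (tame_const 2).mul tame_norm)
    convert! this using 1
    simp [← smul_sub, kq_smul_left, kq_self_left]
  simpa [hf.initial] using h

end

/-! ### Regularized entropy dissipation -/

section

open Filter Topology

/-- A nonnegative Schwartz function controls the square of its gradient. -/
theorem pd_sq_le (g : 𝓢(V, ℝ)) (hg : ∀ v, 0 ≤ g v) (i : Fin 3) (v : V) :
    pd i g v ^ 2 ≤ 4 * bd 0 (pd i (pd i g)) * g v := by
  set L := bd 0 (pd i (pd i g)) with hL
  set e : V := EuclideanSpace.single i 1 with he
  have hline : ∀ (h : 𝓢(V, ℝ)) (τ : ℝ), HasDerivAt (fun τ : ℝ => h (v + τ • e))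
      (pd i h (v + τ • e)) τ := fun h τ => by
    have h1 : HasDerivAt (fun τ : ℝ => v + τ • e) e τ := by
      simpa using ((hasDerivAt_id τ).smul_const e).const_add v
    exact (h.hasFDerivAt (v + τ • e)).comp_hasDerivAt τ h1
  have hlip : ∀ τ, |pd i g (v + τ • e) - pd i g v| ≤ L * |τ| := fun τ => by
    have := (convex_univ (𝕜 := ℝ) (E := ℝ)).norm_image_sub_le_of_norm_hasDerivWithin_le
      (f := fun τ : ℝ => pd i g (v + τ • e)) (C := L) (x := 0) (y := τ)
      (fun x _ => (hline (pd i g) x).hasDerivWithinAt)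
      (fun x _ => abs_le_bd_zero (pd i (pd i g)) _) (Set.mem_univ _) (Set.mem_univ _)
    simpa using this
  -- Taylor's formula along a line: `g ≥ 0` makes this quadratic in `τ` nonnegative, and the claim
  -- is the sign of its discriminant.
  have key : ∀ τ : ℝ, 0 ≤ L * (τ * τ) + pd i g v * τ + g v := fun τ => by
    have := (convex_Icc (-|τ|) |τ|).norm_image_sub_le_of_norm_hasDerivWithin_le
      (f := fun τ : ℝ => g (v + τ • e) - pd i g v * τ) (C := L * |τ|) (x := 0) (y := τ)
      (f' := fun x => pd i g (v + x • e) - pd i g v)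
      (fun x _ => by
        have := (hline g x).sub ((hasDerivAt_id x).const_mul (pd i g v))
        rw [mul_one] at this
        exact this.hasDerivWithinAt)
      (fun x hx => (hlip x).trans (mul_le_mul_of_nonneg_left (abs_le.2 ⟨hx.1, hx.2⟩)
        (bd_nonneg _ _))) ⟨by simp, by simp⟩ ⟨neg_abs_le τ, le_abs_self τ⟩
    simp only [zero_smul, add_zero, mul_zero, sub_zero, Real.norm_eq_abs] at this
    have h1 := (abs_le.1 this).2
    have h2 := hg (v + τ • e)
    have h3 : |τ| * |τ| = τ * τ := abs_mul_abs_self τ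
    rw [mul_assoc, h3] at h1
    linarith
  have := discrim_le_zero key
  rw [discrim] at this
  linarith

/-- The regularized score `∇g / (g + ε)`. -/
def score (ε : ℝ) (g : 𝓢(V, ℝ)) (v : V) : V := (g v + ε)⁻¹ • gradient g v

/-- Quantitative regularity of a nonnegative Schwartz function, with weight `(1 + |v|)^N`. -/
structure Reg (N : ℕ) (B : ℝ) (g : 𝓢(V, ℝ)) : Prop where
  nonneg : ∀ v, 0 ≤ g v
  val : ∀ v, (1 + ‖v‖) ^ N * g v ≤ B
  grd : ∀ v, (1 + ‖v‖) ^ N * ‖gradient g v‖ ≤ B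
  score_le : ∀ η : ℝ, 0 < η → ∀ v, (1 + ‖v‖) ^ N * (η ^ 4 * ‖score (η ^ 4) g v‖) ≤ η * B

/-- Combining `|∂ᵢg|² ≤ 4Lg` with the decay of `∂ᵢg` gives `(1 + |v|)^N |∂ᵢg| ≤ C g^{1/4}`. With `ε
= η⁴` one has `ε g^{1/4} ≤ η (g + ε)`, so `ε` times the regularised score is `O(η)` with any
polynomial weight. This is why the regularisation parameter is a fourth power. -/
theorem pd_div_le {g : 𝓢(V, ℝ)} (hg : ∀ v, 0 ≤ g v) {N : ℕ} {i : Fin 3} {L B : ℝ}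
    (hL : bd 0 (pd i (pd i g)) ≤ L) (hB : bd (2 * N) (pd i g) ≤ B) {η : ℝ} (hη : 0 < η) (v : V) :
    (1 + ‖v‖) ^ N * (η ^ 4 * |pd i g v|) ≤ η * (1 + 4 * L * B ^ 2) * (g v + η ^ 4) := by
  have hL0 : 0 ≤ L := (bd_nonneg _ _).trans hL
  have hB0 : 0 ≤ B := (bd_nonneg _ _).trans hB
  have hgv := hg v
  set a := |pd i g v| with ha
  set P := (1 + ‖v‖) ^ N with hP
  have hP0 : 0 ≤ P := by positivity
  have ha0 : 0 ≤ a := abs_nonneg _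
  have h1 : P ^ 2 * a ≤ B := by
    rw [hP, ← pow_mul, mul_comm N 2]
    exact (mul_abs_le_bd (2 * N) (pd i g) v).trans hB
  have h2 : a ^ 2 ≤ 4 * L * g v := by
    rw [ha, sq_abs]
    exact (pd_sq_le g hg i v).trans (by gcongr)
  have h3 : (P * a) ^ 4 ≤ 4 * L * B ^ 2 * g v := by
    calc (P * a) ^ 4 = (P ^ 2 * a) ^ 2 * a ^ 2 := by ring
      _ ≤ B ^ 2 * (4 * L * g v) := by gcongr
      _ = _ := by ring
  set Q := 4 * L * B ^ 2 with hQ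
  have hQ0 : 0 ≤ Q := by positivity
  have h4 : Q ≤ (1 + Q) ^ 4 := by
    have : (1 + Q) ^ 1 ≤ (1 + Q) ^ 4 := pow_le_pow_right₀ (by linarith) (by norm_num)
    linarith
  -- Both `η⁴` and `g` are at most `g + η⁴`: three factors of the first kind and one of the second.
  have h5 : η ^ 12 * g v ≤ (g v + η ^ 4) ^ 4 := by
    have h6 : (η ^ 4) ^ 3 * g v ≤ (g v + η ^ 4) ^ 3 * (g v + η ^ 4) := by
      gcongr
      · linarith
      · linarith [pow_pos hη 4]
    calc η ^ 12 * g v = (η ^ 4) ^ 3 * g v := by ring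
      _ ≤ _ := h6
      _ = _ := by ring
  refine (pow_le_pow_iff_left₀ (by positivity) (by positivity) (n := 4) (by norm_num)).1 ?_
  calc (P * (η ^ 4 * a)) ^ 4 = η ^ 16 * (P * a) ^ 4 := by ring
    _ ≤ η ^ 16 * (Q * g v) := by gcongr
    _ = η ^ 4 * Q * (η ^ 12 * g v) := by ring
    _ ≤ η ^ 4 * (1 + Q) ^ 4 * (g v + η ^ 4) ^ 4 := by gcongr
    _ = _ := by ring

theorem reg_of_bounds {g : 𝓢(V, ℝ)} (hg : ∀ v, 0 ≤ g v) {N : ℕ} {L B B₀ B₁ : ℝ}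
    (hL : ∀ i, bd 0 (pd i (pd i g)) ≤ L) (hB : ∀ i, bd (2 * N) (pd i g) ≤ B)
    (hB₀ : bd N g ≤ B₀) (hB₁ : ∀ i, bd N (pd i g) ≤ B₁) :
    Reg N (B₀ + 3 * B₁ + 3 * (1 + 4 * L * B ^ 2)) g := by
  have hL0 : 0 ≤ L := (bd_nonneg _ _).trans (hL 0)
  have h0 : 0 ≤ B₀ := (bd_nonneg _ _).trans hB₀
  have h1 : 0 ≤ B₁ := (bd_nonneg _ _).trans (hB₁ 0)
  have hs : 0 ≤ 4 * L * B ^ 2 := by positivity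
  have hgrad : ∀ v, ‖gradient g v‖ ≤ ∑ i, |pd i g v| := fun v => by
    simpa only [schwartz_gradient_apply] using norm_le_sum_abs (gradient g v)
  refine ⟨hg, fun v => ?_, fun v => ?_, fun η hη v => ?_⟩
  · have := mul_abs_le_bd N g v
    rw [abs_of_nonneg (hg v)] at this
    linarith
  · calc (1 + ‖v‖) ^ N * ‖gradient g v‖ ≤ (1 + ‖v‖) ^ N * ∑ i, |pd i g v| := by
          gcongr
          exact hgrad v
      _ = ∑ i, (1 + ‖v‖) ^ N * |pd i g v| := Finset.mul_sum _ _ _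
      _ ≤ ∑ i : Fin 3, B₁ := Finset.sum_le_sum fun i _ => (mul_abs_le_bd N (pd i g) v).trans (hB₁ i)
      _ = 3 * B₁ := by simp
      _ ≤ _ := by linarith
  · have hpos : 0 < g v + η ^ 4 := by have := hg v; positivity
    have hsc : ‖score (η ^ 4) g v‖ = (g v + η ^ 4)⁻¹ * ‖gradient g v‖ := by
      rw [score, norm_smul, Real.norm_of_nonneg (by positivity)]
    have : (1 + ‖v‖) ^ N * (η ^ 4 * ‖gradient g v‖) ≤
        η * (3 * (1 + 4 * L * B ^ 2)) * (g v + η ^ 4) := by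
      calc (1 + ‖v‖) ^ N * (η ^ 4 * ‖gradient g v‖)
          ≤ (1 + ‖v‖) ^ N * (η ^ 4 * ∑ i, |pd i g v|) := by
            gcongr
            exact hgrad v
        _ = ∑ i, (1 + ‖v‖) ^ N * (η ^ 4 * |pd i g v|) := by rw [Finset.mul_sum, Finset.mul_sum]
        _ ≤ ∑ i : Fin 3, η * (1 + 4 * L * B ^ 2) * (g v + η ^ 4) :=
            Finset.sum_le_sum fun i _ => pd_div_le hg (hL i) (hB i) hη v
        _ = _ := by
          rw [Finset.sum_const, Finset.card_univ, Fintype.card_fin, nsmul_eq_mul]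
          push_cast
          ring
    calc (1 + ‖v‖) ^ N * (η ^ 4 * ‖score (η ^ 4) g v‖)
        = ((1 + ‖v‖) ^ N * (η ^ 4 * ‖gradient g v‖)) * (g v + η ^ 4)⁻¹ := by rw [hsc]; ring
      _ ≤ (η * (3 * (1 + 4 * L * B ^ 2)) * (g v + η ^ 4)) * (g v + η ^ 4)⁻¹ := by gcongr
      _ = η * (3 * (1 + 4 * L * B ^ 2)) := by field_simp
      _ ≤ _ := by
        apply mul_le_mul_of_nonneg_left _ hη.le
        linarith

theorem exists_reg {f : ℝ → 𝓢(V, ℝ)} {K : Set ℝ} (hK : IsCompact K) (hf : ContinuousOn f K)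
    (hpos : ∀ s ∈ K, ∀ v, 0 ≤ f s v) (N : ℕ) : ∃ B, ∀ s ∈ K, Reg N B (f s) := by
  have h1 : ∀ i, ContinuousOn (fun s => pd i (f s)) K := fun i =>
    (continuous_pd i).comp_continuousOn hf
  have h2 : ∀ i, ContinuousOn (fun s => pd i (pd i (f s))) K := fun i =>
    (continuous_pd i).comp_continuousOn (h1 i)
  obtain ⟨B₀, _, hB₀⟩ := exists_bd_le hK hf N
  choose B₁ h01 hB₁ using fun i => exists_bd_le hK (h1 i) N
  choose B₂ h02 hB₂ using fun i => exists_bd_le hK (h1 i) (2 * N)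
  choose L h0L hL using fun i => exists_bd_le hK (h2 i) 0
  have le_sum : ∀ {F : Fin 3 → ℝ}, (∀ i, 0 ≤ F i) → ∀ i, F i ≤ ∑ j, F j := fun hF i =>
    Finset.single_le_sum (fun j _ => hF j) (Finset.mem_univ i)
  exact ⟨_, fun s hs => reg_of_bounds (hpos s hs)
    (fun i => (hL i s hs).trans (le_sum h0L i)) (fun i => (hB₂ i s hs).trans (le_sum h02 i))
    (hB₀ s hs) fun i => (hB₁ i s hs).trans (le_sum h01 i)⟩

variable {g : 𝓢(V, ℝ)} {ε : ℝ}

theorem measurable_score (ε : ℝ) (g : 𝓢(V, ℝ)) : Measurable (score ε g) := by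
  unfold score
  have := g.continuous.measurable
  have := (continuous_gradient g).measurable
  fun_prop

theorem smul_score (hg : ∀ v, 0 ≤ g v) (hε : 0 < ε) (v : V) :
    gradient g v = (g v + ε) • score ε g v := by
  have : g v + ε ≠ 0 := by have := hg v; positivity
  rw [score, smul_inv_smul₀ this]

theorem mul_norm_score_le (hg : ∀ v, 0 ≤ g v) (hε : 0 < ε) (v : V) :
    g v * ‖score ε g v‖ ≤ ‖gradient g v‖ := by
  rw [smul_score hg hε v, norm_smul, Real.norm_of_nonneg (by have := hg v; positivity)]
  gcongr
  linarith

theorem norm_score_le (hg : ∀ v, 0 ≤ g v) (hε : 0 < ε) (v : V) :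
    ‖score ε g v‖ ≤ ε⁻¹ * ‖gradient g v‖ := by
  have := hg v
  rw [score, norm_smul, Real.norm_of_nonneg (by positivity)]
  gcongr
  linarith

theorem tame_norm_score (hg : ∀ v, 0 ≤ g v) (hε : 0 < ε) : Tame fun v => ‖score ε g v‖ := by
  obtain ⟨C, hC⟩ := (rapid_norm_gradient g).bound 0
  refine .of_bounded (C := ε⁻¹ * C) (measurable_score ε g).norm fun v => ?_
  rw [abs_norm]
  refine (norm_score_le hg hε v).trans ?_
  have := hC v
  rw [pow_zero, one_mul, abs_norm] at this
  gcongr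

/-- For `ε = 0` only the first term would be present, and it produces the dissipation; the second is
the regularisation error. -/
theorem current_eq_score (hg : ∀ v, 0 ≤ g v) (hε : 0 < ε) (v w : V) :
    current g v w = (g v * g w) • (score ε g v - score ε g w) +
      ε • (g w • score ε g v - g v • score ε g w) := by
  rw [current, smul_score hg hε v, smul_score hg hε w]
  module

/-- The regularized entropy dissipation, as a density on the product space. -/
def dissDensity (ε : ℝ) (g : 𝓢(V, ℝ)) (x : V × V) : ℝ :=
  g x.1 * g x.2 * kq (x.1 - x.2) (score ε g x.1 - score ε g x.2) (score ε g x.1 - score ε g x.2)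

/-- The regularized entropy dissipation. -/
def diss (ε : ℝ) (g : 𝓢(V, ℝ)) : ℝ := 1 / 2 * ∫ x, dissDensity ε g x ∂(volume.prod volume)

theorem dissDensity_nonneg (hg : ∀ v, 0 ≤ g v) (ε : ℝ) (x : V × V) : 0 ≤ dissDensity ε g x :=
  mul_nonneg (mul_nonneg (hg _) (hg _)) (kq_self_nonneg _ _)

theorem measurable_dissDensity (ε : ℝ) (g : 𝓢(V, ℝ)) : Measurable (dissDensity ε g) := by
  have h1 := measurable_score ε g
  have h2 := g.continuous.measurable
  have h3 := measurable_kq (α := V × V) (z := fun x => x.1 - x.2)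
    (a := fun x => score ε g x.1 - score ε g x.2) (b := fun x => score ε g x.1 - score ε g x.2)
    (by fun_prop) (by fun_prop) (by fun_prop)
  unfold dissDensity
  fun_prop

theorem integrable_dissDensity (hg : ∀ v, 0 ≤ g v) (hε : 0 < ε) :
    Integrable (dissDensity ε g) (volume.prod volume) := by
  have ht := tame_norm_score hg hε
  obtain ⟨C₁, hC₁, h1⟩ := ((ht.mul ht).mul_rapid (rapid_schwartz g)).exists_le_wt
  obtain ⟨C₂, hC₂, h2⟩ := (rapid_schwartz g).exists_le_wt
  refine integrable_of_le_wt (C := 4 * (C₁ * C₂)) (measurable_dissDensity ε g) fun v w => ?_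
  simp only [abs_mul, abs_norm] at h1
  rw [dissDensity, abs_mul, abs_mul]
  have hb := abs_kq_le (v - w) (score ε g v - score ε g w) (score ε g v - score ε g w)
  have hs : ‖score ε g v - score ε g w‖ * ‖score ε g v - score ε g w‖ ≤
      2 * (‖score ε g v‖ * ‖score ε g v‖ + ‖score ε g w‖ * ‖score ε g w‖) := by
    have := norm_sub_le (score ε g v) (score ε g w)
    nlinarith [norm_nonneg (score ε g v - score ε g w), sq_nonneg (‖score ε g v‖ - ‖score ε g w‖)]
  calc |g v| * |g w| * |kq (v - w) (score ε g v - score ε g w) (score ε g v - score ε g w)|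
      ≤ |g v| * |g w| * (‖v - w‖⁻¹ *
        (2 * (‖score ε g v‖ * ‖score ε g v‖ + ‖score ε g w‖ * ‖score ε g w‖))) := by
        gcongr
        exact hb.trans (by gcongr)
    _ = 2 * ((‖score ε g v‖ * ‖score ε g v‖ * |g v|) * |g w| +
        |g v| * (‖score ε g w‖ * ‖score ε g w‖ * |g w|)) * ‖v - w‖⁻¹ := by ring
    _ ≤ 2 * ((C₁ * wt v) * (C₂ * wt w) + (C₂ * wt v) * (C₁ * wt w)) * ‖v - w‖⁻¹ := by
        refine mul_le_mul_of_nonneg_right (mul_le_mul_of_nonneg_left (add_le_add ?_ ?_)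
          zero_le_two) (by positivity)
        · exact mul_le_mul (h1 v) (h2 w) (abs_nonneg _) (mul_nonneg hC₁ (wt_pos v).le)
        · exact mul_le_mul (h2 v) (h1 w) (by positivity) (mul_nonneg hC₂ (wt_pos v).le)
    _ = _ := by ring

theorem Reg.le_wt {B x : ℝ} {v : V} (h : (1 + ‖v‖) ^ 4 * x ≤ B) : x ≤ B * wt v := by
  rw [wt, ← div_eq_mul_inv, le_div_iff₀ (by positivity), mul_comm]
  exact h

theorem Reg.nonneg_const {N : ℕ} {B : ℝ} (h : Reg N B g) : 0 ≤ B :=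
  (mul_nonneg (by positivity) (h.nonneg 0)).trans (h.val 0)

/-- The constant `∬ (1 + |v|)⁻⁴ (1 + |w|)⁻⁴ |v - w|⁻¹`. -/
def pairConst : ℝ := ∫ x : V × V, wt x.1 * wt x.2 * ‖x.1 - x.2‖⁻¹ ∂(volume.prod volume)

/-- In the error the diagonal terms have the favourable sign and are dropped. In the remaining cross
term one factor `ε · score` is paired with one factor `g · score`, which yields the small factor `η`
and the product weight. -/
theorem entropy_density_le {B η : ℝ} (h : Reg 4 B g) (hη : 0 < η) (v w : V) :
    dissDensity (η ^ 4) g (v, w) - kq (v - w) (score (η ^ 4) g v - score (η ^ 4) g w)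
      (current g v w) ≤ 2 * (η * B ^ 2) * (wt v * wt w * ‖v - w‖⁻¹) := by
  have hε : 0 < η ^ 4 := by positivity
  have hB := h.nonneg_const
  rw [current_eq_score h.nonneg hε v w, kq_add_right, kq_smul_right, kq_smul_right, dissDensity]
  set a := score (η ^ 4) g v with ha
  set b := score (η ^ 4) g w with hb
  have e : kq (v - w) (a - b) (g w • a - g v • b) = g w * kq (v - w) a a + g v * kq (v - w) b b -
      (g v + g w) * kq (v - w) a b := by
    simp only [kq_sub_left, kq_sub_right, kq_smul_right]
    rw [kq_comm _ b a]
    ring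
  rw [e]
  have hgv := h.nonneg v
  have hgw := h.nonneg w
  have p1 : 0 ≤ g w * kq (v - w) a a := mul_nonneg hgw (kq_self_nonneg _ _)
  have p2 : 0 ≤ g v * kq (v - w) b b := mul_nonneg hgv (kq_self_nonneg _ _)
  have k1 := (le_abs_self _).trans (abs_kq_le (v - w) a b)
  have s1 : g v * ‖a‖ ≤ B * wt v := (mul_norm_score_le h.nonneg hε v).trans (Reg.le_wt (h.grd v))
  have s2 : g w * ‖b‖ ≤ B * wt w := (mul_norm_score_le h.nonneg hε w).trans (Reg.le_wt (h.grd w))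
  have s3 : η ^ 4 * ‖a‖ ≤ η * B * wt v := Reg.le_wt (h.score_le η hη v)
  have s4 : η ^ 4 * ‖b‖ ≤ η * B * wt w := Reg.le_wt (h.score_le η hη w)
  have hwv := (wt_pos v).le
  have hww := (wt_pos w).le
  calc _ = - (η ^ 4 * (g w * kq (v - w) a a + g v * kq (v - w) b b)) +
        η ^ 4 * (g v + g w) * kq (v - w) a b := by ring
    _ ≤ η ^ 4 * (g v + g w) * (‖v - w‖⁻¹ * (‖a‖ * ‖b‖)) := by
        have := mul_nonneg hε.le (add_nonneg p1 p2)
        have := mul_le_mul_of_nonneg_left k1 (by positivity : 0 ≤ η ^ 4 * (g v + g w))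
        linarith
    _ = ((g v * ‖a‖) * (η ^ 4 * ‖b‖) + (η ^ 4 * ‖a‖) * (g w * ‖b‖)) * ‖v - w‖⁻¹ := by ring
    _ ≤ ((B * wt v) * (η * B * wt w) + (η * B * wt v) * (B * wt w)) * ‖v - w‖⁻¹ := by gcongr
    _ = _ := by ring

/-- The entropy production is dominated by minus the dissipation, up to a small error. -/
theorem entropy_production_le {B η : ℝ} (h : Reg 4 B g) (hη : 0 < η) :
    -(1 / 2 * ∫ x : V × V, kq (x.1 - x.2) (score (η ^ 4) g x.1 - score (η ^ 4) g x.2)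
      (current g x.1 x.2) ∂(volume.prod volume)) ≤
      - diss (η ^ 4) g + η * (B ^ 2 * pairConst) := by
  have hε : 0 < η ^ 4 := by positivity
  have i1 := integrable_dissDensity h.nonneg hε
  have i2 := integrable_kq_current_sub g (measurable_score (η ^ 4) g) (tame_norm_score h.nonneg hε)
  have key := integral_mono (i1.sub i2) (integrable_prod_wt.const_mul (2 * (η * B ^ 2)))
    fun x => entropy_density_le h hη x.1 x.2
  rw [integral_const_mul] at key
  have e := integral_sub i1 i2
  simp only [Pi.sub_apply] at key
  rw [e] at key
  rw [diss, pairConst]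
  linarith

/-! ### The regularised entropy along the flow -/

/-- The regularized entropy density. -/
def entDens (ε x : ℝ) : ℝ := (x + ε) * (Real.log (x + ε) - Real.log ε) - x

/-- The affine corrections in the density make it and its derivative `log((x + ε)/ε)` vanish at
zero, as integrability over `ℝ³` requires; the gradient of that derivative along `g` is the
regularised score. -/
theorem smoothNonlin_entDens (hε : 0 < ε) :
    SmoothNonlin (entDens ε) fun x => Real.log (x + ε) - Real.log ε where
  meas := by unfold entDens; fun_prop
  meas' := by fun_prop
  zero := by simp [entDens]
  deriv x hx := by
    have hp : x + ε ≠ 0 := by positivity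
    have h1 : HasDerivAt (fun x => x + ε) 1 x := (hasDerivAt_id x).add_const ε
    have h2 := (h1.mul ((h1.log hp).sub_const (Real.log ε))).sub (hasDerivAt_id x)
    convert! h2 using 1
    field_simp
    ring
  cont' := by
    refine ContinuousOn.sub (ContinuousOn.log (by fun_prop) fun x hx => ?_) continuousOn_const
    have : 0 ≤ x := hx
    positivity

theorem hasGrad_log_add (hg : ∀ v, 0 ≤ g v) (hε : 0 < ε) :
    HasGrad (fun v => Real.log (g v + ε) - Real.log ε) fun v i => score ε g v i := by
  refine ((hasGrad_schwartz g).comp (φ := fun x => Real.log (x + ε) - Real.log ε)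
    (φ' := fun x => (x + ε)⁻¹) fun v => ?_).congr fun v i => ?_
  · have hp : g v + ε ≠ 0 := by have := hg v; positivity
    have h1 : HasDerivAt (fun x => x + ε) 1 (g v) := (hasDerivAt_id _).add_const ε
    simpa using (h1.log hp).sub_const (Real.log ε)
  · simp [score, schwartz_gradient_apply]

theorem tame_log_add (hg : ∀ v, 0 ≤ g v) (hε : 0 < ε) :
    Tame fun v => Real.log (g v + ε) - Real.log ε := by
  obtain ⟨C, _, hC⟩ := exists_bound_of_continuousOn_Ici (smoothNonlin_entDens hε).cont' (bd 0 g)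
  refine .of_bounded (C := C) (hasGrad_log_add hg hε).continuous.measurable fun v => ?_
  exact hC _ (hg v) ((le_abs_self _).trans (abs_le_bd_zero g v))

variable {T : EReal} {f_in : 𝓢(V, ℝ)} {f : ℝ → 𝓢(V, ℝ)}

theorem IsSchwartzSolution.hasDerivAt_entropy (hf : IsSchwartzSolution T f_in f) {t : ℝ}
    (ht : 0 < t) (htT : (t : EReal) < T) (hε : 0 < ε) :
    HasDerivAt (fun s => ∫ v, entDens ε (f s v)) (-(1 / 2 * ∫ x : V × V,
      kq (x.1 - x.2) (score ε (f t) x.1 - score ε (f t) x.2) (current (f t) x.1 x.2)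
        ∂(volume.prod volume))) t := by
  have hpos := hf.nonneg t ht.le htT
  have h := hf.hasDerivAt_integral ht htT (smoothNonlin_entDens hε) (tame_const 1)
  rw [← integral_inner_flux (f t) (measurable_score ε (f t)) (tame_norm_score hpos hε),
    ← integral_mul_collision (hasGrad_log_add hpos hε) (tame_log_add hpos hε) ?_ (f t)]
  · simpa using h
  · intro i
    refine (tame_norm_score hpos hε).of_le
      ((tame_coord i).meas.comp (measurable_score ε (f t))) fun v => ?_
    rw [abs_norm]
    exact abs_coord_le _ i

end

/-! ### Moments and the regular part of the kernel -/

section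

open Filter Topology

theorem hasDerivAt_max_zero_pow (n : ℕ) (x : ℝ) :
    HasDerivAt (fun x : ℝ => max x 0 ^ (n + 2)) ((n + 2 : ℕ) * max x 0 ^ (n + 1)) x := by
  rcases lt_trichotomy x 0 with hx | rfl | hx
  · have h : (fun x : ℝ => max x 0 ^ (n + 2)) =ᶠ[𝓝 x] fun _ => 0 := by
      filter_upwards [gt_mem_nhds hx] with y hy
      rw [max_eq_right hy.le]
      simp
    rw [max_eq_right hx.le]
    simpa using (hasDerivAt_const x (0 : ℝ)).congr_of_eventuallyEq h
  · have h1 : HasDerivWithinAt (fun x : ℝ => max x 0 ^ (n + 2)) 0 (Set.Iic 0) 0 :=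
      (hasDerivWithinAt_const 0 _ (0 : ℝ)).congr (fun y hy => by
        rw [max_eq_right hy]; simp) (by simp)
    have h2 : HasDerivWithinAt (fun x : ℝ => max x 0 ^ (n + 2)) 0 (Set.Ici 0) 0 := by
      have := (hasDerivAt_pow (n + 2) (0 : ℝ)).hasDerivWithinAt (s := Set.Ici 0)
      simp only [Nat.add_succ_sub_one, ne_eq, Nat.add_eq_zero_iff, one_ne_zero, and_false,
        not_false_eq_true, zero_pow, mul_zero] at this
      exact this.congr (fun y hy => by rw [max_eq_left hy]) (by simp)
    have h3 := h1.union h2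
    rw [Set.Iic_union_Ici, hasDerivWithinAt_univ] at h3
    simpa using h3
  · have h : (fun x : ℝ => max x 0 ^ (n + 2)) =ᶠ[𝓝 x] fun x => x ^ (n + 2) := by
      filter_upwards [lt_mem_nhds hx] with y hy
      rw [max_eq_left hy.le]
    rw [max_eq_left hx.le]
    exact (hasDerivAt_pow (n + 2) x).congr_of_eventuallyEq h

/-- A `C¹` function equal to `r` for `r ≥ 1`, bounded below, and larger than `r`. -/
def cutR (r : ℝ) : ℝ := r + max (1 - r) 0 ^ 2

theorem le_cutR (r : ℝ) : r ≤ cutR r := by unfold cutR; nlinarith [sq_nonneg (max (1 - r) 0)]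

theorem quarter_le_cutR (r : ℝ) : 1 / 4 ≤ cutR r := by
  unfold cutR
  have := le_max_left (1 - r) 0
  nlinarith [sq_nonneg (max (1 - r) 0 - 1 / 2)]

theorem cutR_pos (r : ℝ) : 0 < cutR r := lt_of_lt_of_le (by norm_num) (quarter_le_cutR r)

theorem cutR_of_one_le {r : ℝ} (h : 1 ≤ r) : cutR r = r := by
  rw [cutR, max_eq_right (by linarith)]
  simp

theorem continuous_cutR : Continuous cutR := by unfold cutR; fun_prop

/-- The regular part of `r^{-3/2}`. -/
def cutH (r : ℝ) : ℝ := cutR r ^ (-3 / 2 : ℝ)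

/-- The derivative of `cutH`. -/
def cutH' (r : ℝ) : ℝ := -3 / 2 * cutR r ^ (-3 / 2 - 1 : ℝ) * (1 - 2 * max (1 - r) 0)

theorem hasDerivAt_cutH (r : ℝ) : HasDerivAt cutH (cutH' r) r := by
  have h1 : HasDerivAt cutR (1 - 2 * max (1 - r) 0) r := by
    have h2 := (hasDerivAt_max_zero_pow 0 (1 - r)).comp r ((hasDerivAt_id r).const_sub 1)
    convert! (hasDerivAt_id r).add h2 using 1
    simp
    ring
  convert! h1.rpow_const (p := -3 / 2) (Or.inl (cutR_pos r).ne') using 1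
  rw [cutH']
  ring

theorem cutR_rpow_le (r : ℝ) {a : ℝ} (ha : a ≤ 0) : cutR r ^ a ≤ (1 / 4 : ℝ) ^ a :=
  Real.rpow_le_rpow_of_nonpos (by norm_num) (quarter_le_cutR r) ha

theorem cutH_nonneg (r : ℝ) : 0 ≤ cutH r := (Real.rpow_pos_of_pos (cutR_pos r) _).le

/-- With `r = |z|²`: the regular kernel applied to quantities of size `O(|z|²)` stays bounded,
uniformly in `z`. -/
theorem mul_cutH_le (r : ℝ) : r * cutH r ≤ 2 := by
  have h1 : cutR r * cutH r = cutR r ^ (-1 / 2 : ℝ) := by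
    have := Real.rpow_add (cutR_pos r) 1 (-3 / 2)
    rw [Real.rpow_one] at this
    rw [cutH, ← this]
    norm_num
  calc r * cutH r ≤ cutR r * cutH r := mul_le_mul_of_nonneg_right (le_cutR r) (cutH_nonneg r)
    _ ≤ (1 / 4 : ℝ) ^ (-1 / 2 : ℝ) := h1 ▸ cutR_rpow_le r (by norm_num)
    _ = 2 := by
      rw [show (1 / 4 : ℝ) = 2 ^ (-2 : ℝ) by
        rw [Real.rpow_neg (by norm_num)]; norm_num, ← Real.rpow_mul (by norm_num)]
      norm_num

theorem tame_cutH : Tame fun z => cutH (‖z‖ ^ 2) := by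
  have := continuous_cutR.measurable
  refine .of_bounded (C := (1 / 4 : ℝ) ^ (-3 / 2 : ℝ)) ?_ fun z => ?_
  · unfold cutH; fun_prop
  · rw [abs_of_nonneg (cutH_nonneg _)]
    exact cutR_rpow_le _ (by norm_num)

theorem tame_cutH' : Tame fun z => cutH' (‖z‖ ^ 2) := by
  have := continuous_cutR.measurable
  refine .of_bounded (C := 3 / 2 * (1 / 4 : ℝ) ^ (-3 / 2 - 1 : ℝ) * 1) ?_ fun z => ?_
  · unfold cutH'; fun_prop
  · have h1 : |1 - 2 * max (1 - ‖z‖ ^ 2) 0| ≤ 1 := by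
      have h2 : max (1 - ‖z‖ ^ 2) 0 ≤ 1 := max_le (by nlinarith [sq_nonneg ‖z‖]) zero_le_one
      have h3 := le_max_right (1 - ‖z‖ ^ 2) 0
      rw [abs_le]
      constructor <;> linarith
    rw [cutH', abs_mul, abs_mul, abs_of_nonneg (Real.rpow_pos_of_pos (cutR_pos _) _).le]
    have h2 := cutR_rpow_le (‖z‖ ^ 2) (a := -3 / 2 - 1) (by norm_num)
    have h3 : |(-3 / 2 : ℝ)| = 3 / 2 := by norm_num [abs_of_neg]
    rw [h3]
    gcongr

/-- The fraction of the kernel treated as regular. -/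
def farFrac (z : V) : ℝ := ‖z‖ ^ 3 * cutH (‖z‖ ^ 2)

theorem farFrac_nonneg (z : V) : 0 ≤ farFrac z := mul_nonneg (by positivity) (cutH_nonneg _)

theorem farFrac_le_one (z : V) : farFrac z ≤ 1 := by
  rcases eq_or_ne z 0 with rfl | hz
  · simp [farFrac]
  · have hn : 0 < ‖z‖ := norm_pos_iff.2 hz
    have h1 : cutH (‖z‖ ^ 2) ≤ (‖z‖ ^ 2) ^ (-3 / 2 : ℝ) :=
      Real.rpow_le_rpow_of_nonpos (by positivity) (le_cutR _) (by norm_num)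
    rw [norm_sq_rpow_neg_three_half] at h1
    calc farFrac z ≤ ‖z‖ ^ 3 * (‖z‖ ^ 3)⁻¹ := mul_le_mul_of_nonneg_left h1 (by positivity)
      _ = 1 := mul_inv_cancel₀ (by positivity)

theorem farFrac_eq_one {z : V} (h : 1 ≤ ‖z‖) : farFrac z = 1 := by
  have h1 : 1 ≤ ‖z‖ ^ 2 := one_le_pow₀ h
  rw [farFrac, cutH, cutR_of_one_le h1, norm_sq_rpow_neg_three_half]
  exact mul_inv_cancel₀ (by positivity)

theorem farFrac_neg (z : V) : farFrac (-z) = farFrac z := by simp [farFrac]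

theorem measurable_farFrac : Measurable farFrac := by
  have := tame_cutH.meas
  unfold farFrac
  fun_prop

theorem farFrac_mul_kq (z a b : V) : farFrac z * kq z a b =
    (8 * Real.pi)⁻¹ * (cutH (‖z‖ ^ 2) * (‖z‖ ^ 2 * inner ℝ a b - inner ℝ z a * inner ℝ z b)) := by
  rcases eq_or_ne z 0 with rfl | hz
  · simp [farFrac]
  · have hn : 0 < ‖z‖ := norm_pos_iff.2 hz
    have := Real.pi_pos
    rw [farFrac, kq]
    field_simp

variable {m : ℝ}

/-- The gradient of `⟨v⟩ᵐ`. -/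
def momGrad (m : ℝ) (v : V) : V := (m * regPow 1 (m / 2 - 1) v) • v

/-- The Hessian of `⟨v⟩ᵐ`. -/
def momHess (m : ℝ) (i : Fin 3) (v : V) (l : Fin 3) : ℝ :=
  m * (regPow 1 (m / 2 - 1) v * (if l = i then 1 else 0) +
    v i * (2 * (m / 2 - 1) * v l * regPow 1 (m / 2 - 1 - 1) v))

theorem regPow_one_pos (a : ℝ) (v : V) : 0 < regPow 1 a v := by unfold regPow; positivity

theorem hasGrad_moment (m : ℝ) : HasGrad (regPow 1 (m / 2)) fun v i => momGrad m v i :=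
  (hasGrad_regPow one_pos (m / 2)).congr fun v i => by
    simp only [momGrad, PiLp.smul_apply, smul_eq_mul]
    ring

theorem hasGrad_momGrad (m : ℝ) (i : Fin 3) :
    HasGrad (fun v => momGrad m v i) (momHess m i) := by
  have h := (hasGrad_const m).mul ((hasGrad_coord i).mul (hasGrad_regPow one_pos (m / 2 - 1)))
  have e : (fun v => momGrad m v i) = fun v : V => m * (v i * regPow 1 (m / 2 - 1) v) := by
    ext v
    simp only [momGrad, PiLp.smul_apply, smul_eq_mul]
    ring
  rw [e]
  exact h.congr fun v l => by
    rw [momHess]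
    ring

theorem abs_momHess_le (hm : 2 < m) (i : Fin 3) (v : V) (l : Fin 3) :
    |momHess m i v l| ≤ m * (m - 1) * regPow 1 (m / 2 - 1) v := by
  have hp := (regPow_one_pos (m / 2 - 1) v).le
  have hp' := (regPow_one_pos (m / 2 - 1 - 1) v).le
  have h1 : |regPow 1 (m / 2 - 1) v * (if l = i then 1 else 0)| ≤ regPow 1 (m / 2 - 1) v := by
    split_ifs
    · rw [mul_one, abs_of_nonneg hp]
    · simpa using hp
  have h2 : |v i * (2 * (m / 2 - 1) * v l * regPow 1 (m / 2 - 1 - 1) v)| ≤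
      (m - 2) * regPow 1 (m / 2 - 1) v := by
    have e : v i * (2 * (m / 2 - 1) * v l * regPow 1 (m / 2 - 1 - 1) v) =
      (m - 2) * ((v i * v l) * regPow 1 (m / 2 - 1 - 1) v) := by ring
    rw [e, abs_mul, abs_of_pos (by linarith : 0 < m - 2), abs_mul, abs_of_nonneg hp']
    refine mul_le_mul_of_nonneg_left ?_ (by linarith)
    rw [← sq_mul_regPow one_pos (m / 2 - 1) v]
    refine mul_le_mul_of_nonneg_right ?_ hp'
    rw [abs_mul]
    have := mul_le_mul (abs_coord_le v i) (abs_coord_le v l) (abs_nonneg _) (norm_nonneg _)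
    nlinarith
  rw [momHess, abs_mul, abs_of_pos (by linarith : 0 < m), mul_assoc m (m - 1)]
  refine mul_le_mul_of_nonneg_left ?_ (by linarith)
  refine (abs_add_le _ _).trans ?_
  linarith

theorem regPow_one_mono {a : ℝ} (ha : 0 ≤ a) {v w : V} (h : ‖v‖ ≤ ‖w‖) :
    regPow 1 a v ≤ regPow 1 a w := by
  unfold regPow
  gcongr

theorem regPow_one_le_of_mem_segment {a : ℝ} (ha : 0 ≤ a) {v w x : V} (h : x ∈ segment ℝ v w) :
    regPow 1 a x ≤ regPow 1 a v + regPow 1 a w := by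
  have h1 : ‖x‖ ≤ max ‖v‖ ‖w‖ := by
    have hc := (convexOn_norm (convex_univ (𝕜 := ℝ) (E := V)))
    exact hc.le_on_segment (Set.mem_univ _) (Set.mem_univ _) h
  have p1 := (regPow_one_pos a v).le
  have p2 := (regPow_one_pos a w).le
  rcases le_max_iff.1 h1 with h2 | h2
  · linarith [regPow_one_mono ha h2]
  · linarith [regPow_one_mono ha h2]

/-- Mean value inequality on the segment from `w` to `v`. As `m > 2`, the Hessian bound increases
with `|v|`, and by convexity of the norm it is controlled on the segment by its values at the
endpoints. -/
theorem norm_momGrad_sub_le (hm : 2 < m) (v w : V) :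
    ‖momGrad m v - momGrad m w‖ ≤ 9 * (m * (m - 1)) *
      (regPow 1 (m / 2 - 1) v + regPow 1 (m / 2 - 1) w) * ‖v - w‖ := by
  have key : ∀ i, |momGrad m v i - momGrad m w i| ≤ 3 * (m * (m - 1)) *
      (regPow 1 (m / 2 - 1) v + regPow 1 (m / 2 - 1) w) * ‖v - w‖ := fun i => by
    refine (convex_segment w v).norm_image_sub_le_of_norm_hasFDerivWithin_le
      (f := fun v => momGrad m v i) (fun x _ => (hasGrad_momGrad m i x).hasFDerivWithinAt)
      (fun x hx => ?_) (left_mem_segment ℝ w v) (right_mem_segment ℝ w v)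
    refine (norm_clm_le _).trans ?_
    simp only [dualForm_single]
    have hx' := regPow_one_le_of_mem_segment (a := m / 2 - 1) (by linarith) hx
    have hmm : 0 ≤ m * (m - 1) := by nlinarith
    calc ∑ l, |momHess m i x l| ≤ ∑ l : Fin 3, m * (m - 1) *
          (regPow 1 (m / 2 - 1) v + regPow 1 (m / 2 - 1) w) := Finset.sum_le_sum fun l _ => by
            refine (abs_momHess_le hm i x l).trans (mul_le_mul_of_nonneg_left ?_ hmm)
            linarith
      _ = _ := by
        rw [Finset.sum_const, Finset.card_univ, Fintype.card_fin, nsmul_eq_mul]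
        push_cast
        ring
  refine (norm_le_sum_abs _).trans ?_
  calc ∑ i, |(momGrad m v - momGrad m w) i| ≤ ∑ i : Fin 3, 3 * (m * (m - 1)) *
      (regPow 1 (m / 2 - 1) v + regPow 1 (m / 2 - 1) w) * ‖v - w‖ :=
        Finset.sum_le_sum fun i _ => key i
    _ = _ := by
      rw [Finset.sum_const, Finset.card_univ, Fintype.card_fin, nsmul_eq_mul]
      push_cast
      ring

theorem regPow_one_le_pow {a : ℝ} (ha : 0 ≤ a) (v : V) :
    regPow 1 a v ≤ (1 + ‖v‖) ^ ⌈2 * a⌉₊ := by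
  have h1 : 1 ≤ 1 + ‖v‖ := by linarith [norm_nonneg v]
  calc regPow 1 a v ≤ ((1 + ‖v‖) ^ 2) ^ a := by
        unfold regPow
        gcongr
        nlinarith [norm_nonneg v]
    _ = (1 + ‖v‖) ^ (2 * a) := by
        rw [← Real.rpow_natCast, ← Real.rpow_mul (by positivity)]
        norm_num
    _ ≤ (1 + ‖v‖) ^ ((⌈2 * a⌉₊ : ℕ) : ℝ) := Real.rpow_le_rpow_of_exponent_le h1 (Nat.le_ceil _)
    _ = _ := Real.rpow_natCast _ _

theorem tame_regPow_one {a : ℝ} (ha : 0 ≤ a) : Tame (regPow 1 a) :=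
  ⟨measurable_regPow _ _, 1, ⌈2 * a⌉₊, zero_le_one, fun v => by
    rw [abs_of_pos (regPow_one_pos a v), one_mul]
    exact regPow_one_le_pow ha v⟩

theorem norm_momGrad_le (hm : 2 < m) (v : V) :
    ‖momGrad m v‖ ≤ m * (1 + ‖v‖) ^ (⌈m - 2⌉₊ + 1) := by
  rw [momGrad, norm_smul, Real.norm_of_nonneg (mul_nonneg (by linarith) (regPow_one_pos _ v).le),
    pow_succ, mul_assoc]
  have h := regPow_one_le_pow (a := m / 2 - 1) (by linarith) v
  rw [show 2 * (m / 2 - 1) = m - 2 by ring] at h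
  have := norm_nonneg v
  have h2 := (regPow_one_pos (m / 2 - 1) v).le
  gcongr
  linarith

theorem measurable_momGrad (m : ℝ) : Measurable (momGrad m) := by
  have := measurable_regPow 1 (m / 2 - 1)
  unfold momGrad
  fun_prop

theorem tame_norm_momGrad (hm : 2 < m) : Tame fun v => ‖momGrad m v‖ :=
  ⟨(measurable_momGrad m).norm, m, ⌈m - 2⌉₊ + 1, by linarith, fun v => by
    rw [abs_norm]
    exact norm_momGrad_le hm v⟩

end

/-! ### Regular part of the moment production -/

section

open Filter Topology

variable {m : ℝ} {g : 𝓢(V, ℝ)}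

/-- The regular part of the kernel applied to the increment of the gradient of `⟨v⟩ᵐ`, without
the factor `1 / (8π)`. -/
def farField (m : ℝ) (w : V) (i : Fin 3) (v : V) : ℝ :=
  cutH (‖v - w‖ ^ 2) * (‖v - w‖ ^ 2 * (momGrad m v i - momGrad m w i) -
    (∑ j, (v j - w j) * (momGrad m v j - momGrad m w j)) * (v i - w i))

/-- The partial derivatives of `farField`. -/
def farFieldPartial (m : ℝ) (w : V) (i : Fin 3) (v : V) (l : Fin 3) : ℝ :=
  cutH (‖v - w‖ ^ 2) * ((‖v - w‖ ^ 2 * (momHess m i v l - 0) +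
      (momGrad m v i - momGrad m w i) * (2 * (v - w) l)) -
    ((∑ j, (v j - w j) * (momGrad m v j - momGrad m w j)) * ((if l = i then 1 else 0) - 0) +
      (v i - w i) * ∑ j, ((v j - w j) * (momHess m j v l - 0) +
        (momGrad m v j - momGrad m w j) * ((if l = j then 1 else 0) - 0)))) +
  (‖v - w‖ ^ 2 * (momGrad m v i - momGrad m w i) -
    (∑ j, (v j - w j) * (momGrad m v j - momGrad m w j)) * (v i - w i)) *
      (cutH' (‖v - w‖ ^ 2) * (2 * (v - w) l))

theorem hasGrad_farField (m : ℝ) (w : V) (i : Fin 3) :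
    HasGrad (farField m w i) (farFieldPartial m w i) := by
  have hz : ∀ i : Fin 3, HasGrad (fun v : V => v i - w i) _ := fun i =>
    (hasGrad_coord i).sub (hasGrad_const (w i))
  have hN := hasGrad_norm_sq.comp_sub_const w
  have hX : ∀ i : Fin 3, HasGrad (fun v : V => momGrad m v i - momGrad m w i) _ := fun i =>
    (hasGrad_momGrad m i).sub (hasGrad_const (momGrad m w i))
  have hH := hN.comp (φ := cutH) (φ' := cutH') fun v => hasDerivAt_cutH _
  exact hH.mul ((hN.mul (hX i)).sub ((HasGrad.sum Finset.univ fun j => (hz j).mul (hX j)).mul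
    (hz i)))

theorem tame_momGrad_sub (hm : 2 < m) (w : V) (i : Fin 3) :
    Tame fun v => momGrad m v i - momGrad m w i := by
  refine Tame.sub ?_ (tame_const _)
  refine (tame_norm_momGrad hm).of_le ((tame_coord i).meas.comp (measurable_momGrad m)) fun v => ?_
  rw [abs_norm]
  exact abs_coord_le _ i

theorem tame_momHess (hm : 2 < m) (i l : Fin 3) : Tame fun v => momHess m i v l := by
  refine ((tame_const (m * (m - 1))).mul (tame_regPow_one (a := m / 2 - 1) (by linarith))).of_le
    ?_ fun v => ?_
  · have := measurable_regPow 1 (m / 2 - 1)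
    have := measurable_regPow 1 (m / 2 - 1 - 1)
    unfold momHess
    fun_prop
  · exact (abs_momHess_le hm i v l).trans (le_abs_self _)

theorem Tame.comp_sub_const {k : V → ℝ} (hk : Tame k) (w : V) : Tame fun v => k (v - w) := by
  obtain ⟨C, N, hC, h⟩ := hk.bound
  refine ⟨hk.meas.comp (measurable_id.sub measurable_const), C * (1 + ‖w‖) ^ N, N, by positivity,
    fun v => (h _).trans ?_⟩
  rw [mul_assoc, ← mul_pow]
  have := norm_sub_le v w
  gcongr
  nlinarith [norm_nonneg v, norm_nonneg w]

theorem tame_coord_sub (w : V) (i : Fin 3) : Tame fun v : V => v i - w i :=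
  (tame_coord i).sub (tame_const _)

theorem tame_farField (hm : 2 < m) (w : V) (i : Fin 3) : Tame (farField m w i) :=
  (tame_cutH.comp_sub_const w).mul ((((tame_norm.pow 2).comp_sub_const w).mul
    (tame_momGrad_sub hm w i)).sub ((Tame.sum _ fun j => (tame_coord_sub w j).mul
      (tame_momGrad_sub hm w j)).mul (tame_coord_sub w i)))

theorem tame_farFieldPartial (hm : 2 < m) (w : V) (i l : Fin 3) :
    Tame fun v => farFieldPartial m w i v l := by
  have hN := (tame_norm.pow 2).comp_sub_const w
  have hS : Tame fun v : V => ∑ j, (v j - w j) * (momGrad m v j - momGrad m w j) :=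
    Tame.sum _ fun j => (tame_coord_sub w j).mul (tame_momGrad_sub hm w j)
  have h2 : Tame fun v : V => 2 * (v - w) l :=
    (tame_const 2).mul ((tame_coord l).comp_sub_const w)
  exact ((tame_cutH.comp_sub_const w).mul (((hN.mul ((tame_momHess hm i l).sub (tame_const 0))).add
    ((tame_momGrad_sub hm w i).mul h2)).sub ((hS.mul ((tame_ite l i).sub (tame_const 0))).add
      ((tame_coord_sub w i).mul (Tame.sum _ fun j =>
        ((tame_coord_sub w j).mul ((tame_momHess hm j l).sub (tame_const 0))).add
          ((tame_momGrad_sub hm w j).mul ((tame_ite l j).sub (tame_const 0)))))))).add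
    (((hN.mul (tame_momGrad_sub hm w i)).sub (hS.mul (tame_coord_sub w i))).mul
      ((tame_cutH'.comp_sub_const w).mul h2))

/-- The derivative of the radial cut-off disappears: it points along `v - w`, to which the projected
field is orthogonal. -/
theorem sum_farFieldPartial (m : ℝ) (w v : V) : ∑ i, farFieldPartial m w i v i =
    cutH (‖v - w‖ ^ 2) * (‖v - w‖ ^ 2 * (∑ i, momHess m i v i) -
      (∑ i, ∑ j, (v i - w i) * (v j - w j) * momHess m j v i) -
      2 * ∑ j, (v j - w j) * (momGrad m v j - momGrad m w j)) := by
  simp only [farFieldPartial]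
  rw [sum_fin_three_norm_sq]
  simp [Fin.sum_univ_three]
  ring

/-- Every term in the divergence carries a factor `|v - w|²`, which the cut-off kernel absorbs at
the cost of a factor two. -/
theorem abs_sum_farFieldPartial_le (hm : 2 < m) (w v : V) :
    |∑ i, farFieldPartial m w i v i| ≤ 60 * (m * (m - 1)) *
      (regPow 1 (m / 2 - 1) v + regPow 1 (m / 2 - 1) w) := by
  set ρ := regPow 1 (m / 2 - 1) v with hρ
  set ρ' := regPow 1 (m / 2 - 1) w with hρ'
  set C := m * (m - 1) with hC
  have hC0 : 0 ≤ C := by rw [hC]; nlinarith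
  have hρ0 : 0 ≤ ρ := (regPow_one_pos _ v).le
  have hρ0' : 0 ≤ ρ' := (regPow_one_pos _ w).le
  set r := ‖v - w‖ with hr
  have hr0 : 0 ≤ r := norm_nonneg _
  have hcoord : ∀ i, |v i - w i| ≤ r := fun i => abs_coord_le (v - w) i
  have h1 : |∑ i, momHess m i v i| ≤ 3 * (C * ρ) := by
    refine (Finset.abs_sum_le_sum_abs _ _).trans ?_
    refine (Finset.sum_le_sum fun i _ => abs_momHess_le hm i v i).trans ?_
    simp [hC, hρ]
  have h2 : |∑ i, ∑ j, (v i - w i) * (v j - w j) * momHess m j v i| ≤ 9 * (r ^ 2 * (C * ρ)) := by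
    have hb : ∀ i j, |(v i - w i) * (v j - w j) * momHess m j v i| ≤ r ^ 2 * (C * ρ) := by
      intro i j
      rw [abs_mul, abs_mul, sq]
      exact mul_le_mul (mul_le_mul (hcoord i) (hcoord j) (abs_nonneg _) hr0)
        (abs_momHess_le hm j v i) (abs_nonneg _) (by positivity)
    refine (Finset.abs_sum_le_sum_abs _ _).trans ?_
    refine (Finset.sum_le_sum fun i _ => (Finset.abs_sum_le_sum_abs _ _).trans
      (Finset.sum_le_sum fun j _ => hb i j)).trans ?_
    simp only [Finset.sum_const, Finset.card_univ, Fintype.card_fin, nsmul_eq_mul]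
    push_cast
    linarith
  have h3 : |∑ j, (v j - w j) * (momGrad m v j - momGrad m w j)| ≤ r ^ 2 * (9 * C * (ρ + ρ')) := by
    have e : ∑ j, (v j - w j) * (momGrad m v j - momGrad m w j) =
        inner ℝ (v - w) (momGrad m v - momGrad m w) := by
      rw [inner_eq_sum]
      simp
    rw [e]
    refine (abs_real_inner_le_norm _ _).trans ?_
    have := mul_le_mul_of_nonneg_left (norm_momGrad_sub_le hm v w) hr0
    refine this.trans (le_of_eq ?_)
    rw [← hr, ← hρ, ← hρ', ← hC]
    ring
  rw [sum_farFieldPartial, abs_mul, abs_of_nonneg (cutH_nonneg _)]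
  have h4 : |r ^ 2 * (∑ i, momHess m i v i) - (∑ i, ∑ j, (v i - w i) * (v j - w j) *
      momHess m j v i) - 2 * ∑ j, (v j - w j) * (momGrad m v j - momGrad m w j)| ≤
      r ^ 2 * (30 * C * (ρ + ρ')) := by
    refine (abs_sub _ _).trans ?_
    refine (add_le_add (abs_sub _ _) le_rfl).trans ?_
    rw [abs_mul, abs_mul, abs_of_nonneg (sq_nonneg r), abs_of_pos (two_pos : (0 : ℝ) < 2)]
    have := mul_le_mul_of_nonneg_left h1 (sq_nonneg r)
    have hh : 0 ≤ r ^ 2 * (C * ρ') := by positivity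
    nlinarith
  have h5 := mul_cutH_le (r ^ 2)
  calc cutH (r ^ 2) * _ ≤ cutH (r ^ 2) * (r ^ 2 * (30 * C * (ρ + ρ'))) :=
        mul_le_mul_of_nonneg_left h4 (cutH_nonneg _)
    _ = (r ^ 2 * cutH (r ^ 2)) * (30 * C * (ρ + ρ')) := by ring
    _ ≤ 2 * (30 * C * (ρ + ρ')) := by gcongr
    _ = _ := by ring

/-- Half of the regular part of the symmetrized moment production. -/
def farHalf (m : ℝ) (g : 𝓢(V, ℝ)) (x : V × V) : ℝ :=
  farFrac (x.1 - x.2) * kq (x.1 - x.2) (momGrad m x.1 - momGrad m x.2) (g x.2 • gradient g x.1)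

theorem farHalf_add_swap (m : ℝ) (g : 𝓢(V, ℝ)) (x : V × V) :
    farFrac (x.1 - x.2) * kq (x.1 - x.2) (momGrad m x.1 - momGrad m x.2) (current g x.1 x.2) =
      farHalf m g x + farHalf m g x.swap := by
  simp only [farHalf, Prod.fst_swap, Prod.snd_swap]
  rw [← neg_sub x.1 x.2, farFrac_neg, kq_neg_left, ← neg_sub (momGrad m x.1), kq_comm _ (-_),
    kq_neg_right, kq_comm _ _ (momGrad m x.1 - _), current, kq_sub_right]
  ring

theorem farHalf_eq_sum (m : ℝ) (g : 𝓢(V, ℝ)) (v w : V) :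
    farHalf m g (v, w) = (8 * Real.pi)⁻¹ * g w * ∑ i, farField m w i v * pd i g v := by
  simp only [farHalf]
  rw [farFrac_mul_kq]
  simp only [inner_eq_sum, farField, PiLp.sub_apply, PiLp.smul_apply, smul_eq_mul,
    schwartz_gradient_apply, Fin.sum_univ_three]
  ring

theorem measurable_farHalf (m : ℝ) (g : 𝓢(V, ℝ)) : Measurable (farHalf m g) := by
  have h1 := measurable_farFrac
  have h2 := measurable_momGrad m
  have h3 := g.continuous.measurable
  have h4 := (continuous_gradient g).measurable
  unfold farHalf
  refine Measurable.mul (by fun_prop) (measurable_kq (by fun_prop) (by fun_prop) ?_)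
  fun_prop

theorem integrable_farHalf (hm : 2 < m) (g : 𝓢(V, ℝ)) :
    Integrable (farHalf m g) (volume.prod volume) := by
  obtain ⟨C₁, hC₁, h1⟩ := ((tame_norm_momGrad hm).mul_rapid (rapid_norm_gradient g)).exists_le_wt
  obtain ⟨C₂, hC₂, h2⟩ := ((tame_norm_momGrad hm).mul_rapid (rapid_schwartz g)).exists_le_wt
  obtain ⟨C₃, hC₃, h3⟩ := (rapid_norm_gradient g).exists_le_wt
  obtain ⟨C₄, hC₄, h4⟩ := (rapid_schwartz g).exists_le_wt
  refine integrable_of_le_wt (C := C₁ * C₄ + C₃ * C₂) (measurable_farHalf m g) fun v w => ?_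
  simp only [abs_mul, abs_norm] at h1 h2 h3
  rw [farHalf, abs_mul, abs_of_nonneg (farFrac_nonneg _)]
  have hs := norm_sub_le (momGrad m v) (momGrad m w)
  calc farFrac (v - w) * |kq (v - w) (momGrad m v - momGrad m w) (g w • gradient g v)|
      ≤ 1 * (‖v - w‖⁻¹ * (‖momGrad m v - momGrad m w‖ * ‖g w • gradient g v‖)) :=
        mul_le_mul (farFrac_le_one _) (abs_kq_le _ _ _) (abs_nonneg _) zero_le_one
    _ ≤ 1 * (‖v - w‖⁻¹ * ((‖momGrad m v‖ + ‖momGrad m w‖) * (|g w| * ‖gradient g v‖))) := by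
        rw [norm_smul, Real.norm_eq_abs]
        gcongr
    _ = ((‖momGrad m v‖ * ‖gradient g v‖) * |g w| +
        ‖gradient g v‖ * (‖momGrad m w‖ * |g w|)) * ‖v - w‖⁻¹ := by ring
    _ ≤ ((C₁ * wt v) * (C₄ * wt w) + (C₃ * wt v) * (C₂ * wt w)) * ‖v - w‖⁻¹ := by
        refine mul_le_mul_of_nonneg_right (add_le_add ?_ ?_) (by positivity)
        · exact mul_le_mul (h1 v) (h4 w) (abs_nonneg _) (mul_nonneg hC₁ (wt_pos v).le)
        · exact mul_le_mul (h3 v) (h2 w) (by positivity) (mul_nonneg hC₃ (wt_pos v).le)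
    _ = _ := by ring

/-- The moment `∫ g ⟨v⟩ᵐ`. -/
def moment (m : ℝ) (g : 𝓢(V, ℝ)) : ℝ := ∫ v, g v * regPow 1 (m / 2) v

theorem regPow_one_le_of_le {a b : ℝ} (h : a ≤ b) (v : V) : regPow 1 a v ≤ regPow 1 b v := by
  unfold regPow
  exact Real.rpow_le_rpow_of_exponent_le (by nlinarith [sq_nonneg ‖v‖]) h

theorem integrable_mul_regPow (g : 𝓢(V, ℝ)) {a : ℝ} (ha : 0 ≤ a) :
    Integrable fun v => g v * regPow 1 a v := by
  simpa only [mul_comm] using (tame_regPow_one ha).integrable_mul g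

theorem integral_mul_regPow_le (hg : ∀ v, 0 ≤ g v) (hm : 2 < m) :
    ∫ v, g v * regPow 1 (m / 2 - 1) v ≤ moment m g :=
  integral_mono (integrable_mul_regPow g (by linarith)) (integrable_mul_regPow g (by linarith))
    fun v => mul_le_mul_of_nonneg_left (regPow_one_le_of_le (by linarith) v) (hg v)

theorem one_le_moment (hg : ∀ v, 0 ≤ g v) (hm : 2 < m) (hmass : ∫ v, g v = 1) :
    1 ≤ moment m g := by
  rw [← hmass]
  refine integral_mono g.integrable (integrable_mul_regPow g (by linarith)) fun v => ?_
  have : 1 ≤ regPow 1 (m / 2) v := Real.one_le_rpow (by nlinarith [sq_nonneg ‖v‖]) (by linarith)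
  nlinarith [hg v]

/-- With `w` frozen, the derivative on `g(v)` is moved to the regular field. What is left is the
divergence, of growth `⟨v⟩^{m-2} + ⟨w⟩^{m-2}`, so no derivative of `g` survives. -/
theorem neg_integral_farHalf_inner_le (hg : ∀ v, 0 ≤ g v) (hm : 2 < m) (hmass : ∫ v, g v = 1)
    (w : V) : - ∫ v, farHalf m g (v, w) ≤
      60 * (m * (m - 1)) * (g w * (moment m g + regPow 1 (m / 2 - 1) w)) := by
  have hC0 : 0 ≤ m * (m - 1) := by nlinarith
  have hpi := Real.pi_gt_three
  have hI : ∀ i, Integrable fun v => farFieldPartial m w i v i * g v := fun i =>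
    (tame_farFieldPartial hm w i i).integrable_mul g
  have e1 : ∫ v, farHalf m g (v, w) =
      (8 * Real.pi)⁻¹ * g w * - ∫ v, (∑ i, farFieldPartial m w i v i) * g v := by
    simp only [farHalf_eq_sum]
    rw [integral_const_mul]
    congr 1
    rw [integral_finsetSum _ fun i _ => (tame_farField hm w i).integrable_mul (pd i g)]
    simp only [Finset.sum_mul]
    rw [integral_finsetSum _ fun i _ => hI i, ← Finset.sum_neg_distrib]
    exact Finset.sum_congr rfl fun i _ => integral_mul_pd (hasGrad_farField m w i) i
      (tame_farField hm w i) (tame_farFieldPartial hm w i i) g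
  have e2 : ∫ v, (∑ i, farFieldPartial m w i v i) * g v ≤
      60 * (m * (m - 1)) * (moment m g + regPow 1 (m / 2 - 1) w) := by
    have i1 : Integrable fun v => (∑ i, farFieldPartial m w i v i) * g v := by
      simp only [Finset.sum_mul]
      exact integrable_finsetSum _ fun i _ => hI i
    have i2 : Integrable fun v => g v * regPow 1 (m / 2 - 1) v :=
      integrable_mul_regPow g (by linarith)
    have i3 : Integrable fun v => g v * regPow 1 (m / 2 - 1) w := g.integrable.mul_const _
    have h1 : ∫ v, (∑ i, farFieldPartial m w i v i) * g v ≤ ∫ v, 60 * (m * (m - 1)) *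
        (g v * regPow 1 (m / 2 - 1) v + g v * regPow 1 (m / 2 - 1) w) := by
      refine integral_mono i1 ((i2.add i3).const_mul _) fun v => ?_
      have := mul_le_mul_of_nonneg_right ((le_abs_self _).trans
        (abs_sum_farFieldPartial_le hm w v)) (hg v)
      refine this.trans (le_of_eq ?_)
      ring
    refine h1.trans ?_
    rw [integral_const_mul, integral_add i2 i3, integral_mul_const, hmass, one_mul]
    have := integral_mul_regPow_le hg hm
    gcongr
  rw [e1]
  have hb : (8 * Real.pi)⁻¹ ≤ 1 := inv_le_one_of_one_le₀ (by linarith)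
  have hM := one_le_moment hg hm hmass
  have hρ := (regPow_one_pos (m / 2 - 1) w).le
  have hgw := hg w
  calc - ((8 * Real.pi)⁻¹ * g w * - ∫ v, (∑ i, farFieldPartial m w i v i) * g v)
      = (8 * Real.pi)⁻¹ * (g w * ∫ v, (∑ i, farFieldPartial m w i v i) * g v) := by ring
    _ ≤ (8 * Real.pi)⁻¹ * (g w * (60 * (m * (m - 1)) * (moment m g + regPow 1 (m / 2 - 1) w))) := by
        gcongr
    _ ≤ 1 * (g w * (60 * (m * (m - 1)) * (moment m g + regPow 1 (m / 2 - 1) w))) := by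
        gcongr
    _ = _ := by ring

/-- The regular part of the moment production is bounded by the moment. -/
theorem far_production_le (hg : ∀ v, 0 ≤ g v) (hm : 2 < m) (hmass : ∫ v, g v = 1) :
    -(1 / 2 * ∫ x : V × V, farFrac (x.1 - x.2) * kq (x.1 - x.2) (momGrad m x.1 - momGrad m x.2)
      (current g x.1 x.2) ∂(volume.prod volume)) ≤ 120 * (m * (m - 1)) * moment m g := by
  have i1 := integrable_farHalf hm g
  have i2 : Integrable (fun x : V × V => farHalf m g x.swap) (volume.prod volume) := i1.swap
  have e1 : ∫ x : V × V, farFrac (x.1 - x.2) * kq (x.1 - x.2) (momGrad m x.1 - momGrad m x.2)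
      (current g x.1 x.2) ∂(volume.prod volume) =
      2 * ∫ x, farHalf m g x ∂(volume.prod volume) := by
    simp only [farHalf_add_swap]
    rw [integral_add i1 i2, integral_prod_swap, two_mul]
  have j2 : Integrable fun w => g w * regPow 1 (m / 2 - 1) w :=
    integrable_mul_regPow g (by linarith)
  have j3 : Integrable fun w => g w * moment m g := g.integrable.mul_const _
  have e2 : - ∫ x, farHalf m g x ∂(volume.prod volume) ≤ ∫ w, 60 * (m * (m - 1)) *
      (g w * moment m g + g w * regPow 1 (m / 2 - 1) w) := by
    rw [integral_prod_symm _ i1, ← integral_neg]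
    refine integral_mono i1.integral_prod_right.neg ((j3.add j2).const_mul _) fun w => ?_
    have := neg_integral_farHalf_inner_le hg hm hmass w
    rw [mul_add (g w)] at this
    exact this
  rw [integral_const_mul, integral_add j3 j2, integral_mul_const, hmass, one_mul] at e2
  rw [e1]
  have h1 := integral_mul_regPow_le hg hm
  have hC0 : 0 ≤ m * (m - 1) := by nlinarith
  have h2 := mul_le_mul_of_nonneg_left h1 (by positivity : 0 ≤ 60 * (m * (m - 1)))
  linarith

end

/-! ### Singular part of the moment production -/

section

open Filter Topology

variable {m : ℝ} {g : 𝓢(V, ℝ)}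

theorem regPow_one_le_of_norm_sub_lt {a : ℝ} (ha : 0 ≤ a) {v w : V} (h : ‖v - w‖ < 1) :
    regPow 1 a v ≤ 3 ^ a * regPow 1 a w := by
  unfold regPow
  rw [← Real.mul_rpow (by norm_num) (by positivity)]
  refine Real.rpow_le_rpow (by positivity) ?_ ha
  have h1 : ‖v‖ ≤ ‖w‖ + 1 := by
    have := norm_le_norm_add_norm_sub' v w
    linarith
  nlinarith [norm_nonneg v, norm_nonneg w, sq_nonneg (‖w‖ - 1 / 2)]

/-- The constant controlling the singular part of the moment production. -/
def nearConst (m : ℝ) : ℝ := 324 * (m * (m - 1)) ^ 2 * 3 ^ (m / 2 - 1)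

theorem nearConst_nonneg (m : ℝ) : 0 ≤ nearConst m := by unfold nearConst; positivity

/-- Supported on `|v - w| < 1`, where the squared increment `O(|v - w|²)` beats the singularity `|v
- w|⁻¹`. There the weights at `v` and `w` are comparable, so the square of their sum is bounded by
their product; the double integral then factors into the square of the moment. -/
theorem near_kq_le (hm : 2 < m) (v w : V) :
    (1 - farFrac (v - w)) * kq (v - w) (momGrad m v - momGrad m w) (momGrad m v - momGrad m w) ≤
      nearConst m * (regPow 1 (m / 2) v * regPow 1 (m / 2) w) := by
  have hφv := regPow_one_pos (m / 2) v
  have hφw := regPow_one_pos (m / 2) w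
  rcases le_or_gt 1 ‖v - w‖ with h | h
  · rw [farFrac_eq_one h, sub_self, zero_mul]
    have := nearConst_nonneg m
    positivity
  · have hk := kq_self_nonneg (v - w) (momGrad m v - momGrad m w)
    have h1 := (le_abs_self _).trans (abs_kq_le (v - w) (momGrad m v - momGrad m w)
      (momGrad m v - momGrad m w))
    have h2 := norm_momGrad_sub_le hm v w
    have h3 := regPow_one_le_of_norm_sub_lt (a := m / 2 - 1) (by linarith) h
    have h4 := regPow_one_le_of_norm_sub_lt (a := m / 2 - 1) (by linarith)
      (norm_sub_rev v w ▸ h)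
    have h5 := regPow_one_le_of_le (v := v) (show m / 2 - 1 ≤ m / 2 by linarith)
    have h6 := regPow_one_le_of_le (v := w) (show m / 2 - 1 ≤ m / 2 by linarith)
    have p1 := regPow_one_pos (m / 2 - 1) v
    have p2 := regPow_one_pos (m / 2 - 1) w
    set ρ := regPow 1 (m / 2 - 1) v
    set ρ' := regPow 1 (m / 2 - 1) w
    set c := m * (m - 1) with hc
    set q : ℝ := 3 ^ (m / 2 - 1) with hq
    have hq1 : 1 ≤ q := Real.one_le_rpow (by norm_num) (by linarith)
    set r := ‖v - w‖ with hr
    have hr0 : 0 ≤ r := norm_nonneg _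
    have hc0 : 0 ≤ c := by rw [hc]; nlinarith
    have h7 : r⁻¹ * (r * r) ≤ 1 := by
      rcases eq_or_ne r 0 with h0 | h0
      · simp [h0]
      · rw [inv_mul_cancel_left₀ h0]; exact h.le
    have h8 : (ρ + ρ') ^ 2 ≤ 4 * q * (ρ * ρ') := by
      nlinarith [mul_le_mul_of_nonneg_left h3 p1.le, mul_le_mul_of_nonneg_left h4 p2.le,
        mul_pos p1 p2]
    calc (1 - farFrac (v - w)) * kq (v - w) (momGrad m v - momGrad m w) (momGrad m v - momGrad m w)
        ≤ 1 * (r⁻¹ * (‖momGrad m v - momGrad m w‖ * ‖momGrad m v - momGrad m w‖)) :=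
          mul_le_mul (by linarith [farFrac_nonneg (v - w)]) h1 hk zero_le_one
      _ ≤ 1 * (r⁻¹ * ((9 * c * (ρ + ρ') * r) * (9 * c * (ρ + ρ') * r))) := by gcongr
      _ = 81 * c ^ 2 * (ρ + ρ') ^ 2 * (r⁻¹ * (r * r)) := by ring
      _ ≤ 81 * c ^ 2 * (4 * q * (ρ * ρ')) * 1 := by gcongr
      _ = 324 * c ^ 2 * q * (ρ * ρ') := by ring
      _ ≤ 324 * c ^ 2 * q * (regPow 1 (m / 2) v * regPow 1 (m / 2) w) := by gcongr
      _ = _ := by rw [nearConst]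

theorem Reg.mul_pow_le {N : ℕ} {B x y : ℝ} {v : V} (hx : (1 + ‖v‖) ^ (N + 4) * x ≤ B)
    (hx0 : 0 ≤ x) (hy : y ≤ (1 + ‖v‖) ^ N) : y * x ≤ B * wt v := by
  refine Reg.le_wt ?_
  refine le_trans ?_ hx
  rw [pow_add, mul_assoc, mul_left_comm]
  gcongr

theorem near_error_le {B η : ℝ} (hm : 2 < m) (h : Reg (⌈m - 2⌉₊ + 1 + 4) B g) (hη : 0 < η)
    (v w : V) :
    |kq (v - w) (momGrad m v - momGrad m w)
      (η ^ 4 • (g w • score (η ^ 4) g v - g v • score (η ^ 4) g w))| ≤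
      4 * m * (η * B ^ 2) * (wt v * wt w * ‖v - w‖⁻¹) := by
  set N := ⌈m - 2⌉₊ + 1
  set a := score (η ^ 4) g v with ha
  set b := score (η ^ 4) g w with hb
  set P := (1 + ‖v‖) ^ N with hP
  set Q := (1 + ‖w‖) ^ N with hQ
  have hB := h.nonneg_const
  have hgv := h.nonneg v
  have hgw := h.nonneg w
  have one_le : ∀ v : V, 1 ≤ (1 + ‖v‖) ^ N := fun v => one_le_pow₀ (by linarith [norm_nonneg v])
  have hP1 : 1 ≤ P := one_le v
  have hQ1 : 1 ≤ Q := one_le w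
  have hwv := (wt_pos v).le
  have hww := (wt_pos w).le
  have s1 : P * g v ≤ B * wt v := Reg.mul_pow_le (h.val v) hgv le_rfl
  have s2 : 1 * g v ≤ B * wt v := Reg.mul_pow_le (h.val v) hgv hP1
  have s3 : Q * g w ≤ B * wt w := Reg.mul_pow_le (h.val w) hgw le_rfl
  have s4 : 1 * g w ≤ B * wt w := Reg.mul_pow_le (h.val w) hgw hQ1
  have t1 : P * (η ^ 4 * ‖a‖) ≤ η * B * wt v :=
    Reg.mul_pow_le (h.score_le η hη v) (by positivity) le_rfl
  have t2 : 1 * (η ^ 4 * ‖a‖) ≤ η * B * wt v :=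
    Reg.mul_pow_le (h.score_le η hη v) (by positivity) hP1
  have t3 : Q * (η ^ 4 * ‖b‖) ≤ η * B * wt w :=
    Reg.mul_pow_le (h.score_le η hη w) (by positivity) le_rfl
  have t4 : 1 * (η ^ 4 * ‖b‖) ≤ η * B * wt w :=
    Reg.mul_pow_le (h.score_le η hη w) (by positivity) hQ1
  have n1 : ‖momGrad m v - momGrad m w‖ ≤ m * (P + Q) := by
    refine (norm_sub_le _ _).trans ?_
    linarith [norm_momGrad_le hm v, norm_momGrad_le hm w]
  have n2 : ‖η ^ 4 • (g w • a - g v • b)‖ ≤ g w * (η ^ 4 * ‖a‖) + g v * (η ^ 4 * ‖b‖) := by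
    rw [norm_smul, Real.norm_of_nonneg (by positivity)]
    calc η ^ 4 * ‖g w • a - g v • b‖ ≤ η ^ 4 * (‖g w • a‖ + ‖g v • b‖) :=
          mul_le_mul_of_nonneg_left (norm_sub_le _ _) (by positivity)
      _ = _ := by
        rw [norm_smul, norm_smul, Real.norm_of_nonneg hgv, Real.norm_of_nonneg hgw]
        ring
  have hm0 : 0 ≤ m := by linarith
  rw [one_mul] at s2 s4 t2 t4
  refine (abs_kq_le _ _ _).trans ?_
  calc ‖v - w‖⁻¹ * (‖momGrad m v - momGrad m w‖ * ‖η ^ 4 • (g w • a - g v • b)‖)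
      ≤ ‖v - w‖⁻¹ * ((m * (P + Q)) * (g w * (η ^ 4 * ‖a‖) + g v * (η ^ 4 * ‖b‖))) := by
        gcongr
    _ = ‖v - w‖⁻¹ * (m * ((P * (η ^ 4 * ‖a‖)) * g w + (P * g v) * (η ^ 4 * ‖b‖) +
        (η ^ 4 * ‖a‖) * (Q * g w) + g v * (Q * (η ^ 4 * ‖b‖)))) := by ring
    _ ≤ ‖v - w‖⁻¹ * (m * ((η * B * wt v) * (B * wt w) + (B * wt v) * (η * B * wt w) +
        (η * B * wt v) * (B * wt w) + (B * wt v) * (η * B * wt w))) := by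
        refine mul_le_mul_of_nonneg_left (mul_le_mul_of_nonneg_left ?_ hm0) (by positivity)
        refine add_le_add (add_le_add (add_le_add ?_ ?_) ?_) ?_
        · exact mul_le_mul t1 s4 hgw (by positivity)
        · exact mul_le_mul s1 t4 (by positivity) (by positivity)
        · exact mul_le_mul t2 s3 (by positivity) (by positivity)
        · exact mul_le_mul s2 t3 (by positivity) (by positivity)
    _ = _ := by ring

/-- Young's inequality separates the increment of the weight from that of the score. The parameter
`r` is left free because it must later be matched to the size of the moment. -/
theorem near_density_le {B η r : ℝ} (hm : 2 < m) (h : Reg (⌈m - 2⌉₊ + 1 + 4) B g) (hη : 0 < η)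
    (hr : 0 < r) (v w : V) :
    -((1 - farFrac (v - w)) * kq (v - w) (momGrad m v - momGrad m w) (current g v w)) ≤
      r / 2 * nearConst m * ((g v * regPow 1 (m / 2) v) * (g w * regPow 1 (m / 2) w)) +
        1 / (2 * r) * dissDensity (η ^ 4) g (v, w) +
        4 * m * (η * B ^ 2) * (wt v * wt w * ‖v - w‖⁻¹) := by
  have hε : 0 < η ^ 4 := by positivity
  have he := near_error_le hm h hη v w
  have hk := near_kq_le hm v w
  rw [current_eq_score h.nonneg hε v w, kq_add_right, kq_smul_right]
  set e := kq (v - w) (momGrad m v - momGrad m w)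
      (η ^ 4 • (g w • score (η ^ 4) g v - g v • score (η ^ 4) g w))
  have hy := abs_kq_le_young (v - w) (momGrad m v - momGrad m w)
    (score (η ^ 4) g v - score (η ^ 4) g w) hr
  set d := kq (v - w) (score (η ^ 4) g v - score (η ^ 4) g w)
    (score (η ^ 4) g v - score (η ^ 4) g w) with hd
  have hd0 : 0 ≤ d := kq_self_nonneg _ _
  set k := kq (v - w) (momGrad m v - momGrad m w) (momGrad m v - momGrad m w)
  set y := kq (v - w) (momGrad m v - momGrad m w) (score (η ^ 4) g v - score (η ^ 4) g w)
  set θ := 1 - farFrac (v - w) with hθ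
  have hθ0 : 0 ≤ θ := by rw [hθ]; linarith [farFrac_le_one (v - w)]
  have hθ1 : θ ≤ 1 := by rw [hθ]; linarith [farFrac_nonneg (v - w)]
  have hG : 0 ≤ g v * g w := mul_nonneg (h.nonneg v) (h.nonneg w)
  have h1 : -(θ * (g v * g w * y)) ≤ (g v * g w) * (r / 2 * (θ * k) + 1 / (2 * r) * d) := by
    calc -(θ * (g v * g w * y)) = (g v * g w) * (θ * -y) := by ring
      _ ≤ (g v * g w) * (θ * (r / 2 * k + 1 / (2 * r) * d)) := by
        gcongr
        exact (neg_le_abs _).trans hy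
      _ = (g v * g w) * (r / 2 * (θ * k) + θ * (1 / (2 * r) * d)) := by ring
      _ ≤ (g v * g w) * (r / 2 * (θ * k) + 1 * (1 / (2 * r) * d)) := by gcongr
      _ = _ := by ring
  have h2 : -(θ * e) ≤ |e| := by
    have h3 := mul_le_mul_of_nonneg_left (neg_le_abs e) hθ0
    have h4 := mul_le_mul_of_nonneg_right hθ1 (abs_nonneg e)
    linarith
  calc -(θ * (g v * g w * y + e)) = -(θ * (g v * g w * y)) + -(θ * e) := by ring
    _ ≤ (g v * g w) * (r / 2 * (nearConst m * (regPow 1 (m / 2) v * regPow 1 (m / 2) w)) +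
        1 / (2 * r) * d) + 4 * m * (η * B ^ 2) * (wt v * wt w * ‖v - w‖⁻¹) := by
        refine add_le_add (h1.trans ?_) (h2.trans he)
        gcongr
    _ = _ := by
        rw [dissDensity, ← hd]
        ring

/-- The constant in the moment production estimate. -/
def momConst (m : ℝ) : ℝ := 120 * (m * (m - 1)) + nearConst m / 8

theorem momConst_nonneg (hm : 2 < m) : 0 ≤ momConst m := by
  have := nearConst_nonneg m
  unfold momConst
  nlinarith

/-- The production of a moment is controlled by the entropy dissipation. -/
theorem moment_production_le {B η : ℝ} (hm : 2 < m) (h : Reg (⌈m - 2⌉₊ + 1 + 4) B g) (hη : 0 < η)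
    (hmass : ∫ v, g v = 1) :
    -(1 / 2 * ∫ x : V × V, kq (x.1 - x.2) (momGrad m x.1 - momGrad m x.2) (current g x.1 x.2)
      ∂(volume.prod volume)) ≤
      moment m g * (diss (η ^ 4) g + momConst m) + η * (2 * m * B ^ 2 * pairConst) := by
  have hε : 0 < η ^ 4 := by positivity
  have hM := one_le_moment h.nonneg hm hmass
  have i0 := integrable_kq_current_sub g (measurable_momGrad m) (tame_norm_momGrad hm)
  have hmf : Measurable fun x : V × V => farFrac (x.1 - x.2) :=
    measurable_farFrac.comp (measurable_fst.sub measurable_snd)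
  have i1 : Integrable (fun x : V × V => farFrac (x.1 - x.2) *
      kq (x.1 - x.2) (momGrad m x.1 - momGrad m x.2) (current g x.1 x.2)) (volume.prod volume) := by
    refine i0.mono (hmf.aestronglyMeasurable.mul i0.aestronglyMeasurable)
      (Eventually.of_forall fun x => ?_)
    rw [norm_mul, Real.norm_of_nonneg (farFrac_nonneg _)]
    exact mul_le_of_le_one_left (norm_nonneg _) (farFrac_le_one _)
  have i2 : Integrable (fun x : V × V => -((1 - farFrac (x.1 - x.2)) *
      kq (x.1 - x.2) (momGrad m x.1 - momGrad m x.2) (current g x.1 x.2))) (volume.prod volume) := by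
    refine (i0.sub i1).neg.congr (Eventually.of_forall fun x => ?_)
    simp only [Pi.neg_apply, Pi.sub_apply]
    ring
  have j := integrable_mul_regPow g (a := m / 2) (by linarith)
  have i3 := j.mul_prod j
  have i4 := integrable_dissDensity h.nonneg hε
  -- This choice makes both Young terms linear in the moment: the squared moment loses one power,
  -- and the dissipation gets the moment as coefficient. Linearity is what allows division by the
  -- moment in the logarithmic estimate.
  set r := 1 / (2 * moment m g) with hr
  have hr0 : 0 < r := by positivity
  have key := integral_mono i2 (((i3.const_mul (r / 2 * nearConst m)).add
    (i4.const_mul (1 / (2 * r)))).add (integrable_prod_wt.const_mul (4 * m * (η * B ^ 2))))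
    fun x => near_density_le hm h hη hr0 x.1 x.2
  have e1 : ∫ x : V × V, -((1 - farFrac (x.1 - x.2)) *
      kq (x.1 - x.2) (momGrad m x.1 - momGrad m x.2) (current g x.1 x.2)) ∂(volume.prod volume) =
      - ∫ x : V × V, kq (x.1 - x.2) (momGrad m x.1 - momGrad m x.2) (current g x.1 x.2)
        ∂(volume.prod volume) + ∫ x : V × V, farFrac (x.1 - x.2) *
      kq (x.1 - x.2) (momGrad m x.1 - momGrad m x.2) (current g x.1 x.2)
        ∂(volume.prod volume) := by
    rw [← integral_neg', ← integral_add' i0.neg i1]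
    congr 1
    ext x
    simp only [Pi.neg_apply, Pi.add_apply]
    ring
  rw [e1, integral_add' ((i3.const_mul _).add (i4.const_mul _)) (integrable_prod_wt.const_mul _),
    integral_add' (i3.const_mul _) (i4.const_mul _), integral_const_mul, integral_const_mul,
    integral_const_mul, integral_prod_mul (fun v => g v * regPow 1 (m / 2) v)
      (fun v => g v * regPow 1 (m / 2) v)] at key
  have hfar := far_production_le h.nonneg hm hmass
  have e2 : 1 / (2 * r) = moment m g := by rw [hr]; field_simp
  have e3 : r / 2 * nearConst m * (moment m g * moment m g) = moment m g * (nearConst m / 4) := by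
    rw [hr]; field_simp; ring
  rw [show (∫ v, g v * regPow 1 (m / 2) v) = moment m g from rfl, e2, e3] at key
  have e4 : ∫ x, dissDensity (η ^ 4) g x ∂(volume.prod volume) = 2 * diss (η ^ 4) g := by
    rw [diss]; ring
  rw [e4, ← pairConst] at key
  rw [momConst]
  nlinarith

end

/-! ### Propagation of entropy and moments -/

section

open Filter Topology

variable {m : ℝ} {g : 𝓢(V, ℝ)}

theorem neg_mul_log_le_sqrt {x : ℝ} (hx : 0 ≤ x) : -(x * Real.log x) ≤ 2 * √x := by
  rcases hx.eq_or_lt with rfl | hx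
  · simp
  · have hs : 0 < √x := Real.sqrt_pos.2 hx
    have h1 := Real.one_sub_inv_le_log_of_pos hs
    rw [Real.log_sqrt hx.le] at h1
    have h2 : √x * √x = x := Real.mul_self_sqrt hx.le
    have h3 : x * (√x)⁻¹ = √x := by nth_rw 1 [← h2]; field_simp
    nlinarith

/-- The regularized entropy integrand, up to affine terms. -/
def entReg (ε x : ℝ) : ℝ := (x + ε) * Real.log (x + ε) - ε * Real.log ε

theorem entDens_eq (ε x : ℝ) : entDens ε x = entReg ε x - (Real.log ε + 1) * x := by
  rw [entDens, entReg]; ring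

/-- A dominating function uniform in `ε ≤ 1`; for a Schwartz function both `g` and `√g` are
integrable. The identity `x log(x + ε) + ε log(1 + x/ε)` separates the two effects of the
regularisation. -/
theorem abs_entReg_le {x ε R : ℝ} (hx : 0 ≤ x) (hxR : x ≤ R) (hε : 0 < ε) (hε1 : ε ≤ 1) :
    |entReg ε x| ≤ (R + 2) * x + 2 * √x := by
  have e : entReg ε x = x * Real.log (x + ε) + ε * Real.log (1 + x / ε) := by
    have : 1 + x / ε = (x + ε) / ε := by field_simp; ring
    rw [this, Real.log_div (by positivity) hε.ne', entReg]
    ring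
  have h1 : 0 ≤ ε * Real.log (1 + x / ε) :=
    mul_nonneg hε.le (Real.log_nonneg (by have := div_nonneg hx hε.le; linarith))
  have h2 : ε * Real.log (1 + x / ε) ≤ x := by
    have := Real.log_le_sub_one_of_pos (x := 1 + x / ε) (by positivity)
    calc ε * Real.log (1 + x / ε) ≤ ε * (x / ε) := by
          apply mul_le_mul_of_nonneg_left _ hε.le; linarith
      _ = x := by field_simp
  have h3 : x * Real.log (x + ε) ≤ (R + 1) * x := by
    have := Real.log_le_sub_one_of_pos (x := x + ε) (by positivity)
    nlinarith
  have h4 : -(x * Real.log (x + ε)) ≤ 2 * √x := by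
    refine le_trans ?_ (neg_mul_log_le_sqrt hx)
    rcases hx.eq_or_lt with rfl | hx
    · simp
    · have := Real.log_le_log hx (show x ≤ x + ε by linarith)
      nlinarith
  have h5 := Real.sqrt_nonneg x
  rw [e, abs_le]
  constructor <;> nlinarith

theorem sqrt_le_wt (g : 𝓢(V, ℝ)) (v : V) : √(g v) ≤ √(bd 8 g) * wt v := by
  have h := (le_abs_self _).trans (abs_le_bd_mul 8 g v)
  refine (Real.sqrt_le_sqrt h).trans (le_of_eq ?_)
  rw [Real.sqrt_mul (bd_nonneg _ _), wt, ← Real.sqrt_sq (by positivity : 0 ≤ ((1 + ‖v‖) ^ 4)⁻¹),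
    ← inv_pow, ← inv_pow, ← pow_mul]

theorem integrable_sqrt (g : 𝓢(V, ℝ)) : Integrable fun v => √(g v) :=
  (integrable_wt.const_mul _).mono' (Real.continuous_sqrt.comp g.continuous).aestronglyMeasurable
    (Eventually.of_forall fun v => by
      rw [Real.norm_of_nonneg (Real.sqrt_nonneg _)]
      exact sqrt_le_wt g v)

/-- The Boltzmann entropy `∫ g log g`. -/
def entropy (g : 𝓢(V, ℝ)) : ℝ := ∫ v, g v * Real.log (g v)

theorem integrable_entropy_dom (g : 𝓢(V, ℝ)) :
    Integrable fun v => (bd 0 g + 2) * g v + 2 * √(g v) :=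
  (g.integrable.const_mul _).add ((integrable_sqrt g).const_mul 2)

theorem tendsto_entReg {x : ℝ} : Tendsto (fun ε => entReg ε x) (𝓝 0) (𝓝 (x * Real.log x)) := by
  have h : Continuous fun ε => entReg ε x := by
    unfold entReg
    exact (Real.continuous_mul_log.comp (continuous_const.add continuous_id)).sub
      Real.continuous_mul_log
  have := h.tendsto 0
  simpa [entReg] using this

theorem tendsto_integral_entReg (hg : ∀ v, 0 ≤ g v) {u : ℕ → ℝ} (hu : ∀ n, 0 < u n)
    (hu1 : ∀ n, u n ≤ 1) (hlim : Tendsto u atTop (𝓝 0)) :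
    Tendsto (fun n => ∫ v, entReg (u n) (g v)) atTop (𝓝 (entropy g)) := by
  refine tendsto_integral_of_dominated_convergence _ (fun n => ?_) (integrable_entropy_dom g)
    (fun n => Eventually.of_forall fun v => ?_) (Eventually.of_forall fun v => ?_)
  · have := g.continuous.measurable
    unfold entReg
    exact Measurable.aestronglyMeasurable (by fun_prop)
  · exact abs_entReg_le (hg v) ((le_abs_self _).trans (abs_le_bd_zero g v)) (hu n) (hu1 n)
  · exact tendsto_entReg.comp hlim

theorem integrable_entReg (hg : ∀ v, 0 ≤ g v) {ε : ℝ} (hε : 0 < ε) (hε1 : ε ≤ 1) :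
    Integrable fun v => entReg ε (g v) := by
  refine (integrable_entropy_dom g).mono' ?_ (Eventually.of_forall fun v =>
    abs_entReg_le (hg v) ((le_abs_self _).trans (abs_le_bd_zero g v)) hε hε1)
  have := g.continuous.measurable
  unfold entReg
  exact Measurable.aestronglyMeasurable (by fun_prop)

theorem integral_entDens (hg : ∀ v, 0 ≤ g v) {ε : ℝ} (hε : 0 < ε) (hε1 : ε ≤ 1) :
    ∫ v, entDens ε (g v) = (∫ v, entReg ε (g v)) - (Real.log ε + 1) * ∫ v, g v := by
  simp only [entDens_eq]
  rw [integral_sub (integrable_entReg hg hε hε1) (g.integrable.const_mul _), integral_const_mul]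

theorem integrable_entropy (hg : ∀ v, 0 ≤ g v) : Integrable fun v => g v * Real.log (g v) := by
  refine (integrable_entropy_dom g).mono'
    (Real.continuous_mul_log.comp g.continuous).aestronglyMeasurable
    (Eventually.of_forall fun v => ?_)
  refine le_of_tendsto (f := fun n : ℕ => |entReg (1 / ((n : ℝ) + 1)) (g v)|) (x := atTop)
    ((tendsto_entReg.comp tendsto_one_div_add_atTop_nhds_zero_nat).abs)
    (Eventually.of_forall fun n => ?_)
  refine abs_entReg_le (hg v) ((le_abs_self _).trans (abs_le_bd_zero g v)) (by positivity) ?_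
  rw [div_le_one (by positivity)]
  have : (0 : ℝ) ≤ n := by positivity
  linarith

/-- The negative part of the entropy density is controlled by energy. -/
theorem neg_entropy_density_le (hg : ∀ v, 0 ≤ g v) (v : V) :
    -(g v * Real.log (g v)) ≤ 4 * (g v * (1 + ‖v‖ ^ 2)) + 2 * wt v := by
  have hgv := hg v
  have hw := wt_pos v
  have hn := norm_nonneg v
  -- If `g ≥ (1 + |v|)⁻⁸`, then `-log g ≤ 8 log(1 + |v|) ≤ 4(1 + |v|²)`, and the energy controls the
  -- term. Otherwise `-g log g ≤ 2√g ≤ 2(1 + |v|)⁻⁴`.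
  rcases le_or_gt (wt v ^ 2) (g v) with h | h
  · have h1 := Real.log_le_log (by positivity) h
    have h2 := Real.log_le_sub_one_of_pos (show 0 < 1 + ‖v‖ by positivity)
    rw [wt, ← inv_pow, ← pow_mul, Real.log_pow, Real.log_inv] at h1
    push_cast at h1
    have h3 : -Real.log (g v) ≤ 4 * (1 + ‖v‖ ^ 2) := by nlinarith [sq_nonneg (‖v‖ - 1)]
    nlinarith
  · have h1 := neg_mul_log_le_sqrt hgv
    have h2 : √(g v) ≤ wt v := by
      rw [← Real.sqrt_sq hw.le]
      exact Real.sqrt_le_sqrt h.le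
    have : 0 ≤ g v * (1 + ‖v‖ ^ 2) := by positivity
    linarith

/-- The constant `∫ (1 + |v|)⁻⁴`. -/
def wtMass : ℝ := ∫ v, wt v

theorem integrable_energy (g : 𝓢(V, ℝ)) : Integrable fun v => g v * (1 + ‖v‖ ^ 2) := by
  simpa only [mul_comm] using ((tame_const 1).add (tame_norm.pow 2)).integrable_mul g

theorem integral_energy (hmass : ∫ v, g v = 1) (hen : ∫ v, g v * ‖v‖ ^ 2 = 3) :
    ∫ v, g v * (1 + ‖v‖ ^ 2) = 4 := by
  have i : Integrable fun v => g v * ‖v‖ ^ 2 := by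
    simpa only [mul_comm] using (tame_norm.pow 2).integrable_mul g
  simp only [mul_add, mul_one]
  rw [integral_add g.integrable i, hmass, hen]
  norm_num

theorem neg_entropy_le (hg : ∀ v, 0 ≤ g v) (hmass : ∫ v, g v = 1)
    (hen : ∫ v, g v * ‖v‖ ^ 2 = 3) : - entropy g ≤ 16 + 2 * wtMass := by
  have i := integrable_energy g
  rw [entropy, ← integral_neg]
  refine (integral_mono (integrable_entropy hg).neg ((i.const_mul 4).add
    (integrable_wt.const_mul 2)) fun v => neg_entropy_density_le hg v).trans (le_of_eq ?_)
  rw [integral_add' (i.const_mul 4) (integrable_wt.const_mul 2), integral_const_mul,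
    integral_const_mul, integral_energy hmass hen, wtMass]
  norm_num

theorem absEntropy_le (hg : ∀ v, 0 ≤ g v) (hmass : ∫ v, g v = 1)
    (hen : ∫ v, g v * ‖v‖ ^ 2 = 3) : absEntropy g ≤ entropy g + 2 * (16 + 2 * wtMass) := by
  have i := integrable_energy g
  have ie := integrable_entropy hg
  have ia : Integrable fun v => g v * |Real.log (g v)| := by
    refine ie.norm.congr (Eventually.of_forall fun v => ?_)
    simp [abs_of_nonneg (hg v)]
  have j := ((i.const_mul 4).add (integrable_wt.const_mul 2)).const_mul 2
  refine (integral_mono ia (ie.add j) fun v => ?_).trans (le_of_eq ?_)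
  · have h := neg_entropy_density_le hg v
    have hgv := hg v
    have hw := wt_pos v
    have h0 : 0 ≤ g v * (1 + ‖v‖ ^ 2) := by positivity
    simp only [Pi.add_apply]
    rcases abs_cases (Real.log (g v)) with ⟨h', _⟩ | ⟨h', _⟩ <;> rw [h'] <;> nlinarith
  · rw [integral_add' ie j, integral_const_mul, integral_add' (i.const_mul 4)
      (integrable_wt.const_mul 2), integral_const_mul, integral_const_mul,
      integral_energy hmass hen, wtMass, entropy]
    norm_num

theorem entropy_le_absEntropy (hg : ∀ v, 0 ≤ g v) : entropy g ≤ absEntropy g := by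
  have ie := integrable_entropy hg
  refine integral_mono ie (ie.norm.congr (Eventually.of_forall fun v => ?_)) fun v =>
    mul_le_mul_of_nonneg_left (le_abs_self _) (hg v)
  simp [abs_of_nonneg (hg v)]

theorem moment_eq_weightedL1Norm (hg : ∀ v, 0 ≤ g v) : moment m g = weightedL1Norm m g := by
  unfold moment weightedL1Norm
  congr 1
  ext v
  rw [abs_of_nonneg (hg v), regPow, bracket, Real.sqrt_eq_rpow, ← Real.rpow_mul (by positivity)]
  congr 2
  · ring
  · ring

variable {T : EReal} {f_in : 𝓢(V, ℝ)} {f : ℝ → 𝓢(V, ℝ)}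

theorem sub_le_mul_of_hasDerivAt_le {F F' : ℝ → ℝ} {t C : ℝ} (ht : 0 ≤ t)
    (hc : ContinuousOn F (Set.Icc 0 t)) (hd : ∀ s ∈ Set.Ioo 0 t, HasDerivAt F (F' s) s)
    (hle : ∀ s ∈ Set.Ioo 0 t, F' s ≤ C) : F t ≤ F 0 + C * t := by
  have := (convex_Icc 0 t).image_sub_le_mul_sub_of_deriv_le hc
    (fun s hs => by
      rw [interior_Icc] at hs
      exact (hd s hs).differentiableAt.differentiableWithinAt)
    (C := C) (fun s hs => by
      rw [interior_Icc] at hs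
      rw [(hd s hs).deriv]
      exact hle s hs) 0 (Set.left_mem_Icc.2 ht) t (Set.right_mem_Icc.2 ht) ht
  linarith

theorem IsSchwartzSolution.continuousOn_entropy (hf : IsSchwartzSolution T f_in f) {t : ℝ}
    (htT : (t : EReal) < T) {ε : ℝ} (hε : 0 < ε) :
    ContinuousOn (fun s => ∫ v, entDens ε (f s v)) (Set.Icc 0 t) := by
  simpa using continuousOn_integral_comp isCompact_Icc (hf.continuousOn_Icc htT)
    (hf.nonneg_of_mem htT) (smoothNonlin_entDens hε).linBound (tame_const 1)

theorem exists_small_sequence : ∃ u : ℕ → ℝ, (∀ n, 0 < u n) ∧ (∀ n, u n ≤ 1) ∧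
    Tendsto u atTop (𝓝 0) ∧ Tendsto (fun n => u n ^ 4) atTop (𝓝 0) := by
  refine ⟨fun n => 1 / ((n : ℝ) + 1), fun n => by positivity, fun n => ?_,
    tendsto_one_div_add_atTop_nhds_zero_nat, ?_⟩
  · rw [div_le_one (by positivity)]
    have : (0 : ℝ) ≤ n := by positivity
    linarith
  · simpa using (tendsto_one_div_add_atTop_nhds_zero_nat (𝕜 := ℝ)).pow 4

/-- Passing to the limit in the regularized entropy inequality. -/
theorem IsSchwartzSolution.entropy_limit (hf : IsSchwartzSolution T f_in f) {t : ℝ} (ht : 0 ≤ t)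
    (htT : (t : EReal) < T) {a b E : ℝ}
    (h : ∀ η : ℝ, 0 < η → η ≤ 1 → a + ∫ v, entDens (η ^ 4) (f t v) ≤
      b + (∫ v, entDens (η ^ 4) (f_in v)) + η * E) :
    a + entropy (f t) ≤ b + entropy f_in := by
  have hpos := hf.nonneg t ht htT
  have hpos0 : ∀ v, 0 ≤ f_in v := hf.initial ▸ hf.nonneg 0 le_rfl hf.pos
  obtain ⟨u, hu, hu1, hlim, hlim4⟩ := exists_small_sequence
  have hu4 : ∀ n, 0 < u n ^ 4 := fun n => by have := hu n; positivity
  have hu41 : ∀ n, u n ^ 4 ≤ 1 := fun n => pow_le_one₀ (hu n).le (hu1 n)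
  have l1 := (tendsto_integral_entReg hpos hu4 hu41 hlim4).const_add a
  have l2 := ((tendsto_integral_entReg hpos0 hu4 hu41 hlim4).const_add b).add (hlim.mul_const E)
  rw [zero_mul, add_zero] at l2
  refine le_of_tendsto_of_tendsto' l1 l2 fun n => ?_
  have := h (u n) (hu n) (hu1 n)
  -- The term `(log ε + 1) ∫ f`, which diverges as `ε → 0`, is the same at times `0` and `t` by
  -- conservation of mass and cancels.
  rw [integral_entDens hpos (hu4 n) (hu41 n), integral_entDens hpos0 (hu4 n) (hu41 n),
    hf.mass_eq ht htT] at this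
  linarith

/-- The entropy does not increase. -/
theorem IsSchwartzSolution.entropy_le (hf : IsSchwartzSolution T f_in f) {t : ℝ} (ht : 0 ≤ t)
    (htT : (t : EReal) < T) : entropy (f t) ≤ entropy f_in := by
  obtain ⟨B, hB⟩ := exists_reg isCompact_Icc (hf.continuousOn_Icc htT) (hf.nonneg_of_mem htT) 4
  have := hf.entropy_limit ht htT (a := 0) (b := 0) (E := B ^ 2 * pairConst * t)
    fun η hη _ => by
      have hε : 0 < η ^ 4 := by positivity
      have := sub_le_mul_of_hasDerivAt_le (C := η * (B ^ 2 * pairConst)) ht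
        (hf.continuousOn_entropy htT hε)
        (fun s hs => hf.hasDerivAt_entropy hs.1 (coe_lt_of_mem hs.2 htT) hε) fun s hs => by
          refine (entropy_production_le (hB s (Set.Ioo_subset_Icc_self hs)) hη).trans ?_
          have : 0 ≤ diss (η ^ 4) (f s) := mul_nonneg (by norm_num) (integral_nonneg
            (dissDensity_nonneg (hB s (Set.Ioo_subset_Icc_self hs)).nonneg _))
          linarith
      rw [hf.initial] at this
      linarith
  linarith

/-- Propagation of moments, at the expense of entropy. -/
theorem IsSchwartzSolution.log_moment_add_entropy_le (hf : IsSchwartzSolution T f_in f)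
    (hm : 2 < m) (hmass : ∫ v, f_in v = 1) {t : ℝ} (ht : 0 ≤ t) (htT : (t : EReal) < T) :
    Real.log (moment m (f t)) + entropy (f t) ≤
      Real.log (moment m f_in) + momConst m * t + entropy f_in := by
  have hK := isCompact_Icc (a := 0) (b := t)
  obtain ⟨B, hB⟩ := exists_reg hK (hf.continuousOn_Icc htT) (hf.nonneg_of_mem htT) 4
  obtain ⟨B', hB'⟩ := exists_reg hK (hf.continuousOn_Icc htT) (hf.nonneg_of_mem htT)
    (⌈m - 2⌉₊ + 1 + 4)
  have hM : ∀ s ∈ Set.Icc 0 t, 1 ≤ moment m (f s) := fun s hs =>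
    one_le_moment (hB s hs).nonneg hm ((hf.mass_eq hs.1
      (lt_of_le_of_lt (EReal.coe_le_coe_iff.2 hs.2) htT)).trans hmass)
  have tm := tame_regPow_one (a := m / 2) (by linarith)
  have hpair : 0 ≤ pairConst := integral_nonneg fun x => by
    have := wt_pos x.1; have := wt_pos x.2; positivity
  refine hf.entropy_limit ht htT (E := (2 * m * B' ^ 2 * pairConst + B ^ 2 * pairConst) * t)
    fun η hη _ => ?_
  have hε : 0 < η ^ 4 := by positivity
  have := sub_le_mul_of_hasDerivAt_le (t := t)
    (F := fun s => Real.log (∫ v, f s v * regPow 1 (m / 2) v) + ∫ v, entDens (η ^ 4) (f s v))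
    (C := momConst m + η * (2 * m * B' ^ 2 * pairConst + B ^ 2 * pairConst)) ht
    (((hf.continuousOn_moment htT tm).log fun s hs =>
      (lt_of_lt_of_le one_pos (hM s hs)).ne').add (hf.continuousOn_entropy htT hε))
    (fun s hs => ((hf.hasDerivAt_moment hs.1 (coe_lt_of_mem hs.2 htT) (hasGrad_moment m) tm
      (measurable_momGrad m) (tame_norm_momGrad hm)).log
        (lt_of_lt_of_le one_pos (hM s (Set.Ioo_subset_Icc_self hs))).ne').add
      (hf.hasDerivAt_entropy hs.1 (coe_lt_of_mem hs.2 htT) hε)) fun s hs => by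
        have hs' := Set.Ioo_subset_Icc_self hs
        have h1 := entropy_production_le (hB s hs') hη
        have h2 := moment_production_le hm (hB' s hs') hη ((hf.mass_eq hs.1.le
          (coe_lt_of_mem hs.2 htT)).trans hmass)
        have h3 := hM s hs'
        -- Dividing the production by the moment, which is at least one, leaves `D + C` and does not
        -- enlarge the error.
        have h4 : (moment m (f s) * (diss (η ^ 4) (f s) + momConst m) +
            η * (2 * m * B' ^ 2 * pairConst)) / moment m (f s) ≤
            diss (η ^ 4) (f s) + momConst m + η * (2 * m * B' ^ 2 * pairConst) := by
          rw [div_le_iff₀ (by linarith)]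
          have : 0 ≤ η * (2 * m * B' ^ 2 * pairConst) := by
            have : 0 ≤ m := by linarith
            positivity
          nlinarith
        have h5 := (div_le_div_of_nonneg_right h2 (by linarith : 0 ≤ moment m (f s))).trans h4
        change _ / moment m (f s) + _ ≤ _
        -- The dissipation produced by `log M_m` is cancelled by the entropy.
        linarith
  rw [hf.initial] at this
  change Real.log (moment m (f t)) + _ ≤ Real.log (moment m f_in) + _ + _ at this
  linarith

/-- The bound on moments up to time one. -/
def momentBound (m M : ℝ) : ℝ := M * Real.exp (momConst m + M + (16 + 2 * wtMass))

/-- The bound on the absolute entropy. -/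
def entropyBound (M : ℝ) : ℝ := M + 2 * (16 + 2 * wtMass)

/-- The a priori bounds available on a solution up to time one. -/
structure Bounds (m M₁ M₂ : ℝ) (g : 𝓢(V, ℝ)) : Prop where
  nonneg : ∀ v, 0 ≤ g v
  mass : ∫ v, g v = 1
  energy : ∫ v, g v * ‖v‖ ^ 2 = 3
  moment_le : moment m g ≤ M₁
  entropy_le : absEntropy g ≤ M₂

/-- The energy bounds `-H` from below uniformly, so the estimate on `log M_m + H` becomes one on
`M_m` alone, and the upper bound on `H` becomes one on `∫ f |log f|`. -/
theorem IsSchwartzSolution.bounds (hf : IsSchwartzSolution T f_in f) {M : ℝ} (hm : 2 < m)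
    (hN : IsNormalized f_in) (hM : weightedL1Norm m f_in ≤ M) (hE : absEntropy f_in ≤ M)
    {t : ℝ} (ht : 0 ≤ t) (ht1 : t ≤ 1) (htT : (t : EReal) < T) :
    Bounds m (momentBound m M) (entropyBound M) (f t) := by
  have hpos := hf.nonneg t ht htT
  have hpos0 : ∀ v, 0 ≤ f_in v := hf.initial ▸ hf.nonneg 0 le_rfl hf.pos
  have hmass : ∫ v, f t v = 1 := (hf.mass_eq ht htT).trans hN.1
  have hen : ∫ v, f t v * ‖v‖ ^ 2 = 3 := by
    rw [hf.energy_eq ht htT, ← hN.2.2]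
    simp only [mul_comm]
  have h0 := (entropy_le_absEntropy hpos0).trans hE
  refine ⟨hpos, hmass, hen, ?_, ?_⟩
  · have h1 := hf.log_moment_add_entropy_le hm hN.1 ht htT
    have h2 := neg_entropy_le hpos hmass hen
    have h3 := one_le_moment hpos hm hmass
    have h4 := one_le_moment hpos0 hm hN.1
    rw [← moment_eq_weightedL1Norm hpos0] at hM
    have h5 : momConst m * t ≤ momConst m := mul_le_of_le_one_right (momConst_nonneg hm) ht1
    have h6 : Real.log (moment m (f t)) ≤ Real.log (momentBound m M) := by
      rw [momentBound, Real.log_mul (by linarith) (Real.exp_pos _).ne', Real.log_exp]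
      have := Real.log_le_log (by linarith) hM
      linarith
    refine (Real.log_le_log_iff (by linarith) ?_).1 h6
    exact mul_pos (by linarith) (Real.exp_pos _)
  · have := absEntropy_le hpos hmass hen
    have := hf.entropy_le ht htT
    rw [entropyBound]
    linarith

end

/-! ### Coercivity of the diffusion matrix -/

section

open Filter Topology

variable {m : ℝ} {g : 𝓢(V, ℝ)}

/-- The component of `z` orthogonal to the unit vector `e`. -/
def perp (e z : V) : V := z - (inner ℝ e z : ℝ) • e

theorem continuous_perp (e : V) : Continuous (perp e) := by
  unfold perp
  fun_prop

theorem norm_perp_sq {e : V} (he : ‖e‖ = 1) (z : V) :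
    ‖perp e z‖ ^ 2 = ‖z‖ ^ 2 - inner ℝ e z ^ 2 := by
  rw [perp, norm_sub_sq_real, inner_smul_right, norm_smul, he, real_inner_comm, mul_one,
    Real.norm_eq_abs, sq_abs]
  ring

theorem kq_self_eq {e : V} (he : ‖e‖ = 1) {z : V} (hz : z ≠ 0) :
    kq z e e = ‖perp e z‖ ^ 2 / (8 * Real.pi * ‖z‖ ^ 3) := by
  have hn : 0 < ‖z‖ := norm_pos_iff.2 hz
  have := Real.pi_pos
  rw [kq, norm_perp_sq he, real_inner_self_eq_norm_sq, he, real_inner_comm z e]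
  field_simp

/-- The part of the ball of radius `4` within distance `4 / n` of the line `v + ℝ e`. -/
def tube (v e : V) (n : ℕ) : Set V := {w | ‖w‖ ≤ 4 ∧ ‖perp e (v - w)‖ < 4 / n}

/-- Slice the tube along its axis in steps `η = 4/n`. In the ball of radius `4 = nη` only `2n + 1`
slices occur, and each lies within `η + η` of a point of the axis. -/
theorem tube_subset {v e : V} (he : ‖e‖ = 1) {n : ℕ} (hn : 0 < n) :
    tube v e n ⊆ ⋃ k ∈ Finset.Icc (-(n : ℤ)) n,
      Metric.ball (perp e v + ((k : ℝ) * (4 / n)) • e) (2 * (4 / n)) := by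
  intro w hw
  have hn' : (0 : ℝ) < n := by exact_mod_cast hn
  set η : ℝ := 4 / n with hη
  have hη0 : 0 < η := by positivity
  have hnη : n * η = 4 := by rw [hη]; field_simp
  set s : ℝ := inner ℝ e w with hs
  have hs4 : |s| ≤ 4 := (abs_real_inner_le_norm e w).trans (by rw [he, one_mul]; exact hw.1)
  have hfl := Int.floor_le (s / η)
  have hfl' := Int.lt_floor_add_one (s / η)
  rw [abs_le] at hs4
  simp only [Set.mem_iUnion]
  refine ⟨⌊s / η⌋, Finset.mem_Icc.2 ⟨Int.le_floor.2 ?_, ?_⟩, ?_⟩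
  · rw [le_div_iff₀ hη0]
    push_cast
    linarith
  · have : (⌊s / η⌋ : ℝ) ≤ n := by
      refine hfl.trans ?_
      rw [div_le_iff₀ hη0]
      linarith
    exact_mod_cast this
  · rw [mem_ball_iff_norm]
    set k : ℝ := (⌊s / η⌋ : ℝ) with hk
    have e1 : w - (perp e v + (k * η) • e) = - perp e (v - w) + (s - k * η) • e := by
      rw [perp, perp, inner_sub_right, hs]
      module
    rw [e1]
    refine (norm_add_le _ _).trans_lt ?_
    rw [norm_neg, norm_smul, he, mul_one, Real.norm_eq_abs, two_mul]
    refine add_lt_add_of_lt_of_le hw.2 ?_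
    rw [le_div_iff₀ hη0] at hfl
    rw [div_lt_iff₀ hη0] at hfl'
    rw [abs_le]
    constructor <;> nlinarith

/-- The volume of the unit ball. -/
def ballVol : ℝ := volume.real (Metric.ball (0 : V) 1)

theorem volume_ball_real (x : V) {r : ℝ} (hr : 0 ≤ r) :
    volume.real (Metric.ball x r) = r ^ 3 * ballVol := by
  rw [Measure.real, Measure.addHaar_ball _ _ hr, ENNReal.toReal_mul, ENNReal.toReal_ofReal
    (by positivity), ballVol, Measure.real]
  simp

/-- There are at most `3n` balls of radius `8/n`, of volume `512 n⁻³` times that of the unit ball.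
-/
theorem volume_tube_le {v e : V} (he : ‖e‖ = 1) {n : ℕ} (hn : 0 < n) :
    volume.real (tube v e n) ≤ 1536 * ballVol / n ^ 2 := by
  have hn' : (1 : ℝ) ≤ n := by exact_mod_cast hn
  have hb : 0 ≤ ballVol := measureReal_nonneg
  have h1 : volume.real (tube v e n) ≤ ∑ k ∈ Finset.Icc (-(n : ℤ)) n,
      volume.real (Metric.ball (perp e v + ((k : ℝ) * (4 / n)) • e) (2 * (4 / n))) := by
    refine (measureReal_mono (tube_subset he hn) ?_).trans (measureReal_biUnion_finset_le _ _)
    exact (measure_biUnion_lt_top (Finset.finite_toSet _) fun _ _ => measure_ball_lt_top).ne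
  refine h1.trans ?_
  have e2 : ∀ k : ℤ, volume.real (Metric.ball (perp e v + ((k : ℝ) * (4 / n)) • e) (2 * (4 / n))) =
      (2 * (4 / n)) ^ 3 * ballVol := fun k => volume_ball_real _ (by positivity)
  simp only [e2, Finset.sum_const, Int.card_Icc, nsmul_eq_mul]
  have e3 : (((n : ℤ) + 1 - -(n : ℤ)).toNat : ℝ) = 2 * n + 1 := by
    have : ((n : ℤ) + 1 - -(n : ℤ)).toNat = 2 * n + 1 := by omega
    rw [this]; push_cast; ring
  rw [e3, le_div_iff₀ (by positivity)]
  have e4 : (2 * n + 1) * ((2 * (4 / (n : ℝ))) ^ 3 * ballVol) * n ^ 2 =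
    512 * ballVol * ((2 * n + 1) / n) := by field_simp; ring
  rw [e4]
  have : (2 * n + 1) / (n : ℝ) ≤ 3 := by rw [div_le_iff₀ (by positivity)]; linarith
  nlinarith

theorem integrable_absEntropy (hg : ∀ v, 0 ≤ g v) : Integrable fun v => g v * |Real.log (g v)| := by
  refine (integrable_entropy hg).norm.congr (Eventually.of_forall fun v => ?_)
  simp [abs_of_nonneg (hg v)]

/-- A function of bounded entropy does not concentrate. -/
theorem setIntegral_le_of_entropy (hg : ∀ v, 0 ≤ g v) {S : Set V}
    (hSf : volume S ≠ ⊤) {a : ℝ} (ha : 0 < a) :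
    ∫ v in S, g v ≤ Real.exp a * volume.real S + absEntropy g / a := by
  have ia := integrable_absEntropy hg
  have i1 : IntegrableOn (fun _ : V => Real.exp a) S :=
    integrableOn_const hSf
  have key : ∫ v in S, g v ≤ ∫ v in S, (Real.exp a + g v * |Real.log (g v)| / a) := by
    refine integral_mono g.integrable.integrableOn
      (i1.add (ia.integrableOn.div_const a)) fun v => ?_
    have hgv := hg v
    rcases le_or_gt (g v) (Real.exp a) with h | h
    · have : 0 ≤ g v * |Real.log (g v)| / a := by positivity
      linarith
    -- Where `g` exceeds `eᵃ`, it is at most `g log g / a`.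
    · have h1 : a ≤ Real.log (g v) := by
        rw [Real.le_log_iff_exp_le (lt_trans (Real.exp_pos a) h)]
        exact h.le
      have h2 : g v ≤ g v * |Real.log (g v)| / a := by
        rw [le_div_iff₀ ha]
        exact mul_le_mul_of_nonneg_left (h1.trans (le_abs_self _)) hgv
      have := Real.exp_pos a
      linarith
  refine key.trans ?_
  rw [integral_add i1 (ia.integrableOn.div_const a), integral_div, setIntegral_const, smul_eq_mul,
    mul_comm]
  gcongr
  exact setIntegral_le_integral ia (Eventually.of_forall fun v => mul_nonneg (hg v) (abs_nonneg _))

theorem setIntegral_far_le (hg : ∀ v, 0 ≤ g v) (hen : ∫ v, g v * ‖v‖ ^ 2 = 3) :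
    ∫ v in {v : V | 4 < ‖v‖}, g v ≤ 3 / 16 := by
  have i : Integrable fun v => g v * ‖v‖ ^ 2 := by
    simpa only [mul_comm] using (tame_norm.pow 2).integrable_mul g
  have hS : MeasurableSet {v : V | 4 < ‖v‖} := measurableSet_lt measurable_const measurable_norm
  calc ∫ v in {v : V | 4 < ‖v‖}, g v ≤ ∫ v in {v : V | 4 < ‖v‖}, g v * ‖v‖ ^ 2 / 16 := by
        refine setIntegral_mono_on g.integrable.integrableOn (i.div_const 16).integrableOn hS
          fun v hv => ?_
        have hv' : 4 < ‖v‖ := hv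
        have := hg v
        rw [le_div_iff₀ (by norm_num)]
        have : (16 : ℝ) ≤ ‖v‖ ^ 2 := by nlinarith
        gcongr
    _ ≤ ∫ v, g v * ‖v‖ ^ 2 / 16 := setIntegral_le_integral (i.div_const 16)
        (Eventually.of_forall fun v => by have := hg v; positivity)
    _ = 3 / 16 := by rw [integral_div, hen]

/-- The part of the ball of radius `4` away from the line `v + ℝ e`. -/
def goodSet (v e : V) (n : ℕ) : Set V := {w | ‖w‖ ≤ 4 ∧ 4 / n ≤ ‖perp e (v - w)‖}

theorem measurableSet_goodSet (v e : V) (n : ℕ) : MeasurableSet (goodSet v e n) := by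
  have h : Measurable fun w => ‖perp e (v - w)‖ :=
    ((continuous_perp e).comp (continuous_const.sub continuous_id)).norm.measurable
  exact (measurableSet_le measurable_norm measurable_const).inter
    (measurableSet_le measurable_const h)

/-- At most `3/16` of the unit mass lies outside the ball of radius `4`, by the energy, and at most
`1/8 + 1/8` in the tube, by the entropy: `a` is large compared with `M₂`, then `n` with `eᵃ`. The
remainder exceeds one half, uniformly in the line. -/
theorem exists_half_le_goodSet (M₂ : ℝ) : ∃ n : ℕ, 0 < n ∧ ∀ {m M₁ : ℝ} {g : 𝓢(V, ℝ)},
    Bounds m M₁ M₂ g → ∀ v e : V, ‖e‖ = 1 → 1 / 2 ≤ ∫ w in goodSet v e n, g w := by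
  set a : ℝ := 8 * |M₂| + 8 with ha
  have ha0 : 0 < a := by positivity
  have hb : 0 ≤ ballVol := measureReal_nonneg
  obtain ⟨k, hk⟩ := exists_nat_gt (8 * (Real.exp a * (1536 * ballVol)))
  refine ⟨k + 1, by omega, fun {m M₁ g} hB v e he => ?_⟩
  have hn : (1 : ℝ) ≤ ((k + 1 : ℕ) : ℝ) := by push_cast; linarith [(Nat.cast_nonneg k : (0:ℝ) ≤ k)]
  set n := k + 1 with hnk
  have hkn : (k : ℝ) ≤ n := by rw [hnk]; push_cast; linarith
  have hSf : volume (tube v e n) ≠ ⊤ := by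
    refine ((measure_mono ?_).trans_lt (measure_closedBall_lt_top (x := (0 : V)) (r := 4))).ne
    intro w hw
    simpa using hw.1
  have h1 := setIntegral_le_of_entropy hB.nonneg hSf ha0
  have h2 := volume_tube_le (v := v) he (n := n) (by omega)
  have h3 : Real.exp a * volume.real (tube v e n) ≤ 1 / 8 := by
    calc Real.exp a * volume.real (tube v e n) ≤ Real.exp a * (1536 * ballVol / n ^ 2) := by gcongr
      _ = Real.exp a * (1536 * ballVol) / n ^ 2 := by ring
      _ ≤ 1 / 8 := by
        rw [div_le_iff₀ (by positivity)]
        nlinarith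
  have h4 : absEntropy g / a ≤ 1 / 8 := by
    rw [div_le_iff₀ ha0]
    have := hB.entropy_le
    have := le_abs_self M₂
    linarith
  have h5 := setIntegral_far_le hB.nonneg hB.energy
  have hfar : MeasurableSet {v : V | 4 < ‖v‖} := measurableSet_lt measurable_const measurable_norm
  have hcompl : (goodSet v e n)ᶜ ⊆ tube v e n ∪ {v : V | 4 < ‖v‖} := by
    intro w hw
    by_cases h : ‖w‖ ≤ 4
    · left
      refine ⟨h, ?_⟩
      by_contra h'
      exact hw ⟨h, not_lt.1 h'⟩
    · right
      exact not_le.1 h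
  have hgpos : ∀ᵐ w ∂(volume : Measure V), 0 ≤ g w := Eventually.of_forall hB.nonneg
  have hsplit := integral_add_compl (measurableSet_goodSet v e n)
    (g.integrable (μ := volume))
  have hle : ∫ w in (goodSet v e n)ᶜ, g w ≤
      (∫ w in tube v e n, g w) + ∫ w in {v : V | 4 < ‖v‖}, g w := by
    refine (setIntegral_mono_set g.integrable.integrableOn (ae_restrict_of_ae hgpos)
      hcompl.eventuallyLE).trans ?_
    have hdisj : Disjoint (tube v e n) {v : V | 4 < ‖v‖} := by
      rw [Set.disjoint_left]
      intro w hw hw'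
      exact absurd hw.1 (not_le.2 hw')
    rw [setIntegral_union hdisj hfar g.integrable.integrableOn g.integrable.integrableOn]
  rw [hB.mass] at hsplit
  linarith

theorem sum_cnv_kerK_eq (g : 𝓢(V, ℝ)) (v ξ : V) :
    ∑ i, ∑ j, cnv (kerK i j) g v * ξ i * ξ j = ∫ w, kq (v - w) ξ ξ * g w := by
  have hI : ∀ i j, Integrable fun w => (ξ i * ξ j) * (kerK i j (v - w) * g w) := fun i j =>
    ((isKernel_kerK i j).integrable g v).const_mul _
  have e : ∀ w, kq (v - w) ξ ξ * g w = ∑ i, ∑ j, (ξ i * ξ j) * (kerK i j (v - w) * g w) := by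
    intro w
    simp only [kq_eq_sum, Finset.sum_mul]
    exact Finset.sum_congr rfl fun i _ => Finset.sum_congr rfl fun j _ => by ring
  simp only [e]
  rw [integral_finsetSum _ fun i _ => integrable_finsetSum _ fun j _ => hI i j]
  refine Finset.sum_congr rfl fun i _ => ?_
  rw [integral_finsetSum _ fun j _ => hI i j]
  refine Finset.sum_congr rfl fun j _ => ?_
  rw [integral_const_mul, cnv]
  ring

theorem integrable_kq_mul (g : 𝓢(V, ℝ)) (v ξ : V) : Integrable fun w => kq (v - w) ξ ξ * g w := by
  have e : ∀ w, kq (v - w) ξ ξ * g w = ∑ i, ∑ j, (ξ i * ξ j) * (kerK i j (v - w) * g w) := by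
    intro w
    simp only [kq_eq_sum, Finset.sum_mul]
    exact Finset.sum_congr rfl fun i _ => Finset.sum_congr rfl fun j _ => by ring
  simp only [e]
  exact integrable_finsetSum _ fun i _ => integrable_finsetSum _ fun j _ =>
    ((isKernel_kerK i j).integrable g v).const_mul _

theorem norm_add_four_pow_le (v : V) : (‖v‖ + 4) ^ 3 ≤ 125 * regPow 1 (3 / 2) v := by
  have h1 : (‖v‖ + 4) ^ 2 ≤ 25 * (‖v‖ ^ 2 + 1 ^ 2) := by
    nlinarith [norm_nonneg v, sq_nonneg (4 * ‖v‖ - 1)]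
  have h2 := Real.rpow_le_rpow (by positivity) h1 (show (0 : ℝ) ≤ 3 / 2 by norm_num)
  rw [Real.mul_rpow (by norm_num) (by positivity), ← Real.rpow_natCast, ← Real.rpow_mul
    (by positivity)] at h2
  rw [show (25 : ℝ) ^ (3 / 2 : ℝ) = 125 by
    rw [show (25 : ℝ) = 5 ^ (2 : ℝ) by norm_num, ← Real.rpow_mul (by norm_num)]
    norm_num] at h2
  rw [regPow]
  refine le_trans (le_of_eq ?_) h2
  rw [← Real.rpow_natCast]
  norm_num

/-- Coercivity of the diffusion matrix, with constants depending only on mass, energy and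
entropy. -/
theorem exists_coercive (M₂ : ℝ) : ∃ c : ℝ, 0 < c ∧ ∀ {m M₁ : ℝ} {g : 𝓢(V, ℝ)},
    Bounds m M₁ M₂ g → ∀ v ξ : V,
      c * regPow 1 (-(3 / 2)) v * ‖ξ‖ ^ 2 ≤ ∑ i, ∑ j, cnv (kerK i j) g v * ξ i * ξ j := by
  obtain ⟨n, hn, h⟩ := exists_half_le_goodSet M₂
  have hn' : (0 : ℝ) < n := by exact_mod_cast hn
  have hpi := Real.pi_pos
  refine ⟨1 / 2 * ((4 / n) ^ 2 / (8 * Real.pi * 125)), by positivity, fun {m M₁ g} hB v ξ => ?_⟩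
  rw [sum_cnv_kerK_eq]
  rcases eq_or_ne ξ 0 with rfl | hξ
  · simp [kq]
  have hξn : 0 < ‖ξ‖ := norm_pos_iff.2 hξ
  set e : V := ‖ξ‖⁻¹ • ξ with he
  have he1 : ‖e‖ = 1 := by
    rw [he, norm_smul, norm_inv, norm_norm, inv_mul_cancel₀ hξn.ne']
  have hξe : ξ = ‖ξ‖ • e := by rw [he, smul_inv_smul₀ hξn.ne']
  have e1 : ∀ z, kq z ξ ξ = ‖ξ‖ ^ 2 * kq z e e := fun z => by
    rw [hξe, kq_smul_left, kq_smul_right, ← hξe]; ring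
  have e3 : ∀ w, ‖ξ‖ ^ 2 * kq (v - w) e e * g w = ‖ξ‖ ^ 2 * (kq (v - w) e e * g w) := fun w =>
    mul_assoc _ _ _
  simp only [e1, e3]
  rw [integral_const_mul, mul_comm]
  refine mul_le_mul_of_nonneg_left ?_ (by positivity)
  have hρ := regPow_one_pos (3 / 2) v
  set q := (4 / (n : ℝ)) ^ 2 / (8 * Real.pi * 125) * regPow 1 (-(3 / 2)) v with hq
  -- On the good set the component of `v - w` orthogonal to `e` is at least `4/n`, while `|v - w| ≤
  -- |v| + 4` makes the denominator `O(⟨v⟩³)`.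
  have hlow : ∀ w ∈ goodSet v e n, q ≤ kq (v - w) e e := by
    intro w hw
    have hp : 0 < ‖perp e (v - w)‖ := lt_of_lt_of_le (by positivity) hw.2
    have hz : v - w ≠ 0 := by
      intro h0
      rw [h0] at hp
      simp [perp] at hp
    have hzn : 0 < ‖v - w‖ := norm_pos_iff.2 hz
    have hz4 : ‖v - w‖ ≤ ‖v‖ + 4 := (norm_sub_le _ _).trans (by linarith [hw.1])
    rw [kq_self_eq he1 hz, hq]
    have e2 : regPow 1 (-(3 / 2)) v = (regPow 1 (3 / 2) v)⁻¹ := by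
      rw [regPow, regPow, Real.rpow_neg (by positivity)]
    rw [e2, ← div_eq_mul_inv, div_div]
    have h3 : ‖v - w‖ ^ 3 ≤ 125 * regPow 1 (3 / 2) v :=
      (pow_le_pow_left₀ hzn.le hz4 3).trans (norm_add_four_pow_le v)
    have h4 := pow_le_pow_left₀ (by positivity) hw.2 2
    refine div_le_div₀ (by positivity) h4 (by positivity) ?_
    calc 8 * Real.pi * ‖v - w‖ ^ 3 ≤ 8 * Real.pi * (125 * regPow 1 (3 / 2) v) := by gcongr
      _ = _ := by ring
  have hnn : ∀ w, 0 ≤ kq (v - w) e e * g w := fun w =>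
    mul_nonneg (kq_self_nonneg _ _) (hB.nonneg w)
  have hq0 : 0 ≤ q := by
    have := regPow_one_pos (-(3 / 2)) v
    positivity
  calc 1 / 2 * ((4 / (n : ℝ)) ^ 2 / (8 * Real.pi * 125)) * regPow 1 (-(3 / 2)) v = q * (1 / 2) := by
        rw [hq]; ring
    _ ≤ q * ∫ w in goodSet v e n, g w := mul_le_mul_of_nonneg_left (h hB v e he1) hq0
    _ = ∫ w in goodSet v e n, q * g w := (integral_const_mul _ _).symm
    _ ≤ ∫ w in goodSet v e n, kq (v - w) e e * g w :=
        setIntegral_mono_on (g.integrable.const_mul q).integrableOn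
          (integrable_kq_mul g v e).integrableOn (measurableSet_goodSet v e n) fun w hw =>
            mul_le_mul_of_nonneg_right (hlow w hw) (hB.nonneg w)
    _ ≤ ∫ w, kq (v - w) e e * g w :=
        setIntegral_le_integral (integrable_kq_mul g v e) (Eventually.of_forall hnn)

end

/-! ### Energy identity and truncations -/

section

open Filter Topology

variable {g : 𝓢(V, ℝ)}

theorem LinBound.rapid {θ : ℝ → ℝ} (hθ : LinBound θ) (hg : ∀ v, 0 ≤ g v) :
    Rapid fun v => θ (g v) := by
  obtain ⟨C, hC, h⟩ := hθ.bound (bd 0 g)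
  refine ⟨hθ.meas.comp g.continuous.measurable, fun N => ⟨C * bd N g, fun v => ?_⟩⟩
  have h1 := h (g v) (hg v) ((le_abs_self _).trans (abs_le_bd_zero g v))
  have h2 := mul_abs_le_bd N g v
  rw [abs_of_nonneg (hg v)] at h2
  calc (1 + ‖v‖) ^ N * |θ (g v)| ≤ (1 + ‖v‖) ^ N * (C * g v) := by gcongr
    _ = C * ((1 + ‖v‖) ^ N * g v) := by ring
    _ ≤ _ := by gcongr

theorem tame_comp_of_continuousOn {θ : ℝ → ℝ} (hm : Measurable θ)
    (hc : ContinuousOn θ (Set.Ici 0)) (hg : ∀ v, 0 ≤ g v) : Tame fun v => θ (g v) := by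
  obtain ⟨C, _, hC⟩ := exists_bound_of_continuousOn_Ici hc (bd 0 g)
  exact .of_bounded (hm.comp g.continuous.measurable) fun v =>
    hC _ (hg v) ((le_abs_self _).trans (abs_le_bd_zero g v))

theorem SmoothNonlin.tame {θ θ' : ℝ → ℝ} (hθ : SmoothNonlin θ θ') (hg : ∀ v, 0 ≤ g v) :
    Tame fun v => θ (g v) :=
  tame_comp_of_continuousOn hθ.meas hθ.linBound.cont hg

theorem SmoothNonlin.tame' {θ θ' : ℝ → ℝ} (hθ : SmoothNonlin θ θ') (hg : ∀ v, 0 ≤ g v) :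
    Tame fun v => θ' (g v) :=
  tame_comp_of_continuousOn hθ.meas' hθ.cont' hg

theorem SmoothNonlin.hasGrad {θ θ' : ℝ → ℝ} (hθ : SmoothNonlin θ θ') (hg : ∀ v, 0 ≤ g v) :
    HasGrad (fun v => θ (g v)) fun v i => θ' (g v) * pd i g v :=
  (hasGrad_schwartz g).comp fun v => hθ.deriv _ (hg v)

/-- The Legendre-type transform `x θ'(x) - θ(x)`. -/
theorem SmoothNonlin.legendre {θ θ' θ'' : ℝ → ℝ} (h : SmoothNonlin θ θ')
    (h' : SmoothNonlin θ' θ'') :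
    SmoothNonlin (fun x => x * θ' x - θ x) fun x => x * θ'' x where
  meas := (measurable_id.mul h.meas').sub h.meas
  meas' := measurable_id.mul h'.meas'
  zero := by simp [h.zero]
  deriv x hx := by
    convert! ((hasDerivAt_id x).mul (h'.deriv x hx)).sub (h.deriv x hx) using 1
    simp
  cont' := continuousOn_id.mul h'.cont'

/-- The quadratic form of the diffusion matrix on the gradient. -/
def diffForm (g : 𝓢(V, ℝ)) (v : V) : ℝ :=
  ∑ i, ∑ j, cnv (kerK i j) g v * gradient g v i * gradient g v j

theorem rapid_diffForm (g : 𝓢(V, ℝ)) : Rapid (diffForm g) := by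
  unfold diffForm
  refine Rapid.sum _ fun i => Rapid.sum _ fun j => ?_
  simp only [schwartz_gradient_apply]
  exact (((isKernel_kerK i j).tame_cnv zero_le_one g).mul (tame_schwartz (pd i g))).mul_rapid
    (rapid_schwartz (pd j g))

/-- The function `x θ'(x) - θ(x)` has derivative `x θ''(x)`, so the drift term is a gradient tested
against `∇a`. Integration by parts and `-Δa = c g` turn it into the reaction term. -/
theorem integral_legendre {θ θ' θ'' : ℝ → ℝ} (h : SmoothNonlin θ θ') (h' : SmoothNonlin θ' θ'')
    (hg : ∀ v, 0 ≤ g v) :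
    ∫ v, ∑ i, (g v * θ'' (g v) * pd i g v) * cnv kerG (pd i g) v =
      newtonConst * ∫ v, (g v * θ' (g v) - θ (g v)) * g v := by
  have hL := h.legendre h'
  have tb : ∀ k : 𝓢(V, ℝ), Tame (cnv kerG k) := fun k => isKernel_kerG.tame_cnv zero_le_one k
  have hr : Rapid fun v => g v * θ' (g v) - θ (g v) := hL.linBound.rapid hg
  have hr' : ∀ i, Rapid fun v => g v * θ'' (g v) * pd i g v := fun i =>
    (hL.tame' hg).mul_rapid (rapid_schwartz (pd i g))
  have e1 : ∀ i, ∫ v, (g v * θ'' (g v) * pd i g v) * cnv kerG (pd i g) v =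
      - ∫ v, cnv kerG (pd i (pd i g)) v * (g v * θ' (g v) - θ (g v)) := fun i => by
    rw [← integral_mul_partial (isKernel_kerG.hasGrad_cnv zero_le_one (pd i g)) (hL.hasGrad hg) i
      ((tb _).mul_rapid hr).integrable ((tb _).mul_rapid hr).integrable
      ((tb _).mul_rapid (hr' i)).integrable]
    simp only [mul_comm]
  have hI : ∀ i, Integrable fun v => (g v * θ'' (g v) * pd i g v) * cnv kerG (pd i g) v := fun i => by
    simpa only [mul_comm] using ((tb (pd i g)).mul_rapid (hr' i)).integrable
  rw [integral_finsetSum _ fun i _ => hI i, Finset.sum_congr rfl fun i _ => e1 i,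
    Finset.sum_neg_distrib, ← integral_finsetSum _ fun i _ => ((tb _).mul_rapid hr).integrable,
    ← integral_neg, ← integral_const_mul]
  congr 1
  ext v
  rw [← Finset.sum_mul, sum_cnv_kerG]
  ring

variable {T : EReal} {f_in : 𝓢(V, ℝ)} {f : ℝ → 𝓢(V, ℝ)}

/-- The energy identity for a convex function of the solution. -/
theorem IsSchwartzSolution.hasDerivAt_energy (hf : IsSchwartzSolution T f_in f) {t : ℝ}
    (ht : 0 < t) (htT : (t : EReal) < T) {θ θ' θ'' : ℝ → ℝ} (h : SmoothNonlin θ θ')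
    (h' : SmoothNonlin θ' θ'') :
    HasDerivAt (fun s => ∫ v, θ (f s v)) (-(∫ v, θ'' (f t v) * diffForm (f t) v) +
      newtonConst * ∫ v, (f t v * θ' (f t v) - θ (f t v)) * f t v) t := by
  have hpos := hf.nonneg t ht.le htT
  have hd := hf.hasDerivAt_integral ht htT h (tame_const 1)
  simp only [mul_one] at hd
  convert hd using 1
  rw [integral_mul_collision (h'.hasGrad hpos) (h'.tame hpos)
    (fun i => (h'.tame' hpos).mul (tame_schwartz (pd i (f t)))), ← integral_legendre h h' hpos]
  have i1 : Integrable fun v => θ'' (f t v) * diffForm (f t) v :=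
    ((h'.tame' hpos).mul_rapid (rapid_diffForm (f t))).integrable
  have i2 : Integrable fun v => ∑ i, (f t v * θ'' (f t v) * pd i (f t) v) *
      cnv kerG (pd i (f t)) v := by
    refine integrable_finsetSum _ fun i _ => ?_
    have := ((isKernel_kerG.tame_cnv zero_le_one (pd i (f t))).mul_rapid
      (((h.legendre h').tame' hpos).mul_rapid (rapid_schwartz (pd i (f t))))).integrable
    simpa only [mul_comm] using this
  rw [← integral_neg', ← integral_neg, ← integral_add' i1.neg i2]
  congr 1
  ext v
  simp only [Pi.add_apply, Pi.neg_apply, diffForm, flux_apply, schwartz_gradient_apply, Fin.sum_univ_three]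
  ring

/-! ### Truncated powers as convex nonlinearities -/

/-- Truncated powers `(s - κ)₊ⁿ sᵃ`. -/
def trunc (n : ℕ) (a κ s : ℝ) : ℝ := max (s - κ) 0 ^ n * s ^ a

variable {n : ℕ} {a κ s : ℝ}

theorem trunc_of_le (hs : s ≤ κ) : trunc (n + 1) a κ s = 0 := by
  rw [trunc, max_eq_right (by linarith), zero_pow (by omega), zero_mul]

theorem trunc_of_lt (hs : κ < s) : trunc n a κ s = (s - κ) ^ n * s ^ a := by
  rw [trunc, max_eq_left (by linarith)]

theorem trunc_nonneg (hs : 0 ≤ s) : 0 ≤ trunc n a κ s := by unfold trunc; positivity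

theorem measurable_trunc (n : ℕ) (a κ : ℝ) : Measurable (trunc n a κ) := by
  unfold trunc
  fun_prop

theorem continuous_trunc (n : ℕ) (a : ℝ) (hκ : 0 < κ) : Continuous (trunc (n + 1) a κ) := by
  rw [continuous_iff_continuousAt]
  intro s
  rcases lt_or_ge s κ with h | h
  · have : trunc (n + 1) a κ =ᶠ[𝓝 s] fun _ => 0 := by
      filter_upwards [gt_mem_nhds h] with x hx using trunc_of_le hx.le
    exact continuousAt_const.congr this.symm
  · unfold trunc
    exact ContinuousAt.mul (by fun_prop) (Real.continuousAt_rpow_const _ _ (Or.inl (by linarith)))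

theorem hasDerivAt_trunc (n : ℕ) (a : ℝ) (hκ : 0 < κ) (s : ℝ) :
    HasDerivAt (trunc (n + 2) a κ)
      ((n + 2 : ℕ) * trunc (n + 1) a κ s + a * trunc (n + 2) (a - 1) κ s) s := by
  rcases lt_or_ge s κ with h | h
  · have : trunc (n + 2) a κ =ᶠ[𝓝 s] fun _ => 0 := by
      filter_upwards [gt_mem_nhds h] with x hx using trunc_of_le hx.le
    rw [trunc_of_le h.le, trunc_of_le h.le]
    simpa using (hasDerivAt_const s (0 : ℝ)).congr_of_eventuallyEq this
  · have h1 := (hasDerivAt_max_zero_pow n (s - κ)).comp s ((hasDerivAt_id s).sub_const κ)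
    have h2 := h1.mul (Real.hasDerivAt_rpow_const (x := s) (p := a) (Or.inl (by linarith)))
    convert! h2 using 1
    simp only [trunc, Function.comp_apply, id_eq]
    push_cast
    ring

theorem smoothNonlin_trunc (n : ℕ) (a : ℝ) (hκ : 0 < κ) : SmoothNonlin (trunc (n + 2) a κ)
    fun s => (n + 2 : ℕ) * trunc (n + 1) a κ s + a * trunc (n + 2) (a - 1) κ s where
  meas := measurable_trunc _ _ _
  meas' := ((measurable_trunc _ _ _).const_mul _).add ((measurable_trunc _ _ _).const_mul _)
  zero := trunc_of_le hκ.le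
  deriv x _ := hasDerivAt_trunc n a hκ x
  cont' := (((continuous_trunc n a hκ).const_mul _).add
    ((continuous_trunc (n + 1) (a - 1) hκ).const_mul _)).continuousOn

theorem SmoothNonlin.const_mul {θ θ' : ℝ → ℝ} (h : SmoothNonlin θ θ') (c : ℝ) :
    SmoothNonlin (fun x => c * θ x) fun x => c * θ' x where
  meas := h.meas.const_mul c
  meas' := h.meas'.const_mul c
  zero := by simp [h.zero]
  deriv x hx := (h.deriv x hx).const_mul c
  cont' := h.cont'.const_mul c

theorem SmoothNonlin.add {θ θ' ζ ζ' : ℝ → ℝ} (h : SmoothNonlin θ θ') (h' : SmoothNonlin ζ ζ') :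
    SmoothNonlin (fun x => θ x + ζ x) fun x => θ' x + ζ' x where
  meas := h.meas.add h'.meas
  meas' := h.meas'.add h'.meas'
  zero := by simp [h.zero, h'.zero]
  deriv x hx := (h.deriv x hx).add (h'.deriv x hx)
  cont' := h.cont'.add h'.cont'

/-- The truncated energy density `(s - κ)₊⁴ s^{p - 4}`. -/
def enPhi (p κ s : ℝ) : ℝ := trunc 4 (p - 4) κ s

/-- The first derivative of `enPhi`. -/
def enPhi' (p κ s : ℝ) : ℝ := 4 * trunc 3 (p - 4) κ s + (p - 4) * trunc 4 (p - 5) κ s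

/-- The second derivative of `enPhi`. -/
def enPhi'' (p κ s : ℝ) : ℝ :=
  4 * (3 * trunc 2 (p - 4) κ s + (p - 4) * trunc 3 (p - 5) κ s) +
    (p - 4) * (4 * trunc 3 (p - 5) κ s + (p - 5) * trunc 4 (p - 6) κ s)

/-- The square root of `enPhi`. -/
def enG (p κ s : ℝ) : ℝ := trunc 2 (p / 2 - 2) κ s

/-- The derivative of `enG`. -/
def enG' (p κ s : ℝ) : ℝ := 2 * trunc 1 (p / 2 - 2) κ s + (p / 2 - 2) * trunc 2 (p / 2 - 3) κ s

/-- The reaction density `s Φ'(s) - Φ(s)`. -/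
def enPsi (p κ s : ℝ) : ℝ := s * enPhi' p κ s - enPhi p κ s

variable {p : ℝ}

/-- The fourth power at the threshold provides the two derivatives needed for every `p > 3/2`; the
plain `(s - κ)₊ᵖ` would fail for `p < 2`. The factor `s^{p-4}` restores the growth `sᵖ` and is
harmless, since only `s > κ > 0` matters. -/
theorem smoothNonlin_enPhi (p : ℝ) (hκ : 0 < κ) : SmoothNonlin (enPhi p κ) (enPhi' p κ) := by
  have := smoothNonlin_trunc 2 (p - 4) hκ
  rw [show p - 4 - 1 = p - 5 by ring] at this
  exact_mod_cast this

theorem smoothNonlin_enPhi' (p : ℝ) (hκ : 0 < κ) : SmoothNonlin (enPhi' p κ) (enPhi'' p κ) := by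
  have h1 := (smoothNonlin_trunc 1 (p - 4) hκ).const_mul 4
  have h2 := (smoothNonlin_trunc 2 (p - 5) hκ).const_mul (p - 4)
  rw [show p - 4 - 1 = p - 5 by ring] at h1
  rw [show p - 5 - 1 = p - 6 by ring] at h2
  exact_mod_cast h1.add h2

theorem smoothNonlin_enG (p : ℝ) (hκ : 0 < κ) : SmoothNonlin (enG p κ) (enG' p κ) := by
  have := smoothNonlin_trunc 0 (p / 2 - 2) hκ
  rw [show p / 2 - 2 - 1 = p / 2 - 3 by ring] at this
  exact_mod_cast this

theorem rpow_eq_mul_pow {s b : ℝ} (hs : 0 < s) (a : ℝ) (n : ℕ) (h : b = a + n) :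
    s ^ b = s ^ a * s ^ n := by
  rw [h, Real.rpow_add hs, Real.rpow_natCast]

theorem enG_sq (hκ : 0 < κ) (s : ℝ) : enG p κ s ^ 2 = enPhi p κ s := by
  rcases le_or_gt s κ with h | h
  · rw [enG, enPhi, trunc_of_le h, trunc_of_le h]
    norm_num
  · have hs : 0 < s := hκ.trans h
    rw [enG, enPhi, trunc_of_lt h, trunc_of_lt h, mul_pow, ← Real.rpow_natCast (s ^ _),
      ← Real.rpow_mul hs.le]
    congr 1
    · ring
    · congr 1
      push_cast
      ring

/-- With `s = κ + d`, dividing the difference by `s^{p-6} d²` leaves `8κ² + (6p - 8)κd + (3p²/4 -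
p)d²`, whose coefficients are nonnegative as soon as `p ≥ 4/3`. -/
theorem enG'_sq_le (hp : 3 / 2 < p) (hκ : 0 < κ) (s : ℝ) : enG' p κ s ^ 2 ≤ enPhi'' p κ s := by
  rcases le_or_gt s κ with h | h
  · simp [enG', enPhi'', trunc_of_le h]
  · have hs : 0 < s := hκ.trans h
    simp only [enG', enPhi'', trunc_of_lt h]
    have e1 : s ^ (p / 2 - 2) = s ^ (p / 2 - 3) * s ^ 1 := rpow_eq_mul_pow hs _ _ (by push_cast; ring)
    have e2 : s ^ (p - 4) = s ^ (p - 6) * s ^ 2 := rpow_eq_mul_pow hs _ _ (by push_cast; ring)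
    have e3 : s ^ (p - 5) = s ^ (p - 6) * s ^ 1 := rpow_eq_mul_pow hs _ _ (by push_cast; ring)
    have e4 : s ^ (p - 6) = (s ^ (p / 2 - 3)) ^ 2 := by
      rw [← Real.rpow_natCast, ← Real.rpow_mul hs.le]
      congr 1
      push_cast
      ring
    rw [e1, e2, e3, e4]
    set Y := s ^ (p / 2 - 3)
    obtain ⟨d, rfl⟩ : ∃ d, s = κ + d := ⟨s - κ, by ring⟩
    have hd : 0 < d := by linarith
    have key : 0 ≤ (Y * d) ^ 2 * (8 * κ ^ 2 + (6 * p - 8) * (κ * d) +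
        (3 / 4 * p ^ 2 - p) * d ^ 2) := by
      have : 0 ≤ 3 / 4 * p ^ 2 - p := by nlinarith
      have : 0 ≤ 6 * p - 8 := by linarith
      positivity
    nlinarith [key]

/-- For `s = κ + d` the reaction density is `s^{p-4} d³ (4κ + (p - 1)d)`, from which both bounds are
visible. -/
theorem enPsi_nonneg_and_le (hp : 3 / 2 < p) (hκ : 0 < κ) (hs : 0 ≤ s) :
    0 ≤ enPsi p κ s ∧ enPsi p κ s ≤ (p + 3) * s ^ p := by
  rcases le_or_gt s κ with h | h
  · simp only [enPsi, enPhi', enPhi, trunc_of_le h]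
    constructor
    · simp
    · simp
      have := Real.rpow_nonneg hs p
      nlinarith
  · have hs : 0 < s := hκ.trans h
    simp only [enPsi, enPhi', enPhi, trunc_of_lt h]
    have e2 : s ^ (p - 4) = s ^ (p - 5) * s ^ 1 := rpow_eq_mul_pow hs _ _ (by push_cast; ring)
    have e3 : s ^ p = s ^ (p - 5) * s ^ 5 := rpow_eq_mul_pow hs _ _ (by push_cast; ring)
    rw [e2, e3]
    set Y := s ^ (p - 5)
    have hY : 0 ≤ Y := Real.rpow_nonneg hs.le _
    obtain ⟨d, rfl⟩ : ∃ d, s = κ + d := ⟨s - κ, by ring⟩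
    have hd : 0 < d := by linarith
    have e : (κ + d) * (4 * ((κ + d - κ) ^ 3 * (Y * (κ + d) ^ 1)) +
        (p - 4) * ((κ + d - κ) ^ 4 * Y)) - (κ + d - κ) ^ 4 * (Y * (κ + d) ^ 1) =
        Y * ((κ + d) * (d ^ 3 * (4 * κ + (p - 1) * d))) := by ring
    rw [e]
    have hp1 : 0 ≤ p - 1 := by linarith
    refine ⟨by positivity, ?_⟩
    have h1 : d ^ 3 ≤ (κ + d) ^ 3 := by gcongr; linarith
    have h2 : 4 * κ + (p - 1) * d ≤ (p + 3) * (κ + d) := by nlinarith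
    calc Y * ((κ + d) * (d ^ 3 * (4 * κ + (p - 1) * d)))
        ≤ Y * ((κ + d) * ((κ + d) ^ 3 * ((p + 3) * (κ + d)))) := by gcongr
      _ = _ := by ring

theorem enPhi_nonneg (hs : 0 ≤ s) : 0 ≤ enPhi p κ s := trunc_nonneg hs

theorem enG_nonneg (hs : 0 ≤ s) : 0 ≤ enG p κ s := trunc_nonneg hs

theorem enPhi_le (hκ : 0 < κ) (hs : 0 ≤ s) : enPhi p κ s ≤ s ^ p := by
  rcases le_or_gt s κ with h | h
  · rw [enPhi, trunc_of_le h]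
    positivity
  · have hs : 0 < s := hκ.trans h
    rw [enPhi, trunc_of_lt h, rpow_eq_mul_pow (b := p) hs (p - 4) 4 (by push_cast; ring),
      mul_comm]
    have : (s - κ) ^ 4 ≤ s ^ 4 := pow_le_pow_left₀ (by linarith) (by linarith) 4
    gcongr

theorem enPhi_eq_zero (h : s ≤ κ) : enPhi p κ s = 0 := trunc_of_le h

theorem enPsi_eq_zero (h : s ≤ κ) : enPsi p κ s = 0 := by
  simp [enPsi, enPhi', enPhi, trunc_of_le h]

end

/-! ### Sobolev inequality and energy inequality -/

section

open Filter Topology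

variable {g : 𝓢(V, ℝ)} {p κ : ℝ}

theorem HasGrad.contDiff {u : V → ℝ} {u' : V → Fin 3 → ℝ} (h : HasGrad u u')
    (hc : ∀ i, Continuous fun v => u' v i) : ContDiff ℝ 1 u := by
  rw [contDiff_one_iff_fderiv]
  refine ⟨fun v => (h v).differentiableAt, ?_⟩
  have : fderiv ℝ u = fun v => dualForm (u' v) := funext fun v => (h v).fderiv
  rw [this]
  unfold dualForm
  exact continuous_finsetSum _ fun i _ => (hc i).smul continuous_const

theorem norm_dualForm_sq_le (a : Fin 3 → ℝ) : ‖dualForm a‖ ^ 2 ≤ 3 * ∑ i, a i ^ 2 := by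
  have h := norm_clm_le (dualForm a)
  simp only [dualForm_single] at h
  have h2 := pow_le_pow_left₀ (norm_nonneg _) h 2
  refine h2.trans ?_
  have := sq_sum_le_card_mul_sum_sq (s := Finset.univ) (f := fun i => |a i|)
  simpa using this

/-- The Sobolev inequality on `ℝ³`. -/
theorem exists_sobolev : ∃ S : ℝ, 0 < S ∧ ∀ (u : V → ℝ) (u' : V → Fin 3 → ℝ), HasGrad u u' →
    (∀ i, Continuous fun v => u' v i) → HasCompactSupport u →
      (∫ v, u v ^ 6) ^ (1 / 3 : ℝ) ≤ S * ∫ v, ∑ i, u' v i ^ 2 := by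
  set C : ℝ := ((SNormLESNormFDerivOfEqConst ℝ (volume : Measure V) 2 : NNReal) : ℝ) with hC
  have hC0 : 0 ≤ C := NNReal.coe_nonneg _
  refine ⟨3 * C ^ 2 + 1, by positivity, fun u u' h hc hs => ?_⟩
  have hcd := h.contDiff hc
  have hcf : Continuous (fderiv ℝ u) := hcd.continuous_fderiv one_ne_zero
  have hsf : HasCompactSupport (fderiv ℝ u) := hs.fderiv ℝ
  have key := eLpNorm_le_eLpNorm_fderiv_of_eq (volume : Measure V) hcd hs (p := 2) (p' := 6)
    (by norm_num) (by simp) (by simp; norm_num)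
  have m1 : MemLp u (6 : NNReal) := hcd.continuous.memLp_of_hasCompactSupport hs
  have m2 : MemLp (fderiv ℝ u) (2 : NNReal) := hcf.memLp_of_hasCompactSupport hsf
  rw [m1.eLpNorm_eq_integral_rpow_norm (by norm_num) (by simp),
    m2.eLpNorm_eq_integral_rpow_norm (by norm_num) (by simp)] at key
  have e6 : ((6 : NNReal) : ENNReal).toReal = ((6 : ℕ) : ℝ) := by simp
  have e2 : ((2 : NNReal) : ENNReal).toReal = ((2 : ℕ) : ℝ) := by simp
  rw [e6, e2] at key
  simp only [Real.rpow_natCast] at key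
  set I6 := ∫ v, ‖u v‖ ^ 6 with hI6
  set I2 := ∫ v, ‖fderiv ℝ u v‖ ^ 2 with hI2
  have h6 : 0 ≤ I6 := integral_nonneg fun v => by positivity
  have h2 : 0 ≤ I2 := integral_nonneg fun v => by positivity
  have key2 : I6 ^ (((6 : ℕ) : ℝ)⁻¹) ≤ C * I2 ^ (((2 : ℕ) : ℝ)⁻¹) := by
    rw [← ENNReal.ofReal_coe_nnreal, ← ENNReal.ofReal_mul (NNReal.coe_nonneg _),
      ENNReal.ofReal_le_ofReal_iff (by positivity)] at key
    exact_mod_cast key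
  have key3 := pow_le_pow_left₀ (by positivity) key2 2
  rw [mul_pow, ← Real.rpow_natCast, ← Real.rpow_mul h6, ← Real.rpow_natCast (I2 ^ _),
    ← Real.rpow_mul h2] at key3
  have e3 : (((6 : ℕ) : ℝ)⁻¹ * ((2 : ℕ) : ℝ)) = 1 / 3 := by norm_num
  have e4 : (((2 : ℕ) : ℝ)⁻¹ * ((2 : ℕ) : ℝ)) = 1 := by norm_num
  rw [e3, e4, Real.rpow_one] at key3
  have e5 : I6 = ∫ v, u v ^ 6 := by
    rw [hI6]
    congr 1
    ext v
    rw [Real.norm_eq_abs, Even.pow_abs (by decide)]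
  rw [e5] at key3
  have hsum : Integrable fun v => ∑ i, u' v i ^ 2 := by
    refine integrable_finsetSum _ fun i _ => ?_
    have hz : HasCompactSupport fun v => u' v i ^ 2 := by
      refine hsf.mono fun v hv => ?_
      rw [Function.mem_support] at hv ⊢
      contrapose! hv
      rw [← h.fderiv_single v i, hv]
      simp
    exact ((hc i).pow 2).integrable_of_hasCompactSupport hz
  have hI : I2 ≤ 3 * ∫ v, ∑ i, u' v i ^ 2 := by
    rw [hI2, ← integral_const_mul]
    refine integral_mono_of_nonneg (Eventually.of_forall fun v => by positivity)
      (hsum.const_mul 3) (Eventually.of_forall fun v => ?_)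
    simp only [(h v).fderiv]
    exact norm_dualForm_sq_le _
  have h0 : 0 ≤ ∫ v, ∑ i, u' v i ^ 2 := integral_nonneg fun v =>
    Finset.sum_nonneg fun i _ => sq_nonneg _
  refine key3.trans ?_
  nlinarith [mul_le_mul_of_nonneg_left hI (sq_nonneg C)]

/-- The truncated energy. -/
def dgX (p κ : ℝ) (g : 𝓢(V, ℝ)) : ℝ := ∫ v, enPhi p κ (g v)

/-- The truncated reaction term. -/
def dgP (p κ : ℝ) (g : 𝓢(V, ℝ)) : ℝ := ∫ v, enPsi p κ (g v) * g v

/-- The integral of the sixth power of the weighted truncation. -/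
def dgI (p κ : ℝ) (g : 𝓢(V, ℝ)) : ℝ := ∫ v, enG p κ (g v) ^ 6 * regPow 1 (-(9 / 2)) v

/-- The squared weighted `L⁶` norm of the truncation. -/
def dgZ (p κ : ℝ) (g : 𝓢(V, ℝ)) : ℝ := dgI p κ g ^ (1 / 3 : ℝ)

/-- The weighted Dirichlet form of the truncation. -/
def dgD (p κ : ℝ) (g : 𝓢(V, ℝ)) : ℝ :=
  ∫ v, enG' p κ (g v) ^ 2 * (regPow 1 (-(3 / 2)) v * ‖gradient g v‖ ^ 2)

/-- A decaying function exceeds a positive level only on a bounded set, so Sobolev's inequality for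
compactly supported functions applies directly. -/
theorem hasCompactSupport_enG (p : ℝ) (hκ : 0 < κ) (g : 𝓢(V, ℝ)) (ω : V → ℝ) :
    HasCompactSupport fun v => ω v * enG p κ (g v) := by
  refine .intro (isCompact_closedBall (0 : V) (bd 1 g / κ)) fun v hv => ?_
  rw [mem_closedBall_zero_iff, not_le, div_lt_iff₀ hκ] at hv
  have h1 := mul_abs_le_bd 1 g v
  rw [pow_one] at h1
  have h2 : g v ≤ κ := by
    by_contra h
    rw [not_le] at h
    have h3 : κ < |g v| := lt_of_lt_of_le h (le_abs_self _)
    have := norm_nonneg v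
    nlinarith
  rw [enG, trunc_of_le h2, mul_zero]

theorem regPow_sq (a : ℝ) (v : V) : regPow 1 a v ^ 2 = regPow 1 (2 * a) v := by
  rw [regPow, regPow, ← Real.rpow_natCast, ← Real.rpow_mul (by positivity)]
  congr 1
  push_cast
  ring

theorem regPow_pow_six (a : ℝ) (v : V) : regPow 1 a v ^ 6 = regPow 1 (6 * a) v := by
  rw [regPow, regPow, ← Real.rpow_natCast, ← Real.rpow_mul (by positivity)]
  congr 1
  push_cast
  ring

theorem regPow_one_le_one {a : ℝ} (ha : a ≤ 0) (v : V) : regPow 1 a v ≤ 1 :=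
  Real.rpow_le_one_of_one_le_of_nonpos (by nlinarith [sq_nonneg ‖v‖]) ha

theorem sum_grad_weight_le (v : V) :
    ∑ i, (2 * (-(3 / 4)) * v i * regPow 1 (-(3 / 4) - 1) v) ^ 2 ≤ 9 / 4 := by
  have h1 : ∑ i, (2 * (-(3 / 4)) * v i * regPow 1 (-(3 / 4) - 1) v) ^ 2 =
      9 / 4 * (‖v‖ ^ 2 * regPow 1 (-(3 / 4) - 1) v ^ 2) := by
    rw [sum_fin_three_norm_sq]
    simp only [Fin.sum_univ_three]
    ring
  rw [h1, regPow_sq]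
  have h2 := sq_mul_regPow one_pos (2 * (-(3 / 4) - 1) + 1) v
  rw [add_sub_cancel_right] at h2
  have h3 := regPow_one_le_one (a := 2 * (-(3 / 4) - 1) + 1) (by norm_num) v
  have h4 := (regPow_one_pos (2 * (-(3 / 4) - 1)) v).le
  nlinarith

theorem integrable_enPhi (p : ℝ) (hκ : 0 < κ) (hg : ∀ v, 0 ≤ g v) :
    Integrable fun v => enPhi p κ (g v) :=
  ((smoothNonlin_enPhi p hκ).linBound.rapid hg).integrable

theorem rapid_dirichlet (p : ℝ) (hκ : 0 < κ) (hg : ∀ v, 0 ≤ g v) :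
    Rapid fun v => enG' p κ (g v) ^ 2 * (regPow 1 (-(3 / 2)) v * ‖gradient g v‖ ^ 2) := by
  have hr := rapid_norm_gradient g
  have ht : Tame fun v => ‖gradient g v‖ := by
    obtain ⟨C, hC⟩ := hr.bound 0
    refine .of_bounded (C := C) hr.meas fun v => ?_
    have := hC v
    rwa [pow_zero, one_mul] at this
  refine (((smoothNonlin_enG p hκ).tame' hg).pow 2).mul_rapid ?_
  refine (tame_regPow one_pos (by norm_num)).mul_rapid ?_
  simpa only [sq] using ht.mul_rapid hr

/-- Sobolev's inequality for `⟨v⟩^{-3/2} G(g)`. The gradient falling on `G` gives the Dirichlet form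
with exactly the weight of the ellipticity bound; falling on the weight it gives a bounded multiple
of `G² = Φ`. -/
theorem dgZ_le {S : ℝ} (hS0 : 0 < S) (hS : ∀ (u : V → ℝ) (u' : V → Fin 3 → ℝ), HasGrad u u' →
    (∀ i, Continuous fun v => u' v i) → HasCompactSupport u →
      (∫ v, u v ^ 6) ^ (1 / 3 : ℝ) ≤ S * ∫ v, ∑ i, u' v i ^ 2) (hκ : 0 < κ)
    (hg : ∀ v, 0 ≤ g v) :
    dgZ p κ g ≤ S * (2 * dgD p κ g + 9 / 2 * dgX p κ g) := by
  have hG := (smoothNonlin_enG p hκ).hasGrad hg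
  have hw := hasGrad_regPow one_pos (-(3 / 4))
  have hu := hw.mul hG
  have cG : Continuous fun v => enG p κ (g v) := hG.continuous
  have cw := hw.continuous
  have cw' := (hasGrad_regPow one_pos (-(3 / 4) - 1)).continuous
  have cG' : Continuous fun v => enG' p κ (g v) :=
    (((continuous_trunc 0 _ hκ).const_mul _).add ((continuous_trunc 1 _ hκ).const_mul _)).comp
      g.continuous
  have key := hS _ _ hu (fun i => by
    have := (pd i g).continuous
    have h3 : Continuous fun v : V => v i := by fun_prop
    exact (cw.mul (cG'.mul this)).add (cG.mul ((h3.const_mul _).mul cw')))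
    (hasCompactSupport_enG p hκ g _)
  have e1 : (∫ v, (regPow 1 (-(3 / 4)) v * enG p κ (g v)) ^ 6) = dgI p κ g := by
    unfold dgI
    congr 1
    ext v
    rw [mul_pow, regPow_pow_six, mul_comm]
    norm_num
  rw [e1] at key
  refine key.trans (mul_le_mul_of_nonneg_left ?_ hS0.le)
  have iD := (rapid_dirichlet p hκ hg).integrable
  have iX := integrable_enPhi p hκ hg
  rw [dgD, dgX, ← integral_const_mul, ← integral_const_mul,
    ← integral_add (iD.const_mul 2) (iX.const_mul _)]
  refine integral_mono_of_nonneg (Eventually.of_forall fun v =>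
    Finset.sum_nonneg fun i _ => sq_nonneg _) ((iD.const_mul 2).add (iX.const_mul _))
    (Eventually.of_forall fun v => ?_)
  have h1 : ∀ x y : ℝ, (x + y) ^ 2 ≤ 2 * x ^ 2 + 2 * y ^ 2 := fun x y => by
    nlinarith [sq_nonneg (x - y)]
  have h2 := sum_grad_weight_le v
  have hn : ‖gradient g v‖ ^ 2 = ∑ i, pd i g v ^ 2 := by
    rw [sum_fin_three_norm_sq]
    simp only [Fin.sum_univ_three, schwartz_gradient_apply]
  have hr : regPow 1 (-(3 / 2)) v = regPow 1 (-(3 / 4)) v ^ 2 := by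
    rw [regPow_sq]
    norm_num
  calc ∑ i, (regPow 1 (-(3 / 4)) v * (enG' p κ (g v) * pd i g v) +
        enG p κ (g v) * (2 * (-(3 / 4)) * v i * regPow 1 (-(3 / 4) - 1) v)) ^ 2
      ≤ ∑ i, (2 * (regPow 1 (-(3 / 4)) v * (enG' p κ (g v) * pd i g v)) ^ 2 +
        2 * (enG p κ (g v) * (2 * (-(3 / 4)) * v i * regPow 1 (-(3 / 4) - 1) v)) ^ 2) :=
        Finset.sum_le_sum fun i _ => h1 _ _
    _ = 2 * (enG' p κ (g v) ^ 2 * (regPow 1 (-(3 / 2)) v * ‖gradient g v‖ ^ 2)) +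
        2 * (enG p κ (g v) ^ 2 * ∑ i, (2 * (-(3 / 4)) * v i * regPow 1 (-(3 / 4) - 1) v) ^ 2) := by
        rw [hn, hr]
        simp only [Fin.sum_univ_three]
        ring
    _ ≤ 2 * (enG' p κ (g v) ^ 2 * (regPow 1 (-(3 / 2)) v * ‖gradient g v‖ ^ 2)) +
        2 * (enG p κ (g v) ^ 2 * (9 / 4)) := by gcongr
    _ = _ := by
        rw [enG_sq hκ]
        ring

/-- The energy inequality for the truncations of a solution. -/
theorem exists_energy_inequality (M₂ : ℝ) {p : ℝ} (hp : 3 / 2 < p) :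
    ∃ c C : ℝ, 0 < c ∧ 0 < C ∧ ∀ {m M₁ : ℝ} {T : EReal} {f_in : 𝓢(V, ℝ)} {f : ℝ → 𝓢(V, ℝ)},
      IsSchwartzSolution T f_in f → ∀ {κ t : ℝ}, 0 < κ → 0 < t → (t : EReal) < T →
        Bounds m M₁ M₂ (f t) → ∃ X' : ℝ, HasDerivAt (fun s => dgX p κ (f s)) X' t ∧
          X' ≤ - (c * dgZ p κ (f t)) + C * (dgP p κ (f t) + dgX p κ (f t)) := by
  obtain ⟨S, hS0, hS⟩ := exists_sobolev
  obtain ⟨c, hc0, hc⟩ := exists_coercive M₂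
  have hN := newtonConst_nonneg
  -- From `Z ≤ S (2D + (9/2) X)`, with `D` here the Dirichlet form, follows `c D ≥ (c / 2S) Z -
  -- (9c/4) X`; the last term joins the right-hand side.
  refine ⟨c / (2 * S), newtonConst + 9 / 4 * c, by positivity, by positivity,
    fun {m M₁ T f_in f} hf {κ t} hκ ht htT hB => ?_⟩
  have hpos := hB.nonneg
  refine ⟨_, hf.hasDerivAt_energy ht htT (smoothNonlin_enPhi p hκ) (smoothNonlin_enPhi' p hκ), ?_⟩
  have iQ : Integrable fun v => enPhi'' p κ (f t v) * diffForm (f t) v :=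
    (((smoothNonlin_enPhi' p hκ).tame' hpos).mul_rapid (rapid_diffForm (f t))).integrable
  have hD : c * dgD p κ (f t) ≤ ∫ v, enPhi'' p κ (f t v) * diffForm (f t) v := by
    rw [dgD, ← integral_const_mul]
    refine integral_mono ((rapid_dirichlet p hκ hpos).integrable.const_mul c) iQ fun v => ?_
    have h1 := hc hB v (gradient (f t) v)
    have h2 := enG'_sq_le hp hκ (f t v)
    have h3 : 0 ≤ c * regPow 1 (-(3 / 2)) v * ‖gradient (f t) v‖ ^ 2 := by
      have := regPow_one_pos (-(3 / 2)) v
      positivity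
    calc c * (enG' p κ (f t v) ^ 2 * (regPow 1 (-(3 / 2)) v * ‖gradient (f t) v‖ ^ 2))
        = enG' p κ (f t v) ^ 2 * (c * regPow 1 (-(3 / 2)) v * ‖gradient (f t) v‖ ^ 2) := by ring
      _ ≤ enPhi'' p κ (f t v) * diffForm (f t) v :=
        mul_le_mul h2 h1 h3 ((sq_nonneg _).trans h2)
  have hZ := dgZ_le (p := p) hS0 hS hκ hpos
  have hP : ∫ v, (f t v * enPhi' p κ (f t v) - enPhi p κ (f t v)) * f t v = dgP p κ (f t) := rfl
  have hP0 : 0 ≤ dgP p κ (f t) := integral_nonneg fun v =>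
    mul_nonneg (enPsi_nonneg_and_le hp hκ (hpos v)).1 (hpos v)
  have hX0 : 0 ≤ dgX p κ (f t) := integral_nonneg fun v => enPhi_nonneg (hpos v)
  rw [hP]
  have h4 : c / (2 * S) * dgZ p κ (f t) ≤ c * dgD p κ (f t) + 9 / 4 * c * dgX p κ (f t) := by
    calc c / (2 * S) * dgZ p κ (f t)
        ≤ c / (2 * S) * (S * (2 * dgD p κ (f t) + 9 / 2 * dgX p κ (f t))) := by gcongr
      _ = _ := by field_simp; ring
  have h5 := mul_nonneg hN hX0
  have h6 := mul_nonneg hc0.le hP0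
  nlinarith

end

/-! ### Interpolation between truncation levels -/

section

open Filter Topology

variable {g : 𝓢(V, ℝ)} {p κ : ℝ}

/-- Hölder's inequality for three functions. -/
theorem integral_rpow_mul_three_le {α : Type*} [MeasurableSpace α] {μ : Measure α}
    {F₁ F₂ F₃ : α → ℝ} (h₁ : Integrable F₁ μ) (h₂ : Integrable F₂ μ) (h₃ : Integrable F₃ μ)
    (n₁ : ∀ x, 0 ≤ F₁ x) (n₂ : ∀ x, 0 ≤ F₂ x) (n₃ : ∀ x, 0 ≤ F₃ x) {a b c : ℝ} (ha : 0 ≤ a)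
    (hb : 0 ≤ b) (hc : 0 ≤ c) (habc : a + b + c = 1) :
    Integrable (fun x => F₁ x ^ a * F₂ x ^ b * F₃ x ^ c) μ ∧
      ∫ x, F₁ x ^ a * F₂ x ^ b * F₃ x ^ c ∂μ ≤
        (∫ x, F₁ x ∂μ) ^ a * (∫ x, F₂ x ∂μ) ^ b * (∫ x, F₃ x ∂μ) ^ c := by
  have key := ENNReal.lintegral_prod_norm_pow_le (μ := μ) Finset.univ
    (f := ![fun x => ENNReal.ofReal (F₁ x), fun x => ENNReal.ofReal (F₂ x),
      fun x => ENNReal.ofReal (F₃ x)]) (p := ![a, b, c]) (by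
        intro i _
        fin_cases i
        · exact h₁.aestronglyMeasurable.aemeasurable.ennreal_ofReal
        · exact h₂.aestronglyMeasurable.aemeasurable.ennreal_ofReal
        · exact h₃.aestronglyMeasurable.aemeasurable.ennreal_ofReal)
    (by simpa [Fin.sum_univ_three] using habc) (by
        intro i _
        fin_cases i
        · exact ha
        · exact hb
        · exact hc)
  simp only [Fin.prod_univ_three, Matrix.cons_val_zero, Matrix.cons_val_one, Matrix.cons_val] at key
  have m₁ := h₁.aestronglyMeasurable.aemeasurable
  have m₂ := h₂.aestronglyMeasurable.aemeasurable
  have m₃ := h₃.aestronglyMeasurable.aemeasurable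
  have hmeas : AEStronglyMeasurable (fun x => F₁ x ^ a * F₂ x ^ b * F₃ x ^ c) μ :=
    (((m₁.pow_const a).mul (m₂.pow_const b)).mul (m₃.pow_const c)).aestronglyMeasurable
  have hnn : ∀ x, 0 ≤ F₁ x ^ a * F₂ x ^ b * F₃ x ^ c := fun x =>
    mul_nonneg (mul_nonneg (Real.rpow_nonneg (n₁ x) a) (Real.rpow_nonneg (n₂ x) b))
      (Real.rpow_nonneg (n₃ x) c)
  have e1 : ∀ x, ENNReal.ofReal (F₁ x) ^ a * ENNReal.ofReal (F₂ x) ^ b * ENNReal.ofReal (F₃ x) ^ c =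
      ENNReal.ofReal (F₁ x ^ a * F₂ x ^ b * F₃ x ^ c) := fun x => by
    rw [ENNReal.ofReal_rpow_of_nonneg (n₁ x) ha, ENNReal.ofReal_rpow_of_nonneg (n₂ x) hb,
      ENNReal.ofReal_rpow_of_nonneg (n₃ x) hc, ← ENNReal.ofReal_mul (Real.rpow_nonneg (n₁ x) a),
      ← ENNReal.ofReal_mul (mul_nonneg (Real.rpow_nonneg (n₁ x) a) (Real.rpow_nonneg (n₂ x) b))]
  have p₁ : 0 ≤ ∫ x, F₁ x ∂μ := integral_nonneg n₁
  have p₂ : 0 ≤ ∫ x, F₂ x ∂μ := integral_nonneg n₂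
  have p₃ : 0 ≤ ∫ x, F₃ x ∂μ := integral_nonneg n₃
  have e2 : (∫⁻ x, ENNReal.ofReal (F₁ x) ∂μ) ^ a * (∫⁻ x, ENNReal.ofReal (F₂ x) ∂μ) ^ b *
      (∫⁻ x, ENNReal.ofReal (F₃ x) ∂μ) ^ c = ENNReal.ofReal
        ((∫ x, F₁ x ∂μ) ^ a * (∫ x, F₂ x ∂μ) ^ b * (∫ x, F₃ x ∂μ) ^ c) := by
    rw [← ofReal_integral_eq_lintegral_ofReal h₁ (Eventually.of_forall n₁),
      ← ofReal_integral_eq_lintegral_ofReal h₂ (Eventually.of_forall n₂),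
      ← ofReal_integral_eq_lintegral_ofReal h₃ (Eventually.of_forall n₃),
      ENNReal.ofReal_rpow_of_nonneg p₁ ha, ENNReal.ofReal_rpow_of_nonneg p₂ hb,
      ENNReal.ofReal_rpow_of_nonneg p₃ hc, ← ENNReal.ofReal_mul (by positivity),
      ← ENNReal.ofReal_mul (by positivity)]
  simp only [e1] at key
  rw [e2] at key
  have hint : Integrable (fun x => F₁ x ^ a * F₂ x ^ b * F₃ x ^ c) μ := by
    refine ⟨hmeas, ?_⟩
    rw [hasFiniteIntegral_iff_ofReal (Eventually.of_forall hnn)]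
    exact key.trans_lt ENNReal.ofReal_lt_top
  refine ⟨hint, ?_⟩
  rw [← ofReal_integral_eq_lintegral_ofReal hint (Eventually.of_forall hnn),
    ENNReal.ofReal_le_ofReal_iff (by positivity)] at key
  exact key

/-- `γ` is the surplus over `p + 1` of the power of `f` controlled by the interpolation; its
positivity is the lower bound imposed on `m`. -/
theorem gammaExp_eq {p m : ℝ} (hp : 3 / 2 < p) (hm : 0 < m) :
    p * (1 + betaExp m) + 3 / m = p + 1 + gammaExp p m := by
  obtain ⟨q, rfl⟩ : ∃ q, p = q + 3 / 2 := ⟨p - 3 / 2, by ring⟩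
  have hq : 0 < q := by linarith
  rw [betaExp, gammaExp, add_sub_cancel_right]
  field_simp
  ring

/-- Above the level `κ'`, powers of `s` are controlled by the truncation at a lower level. -/
theorem rpow_le_enG {p κ κ' q s : ℝ} (hκ : 0 < κ) (hq : 0 < q) (hκq : κ ≤ (1 - q) * κ')
    (hκ' : 0 < κ') (hs : κ' < s) : s ^ (p / 2) ≤ (q ^ 2)⁻¹ * enG p κ s := by
  have hs0 : 0 < s := hκ'.trans hs
  have h1 : q * s ≤ s - κ := by
    have hq1 : 0 < 1 - q := by
      by_contra h
      have : (1 - q) * κ' ≤ 0 := mul_nonpos_of_nonpos_of_nonneg (by linarith) hκ'.le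
      linarith
    nlinarith
  have h2 : κ < s := by nlinarith
  rw [enG, trunc_of_lt h2, rpow_eq_mul_pow (b := p / 2) hs0 (p / 2 - 2) 2 (by push_cast; ring)]
  have h3 : q ^ 2 * s ^ 2 ≤ (s - κ) ^ 2 := by
    rw [← mul_pow]
    exact pow_le_pow_left₀ (by positivity) h1 2
  have hY : 0 ≤ s ^ (p / 2 - 2) := Real.rpow_nonneg hs0.le _
  rw [← div_eq_inv_mul, le_div_iff₀ (by positivity)]
  nlinarith

/-- Lowering the exponent by `e` gains `κ'^{-e}` above the level `κ'`. The case `e = 1 + γ` reaches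
the power `p` of the energy, and `e = γ` the power `p + 1` of the reaction term. -/
theorem rpow_le_level {p m κ κ' q s e : ℝ} (hp : 3 / 2 < p) (hm : 0 < m) (hβ : 0 < betaExp m)
    (he : 0 ≤ e) (hκ : 0 < κ) (hq : 0 < q) (hκq : κ ≤ (1 - q) * κ') (hκ' : 0 < κ') (hs : κ' < s) :
    s ^ (p + 1 + gammaExp p m - e) ≤ κ' ^ (-e) * ((q ^ 2)⁻¹ ^ (2 + 2 * betaExp m) *
      (enG p κ s ^ (2 + 2 * betaExp m) * s ^ (3 / m))) := by
  have hs0 : 0 < s := hκ'.trans hs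
  have h1 := rpow_le_enG (p := p) hκ hq hκq hκ' hs
  have h2 := Real.rpow_le_rpow (by positivity) h1 (show 0 ≤ 2 + 2 * betaExp m by linarith)
  rw [Real.mul_rpow (by positivity) (enG_nonneg hs0.le), ← Real.rpow_mul hs0.le] at h2
  have e1 : s ^ (p + 1 + gammaExp p m - e) =
      s ^ (-e) * (s ^ (p / 2 * (2 + 2 * betaExp m)) * s ^ (3 / m)) := by
    rw [← gammaExp_eq hp hm, ← Real.rpow_add hs0, ← Real.rpow_add hs0]
    congr 1
    ring
  have h3 : s ^ (-e) ≤ κ' ^ (-e) := Real.rpow_le_rpow_of_nonpos hκ' hs.le (by linarith)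
  rw [e1]
  have h4 : 0 ≤ s ^ (3 / m) := by positivity
  calc s ^ (-e) * (s ^ (p / 2 * (2 + 2 * betaExp m)) * s ^ (3 / m))
      ≤ κ' ^ (-e) * (((q ^ 2)⁻¹ ^ (2 + 2 * betaExp m) * enG p κ s ^ (2 + 2 * betaExp m)) *
        s ^ (3 / m)) := by
        have := Real.rpow_nonneg hs0.le (-e)
        gcongr
    _ = _ := by ring

theorem rapid_enG_pow_six (p : ℝ) (hκ : 0 < κ) (hg : ∀ v, 0 ≤ g v) :
    Rapid fun v => enG p κ (g v) ^ 6 * regPow 1 (-(9 / 2)) v := by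
  have h1 := (((smoothNonlin_enG p hκ).tame hg).pow 5).mul_rapid
    ((smoothNonlin_enG p hκ).linBound.rapid hg)
  have h2 := (tame_regPow one_pos (a := -(9 / 2)) (by norm_num)).mul_rapid h1
  convert h2 using 2 with v
  ring

/-- The interpolation inequality behind the iteration. -/
theorem integral_enG_le {m M₁ M₂ : ℝ} (hm : 9 / 2 < m) (hκ : 0 < κ) (hB : Bounds m M₁ M₂ g) :
    Integrable (fun v => enG p κ (g v) ^ (2 + 2 * betaExp m) * g v ^ (3 / m)) ∧
      ∫ v, enG p κ (g v) ^ (2 + 2 * betaExp m) * g v ^ (3 / m) ≤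
        dgZ p κ g * dgX p κ g ^ betaExp m * M₁ ^ (3 / m) := by
  have hm0 : 0 < m := by linarith
  have hβ : 0 ≤ betaExp m := by
    rw [betaExp, sub_nonneg, div_le_div_iff₀ hm0 (by norm_num)]
    linarith
  have hpos := hB.nonneg
  have hreg := fun (a : ℝ) (v : V) => (regPow_one_pos a v).le
  -- The three functions contribute `⟨v⟩^{-9 · 1/3}`, no weight, and `⟨v⟩^{m · 3/m}`, so the weights
  -- cancel.
  have key := integral_rpow_mul_three_le (μ := (volume : Measure V))
    (rapid_enG_pow_six p hκ hpos).integrable (integrable_enPhi p hκ hpos)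
    (integrable_mul_regPow g (a := m / 2) (by linarith))
    (fun v => mul_nonneg (pow_nonneg (enG_nonneg (hpos v)) 6) (hreg _ v))
    (fun v => enPhi_nonneg (hpos v)) (fun v => mul_nonneg (hpos v) (hreg _ v))
    (a := 1 / 3) (b := betaExp m) (c := 3 / m) (by norm_num) hβ (by positivity)
    (by rw [betaExp]; ring)
  have e : ∀ v, (enG p κ (g v) ^ 6 * regPow 1 (-(9 / 2)) v) ^ (1 / 3 : ℝ) *
      enPhi p κ (g v) ^ betaExp m * (g v * regPow 1 (m / 2) v) ^ (3 / m) =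
      enG p κ (g v) ^ (2 + 2 * betaExp m) * g v ^ (3 / m) := fun v => by
    have hG := enG_nonneg (p := p) (κ := κ) (hpos v)
    have hv : (0 : ℝ) < ‖v‖ ^ 2 + 1 ^ 2 := by positivity
    rw [← enG_sq hκ, Real.mul_rpow (by positivity) (hreg _ v), Real.mul_rpow (hpos v) (hreg _ v)]
    have e1 : (enG p κ (g v) ^ 6) ^ (1 / 3 : ℝ) = enG p κ (g v) ^ (2 : ℝ) := by
      rw [← Real.rpow_natCast, ← Real.rpow_mul hG]
      norm_num
    have e2 : (enG p κ (g v) ^ 2) ^ betaExp m = enG p κ (g v) ^ (2 * betaExp m) := by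
      rw [← Real.rpow_natCast, ← Real.rpow_mul hG]
      norm_num
    have e3 : regPow 1 (-(9 / 2)) v ^ (1 / 3 : ℝ) * regPow 1 (m / 2) v ^ (3 / m) = 1 := by
      rw [regPow, regPow, ← Real.rpow_mul hv.le, ← Real.rpow_mul hv.le, ← Real.rpow_add hv]
      have : -(9 / 2) * (1 / 3) + m / 2 * (3 / m) = 0 := by field_simp; ring
      rw [this, Real.rpow_zero]
    rw [e1, e2, Real.rpow_add_of_nonneg hG (by norm_num) (by linarith)]
    linear_combination (enG p κ (g v) ^ (2 : ℝ) * enG p κ (g v) ^ (2 * betaExp m) *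
      g v ^ (3 / m)) * e3
  simp only [e] at key
  refine ⟨key.1, key.2.trans ?_⟩
  have hZ : 0 ≤ dgI p κ g := integral_nonneg fun v =>
    mul_nonneg (pow_nonneg (enG_nonneg (hpos v)) 6) (hreg _ v)
  have hX : 0 ≤ dgX p κ g := integral_nonneg fun v => enPhi_nonneg (hpos v)
  have hM : 0 ≤ moment m g := integral_nonneg fun v => mul_nonneg (hpos v) (hreg _ v)
  have := Real.rpow_le_rpow hM hB.moment_le (show 0 ≤ 3 / m by positivity)
  exact mul_le_mul_of_nonneg_left this (mul_nonneg (Real.rpow_nonneg hZ _) (Real.rpow_nonneg hX _))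

theorem dgZ_nonneg (hg : ∀ v, 0 ≤ g v) : 0 ≤ dgZ p κ g :=
  Real.rpow_nonneg (integral_nonneg fun v =>
    mul_nonneg (pow_nonneg (enG_nonneg (hg v)) 6) (regPow_one_pos _ v).le) _

theorem dgX_nonneg (hg : ∀ v, 0 ≤ g v) : 0 ≤ dgX p κ g :=
  integral_nonneg fun v => enPhi_nonneg (hg v)

theorem dgP_nonneg (hp : 3 / 2 < p) (hκ : 0 < κ) (hg : ∀ v, 0 ≤ g v) : 0 ≤ dgP p κ g :=
  integral_nonneg fun v => mul_nonneg (enPsi_nonneg_and_le hp hκ (hg v)).1 (hg v)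

theorem dgX_level_le {m M₁ M₂ κ' q : ℝ} (hp : 3 / 2 < p) (hm : 9 / 2 < m)
    (hβ : 0 < betaExp m) (hγ : 0 < gammaExp p m) (hκ : 0 < κ) (hq : 0 < q)
    (hκq : κ ≤ (1 - q) * κ') (hκ' : 0 < κ') (hB : Bounds m M₁ M₂ g) :
    dgX p κ' g ≤ κ' ^ (-(1 + gammaExp p m)) * ((q ^ 2)⁻¹ ^ (2 + 2 * betaExp m) *
      (dgZ p κ g * dgX p κ g ^ betaExp m * M₁ ^ (3 / m))) := by
  obtain ⟨hi, hle⟩ := integral_enG_le (p := p) hm hκ hB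
  have hq' : 0 ≤ (q ^ 2)⁻¹ ^ (2 + 2 * betaExp m) := by positivity
  have hk' : 0 ≤ κ' ^ (-(1 + gammaExp p m)) := by positivity
  refine le_trans ?_ (mul_le_mul_of_nonneg_left (mul_le_mul_of_nonneg_left hle hq') hk')
  rw [dgX, ← integral_const_mul, ← integral_const_mul]
  refine integral_mono (integrable_enPhi p hκ' hB.nonneg) ((hi.const_mul _).const_mul _) fun v => ?_
  have hv := hB.nonneg v
  rcases le_or_gt (g v) κ' with h | h
  · rw [enPhi_eq_zero h]
    have := enG_nonneg (p := p) (κ := κ) hv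
    positivity
  · refine (enPhi_le hκ' hv).trans ?_
    have := rpow_le_level (m := m) (e := 1 + gammaExp p m) hp (by linarith) hβ (by linarith) hκ hq
      hκq hκ' h
    rwa [show p + 1 + gammaExp p m - (1 + gammaExp p m) = p by ring] at this

theorem rapid_enPsi_mul (p : ℝ) (hκ : 0 < κ) (hg : ∀ v, 0 ≤ g v) :
    Rapid fun v => enPsi p κ (g v) * g v :=
  (((smoothNonlin_enPhi p hκ).legendre (smoothNonlin_enPhi' p hκ)).tame hg).mul_rapid
    (rapid_schwartz g)

theorem dgP_level_le {m M₁ M₂ κ' q : ℝ} (hp : 3 / 2 < p) (hm : 9 / 2 < m)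
    (hβ : 0 < betaExp m) (hγ : 0 < gammaExp p m) (hκ : 0 < κ) (hq : 0 < q)
    (hκq : κ ≤ (1 - q) * κ') (hκ' : 0 < κ') (hB : Bounds m M₁ M₂ g) :
    dgP p κ' g ≤ (p + 3) * (κ' ^ (-gammaExp p m) * ((q ^ 2)⁻¹ ^ (2 + 2 * betaExp m) *
      (dgZ p κ g * dgX p κ g ^ betaExp m * M₁ ^ (3 / m)))) := by
  obtain ⟨hi, hle⟩ := integral_enG_le (p := p) hm hκ hB
  have hq' : 0 ≤ (q ^ 2)⁻¹ ^ (2 + 2 * betaExp m) := by positivity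
  have hk' : 0 ≤ κ' ^ (-gammaExp p m) := by positivity
  have hp3 : 0 ≤ p + 3 := by linarith
  refine le_trans ?_ (mul_le_mul_of_nonneg_left (mul_le_mul_of_nonneg_left
    (mul_le_mul_of_nonneg_left hle hq') hk') hp3)
  rw [dgP, ← integral_const_mul, ← integral_const_mul, ← integral_const_mul]
  refine integral_mono (rapid_enPsi_mul p hκ' hB.nonneg).integrable
    (((hi.const_mul _).const_mul _).const_mul _) fun v => ?_
  have hv := hB.nonneg v
  rcases le_or_gt (g v) κ' with h | h
  · rw [enPsi_eq_zero h, zero_mul]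
    have := enG_nonneg (p := p) (κ := κ) hv
    positivity
  · have h0 : 0 < g v := hκ'.trans h
    have := rpow_le_level (m := m) (e := gammaExp p m) hp (by linarith) hβ hγ.le hκ hq hκq hκ' h
    rw [show p + 1 + gammaExp p m - gammaExp p m = p + 1 by ring, Real.rpow_add_one h0.ne'] at this
    calc enPsi p κ' (g v) * g v ≤ (p + 3) * g v ^ p * g v :=
          mul_le_mul_of_nonneg_right (enPsi_nonneg_and_le hp hκ' hv).2 hv
      _ = (p + 3) * (g v ^ p * g v) := by ring
      _ ≤ _ := mul_le_mul_of_nonneg_left this hp3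

theorem LinBound.mul {θ ζ : ℝ → ℝ} (hθ : LinBound θ) (hζ : LinBound ζ) :
    LinBound fun x => θ x * ζ x where
  meas := hθ.meas.mul hζ.meas
  cont := hθ.cont.mul hζ.cont
  bound R := by
    obtain ⟨C, hC, h⟩ := hθ.bound R
    obtain ⟨D, hD, h'⟩ := hζ.bound R
    refine ⟨C * (D * |R|), by positivity, fun x hx hR => ?_⟩
    rw [abs_mul]
    calc |θ x| * |ζ x| ≤ (C * x) * (D * x) := by
          gcongr
          exacts [h x hx hR, h' x hx hR]
      _ = C * (D * x) * x := by ring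
      _ ≤ C * (D * |R|) * x := by
          gcongr
          exact hR.trans (le_abs_self R)

theorem LinBound.pow_succ {θ : ℝ → ℝ} (hθ : LinBound θ) (n : ℕ) :
    LinBound fun x => θ x ^ (n + 1) := by
  induction n with
  | zero => simpa using hθ
  | succ n ih => simpa only [_root_.pow_succ] using ih.mul hθ

theorem linBound_rpow {p : ℝ} (hp : 0 < p) : LinBound fun x => x ^ (p + 1) where
  meas := by fun_prop
  cont := (Real.continuous_rpow_const (by linarith)).continuousOn
  bound R := by
    refine ⟨|R| ^ p, by positivity, fun x hx hR => ?_⟩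
    rw [abs_of_nonneg (by positivity), Real.rpow_add_one' hx (by linarith)]
    have : x ≤ |R| := hR.trans (le_abs_self R)
    gcongr

variable {T : EReal} {f_in : 𝓢(V, ℝ)} {f : ℝ → 𝓢(V, ℝ)}

theorem IsSchwartzSolution.continuousOn_integral (hf : IsSchwartzSolution T f_in f) {t : ℝ}
    (htT : (t : EReal) < T) {θ : ℝ → ℝ} (hθ : LinBound θ) :
    ContinuousOn (fun s => ∫ v, θ (f s v)) (Set.Icc 0 t) := by
  simpa using continuousOn_integral_comp isCompact_Icc (hf.continuousOn_Icc htT)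
    (hf.nonneg_of_mem htT) hθ (tame_const 1)

theorem IsSchwartzSolution.continuousOn_dgX (hf : IsSchwartzSolution T f_in f) {t : ℝ}
    (htT : (t : EReal) < T) (hκ : 0 < κ) :
    ContinuousOn (fun s => dgX p κ (f s)) (Set.Icc 0 t) :=
  hf.continuousOn_integral htT (smoothNonlin_enPhi p hκ).linBound

theorem IsSchwartzSolution.continuousOn_dgP (hf : IsSchwartzSolution T f_in f) {t : ℝ}
    (htT : (t : EReal) < T) (hκ : 0 < κ) :
    ContinuousOn (fun s => dgP p κ (f s)) (Set.Icc 0 t) :=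
  hf.continuousOn_integral htT
    (((smoothNonlin_enPhi p hκ).legendre (smoothNonlin_enPhi' p hκ)).linBound.mul LinBound.id)

theorem IsSchwartzSolution.continuousOn_dgZ (hf : IsSchwartzSolution T f_in f) {t : ℝ}
    (htT : (t : EReal) < T) (hκ : 0 < κ) :
    ContinuousOn (fun s => dgZ p κ (f s)) (Set.Icc 0 t) := by
  have h : ContinuousOn (fun s => dgI p κ (f s)) (Set.Icc 0 t) :=
    continuousOn_integral_comp isCompact_Icc (hf.continuousOn_Icc htT)
      (hf.nonneg_of_mem htT) ((smoothNonlin_enG p hκ).linBound.pow_succ 5)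
      (tame_regPow one_pos (a := -(9 / 2)) (by norm_num))
  exact h.rpow_const fun _ _ => Or.inr (by norm_num)

end

/-! ### De Giorgi iteration -/

section

open Filter Topology

theorem integral_le_of_subinterval {F : ℝ → ℝ} {u t x y : ℝ} (hF : ContinuousOn F (Set.Icc u t))
    (hn : ∀ s ∈ Set.Icc u t, 0 ≤ F s) (hx : u ≤ x) (hxy : x ≤ y) (hy : y ≤ t) :
    ∫ s in x..y, F s ≤ ∫ s in u..t, F s := by
  refine intervalIntegral.integral_mono_interval hx hxy hy ?_
    (hF.intervalIntegrable_of_Icc (hx.trans (hxy.trans hy)))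
  filter_upwards [ae_restrict_mem measurableSet_Ioc] with s hs using hn s ⟨hs.1.le, hs.2⟩

/-- Averaging an integrated energy inequality over the initial time. -/
theorem energy_average {X Y Z : ℝ → ℝ} {u w t c : ℝ} (huw : u < w) (hwt : w ≤ t) (hc : 0 ≤ c)
    (cX : ContinuousOn X (Set.Icc u t)) (cY : ContinuousOn Y (Set.Icc u t))
    (cZ : ContinuousOn Z (Set.Icc u t)) (nX : ∀ s ∈ Set.Icc u t, 0 ≤ X s)
    (nY : ∀ s ∈ Set.Icc u t, 0 ≤ Y s) (nZ : ∀ s ∈ Set.Icc u t, 0 ≤ Z s)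
    (hE : ∀ x y, u ≤ x → x ≤ y → y ≤ t → X y - X x ≤ ∫ s in x..y, (-(c * Z s) + Y s))
    {y : ℝ} (hy : y ∈ Set.Icc w t) :
    X y + c * (∫ s in w..y, Z s) ≤ (w - u)⁻¹ * (∫ s in u..t, X s) + ∫ s in u..t, Y s := by
  have hint : ∀ {F : ℝ → ℝ}, ContinuousOn F (Set.Icc u t) → ∀ {x y}, u ≤ x → x ≤ y → y ≤ t →
      IntervalIntegrable F volume x y := fun hF x y hx hxy hy =>
    (hF.mono (Set.Icc_subset_Icc hx hy)).intervalIntegrable_of_Icc hxy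
  -- The inequality is started from an arbitrary time `x` in `[u, w]` and then averaged in `x`, so
  -- no pointwise information on `X` at the initial time enters.
  have h1 : ∀ x ∈ Set.Icc u w, X y + c * (∫ s in w..y, Z s) - (∫ s in u..t, Y s) ≤ X x := by
    intro x hx
    have hxy : x ≤ y := hx.2.trans hy.1
    have h2 := hE x y hx.1 hxy hy.2
    have hneg : IntervalIntegrable (fun s => -(c * Z s)) volume x y :=
      ((hint cZ hx.1 hxy hy.2).const_mul c).neg
    rw [intervalIntegral.integral_add hneg (hint cY hx.1 hxy hy.2), intervalIntegral.integral_neg,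
      intervalIntegral.integral_const_mul] at h2
    have h3 : ∫ s in w..y, Z s ≤ ∫ s in x..y, Z s :=
      integral_le_of_subinterval (cZ.mono (Set.Icc_subset_Icc hx.1 hy.2))
        (fun s hs => nZ s (Set.Icc_subset_Icc hx.1 hy.2 hs)) hx.2 hy.1 le_rfl
    have h4 := integral_le_of_subinterval cY nY hx.1 hxy hy.2
    have h5 := mul_le_mul_of_nonneg_left h3 hc
    linarith
  set L := X y + c * (∫ s in w..y, Z s) - ∫ s in u..t, Y s with hL
  have h2 : (w - u) * L ≤ ∫ s in u..t, X s := by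
    calc (w - u) * L = ∫ _ in u..w, L := by rw [intervalIntegral.integral_const, smul_eq_mul]
      _ ≤ ∫ s in u..w, X s := intervalIntegral.integral_mono_on huw.le
          intervalIntegrable_const (hint cX le_rfl huw.le hwt) h1
      _ ≤ _ := integral_le_of_subinterval cX nX le_rfl huw.le hwt
  have h3 : L ≤ (w - u)⁻¹ * ∫ s in u..t, X s := by
    rw [← div_eq_inv_mul, le_div_iff₀ (by linarith), mul_comm]
    exact h2
  linarith

/-- The De Giorgi iteration for a family of truncated energies. -/
theorem deGiorgi_iteration {X P Z : ℕ → ℝ → ℝ} {a : ℝ → ℝ} {t c C A B k₀ G β C₀ r : ℝ}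
    (ht : 0 < t) (ht1 : t ≤ 1) (hc : 0 < c) (hC : 0 < C) (hA : 0 ≤ A) (hB : 0 ≤ B) (hk : 0 < k₀)
    (hG : 0 ≤ G) (hβ : 0 < β) (hC₀ : 0 ≤ C₀) (hr : 0 < r)
    (cX : ∀ k, ContinuousOn (X k) (Set.Icc 0 t)) (cP : ∀ k, ContinuousOn (P k) (Set.Icc 0 t))
    (cZ : ∀ k, ContinuousOn (Z k) (Set.Icc 0 t)) (ca : ContinuousOn a (Set.Icc 0 t))
    (nX : ∀ k, ∀ s ∈ Set.Icc 0 t, 0 ≤ X k s) (nP : ∀ k, ∀ s ∈ Set.Icc 0 t, 0 ≤ P k s)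
    (nZ : ∀ k, ∀ s ∈ Set.Icc 0 t, 0 ≤ Z k s) (na : ∀ s ∈ Set.Icc 0 t, 0 ≤ a s)
    (hE : ∀ k x y, 0 ≤ x → x ≤ y → y ≤ t →
      X k y - X k x ≤ ∫ s in x..y, (-(c * Z k s) + C * (P k s + X k s)))
    (hX : ∀ k, ∀ s ∈ Set.Icc 0 t, X (k + 1) s ≤ A * B ^ k * (G * k₀) * (Z k s * X k s ^ β))
    (hP : ∀ k, ∀ s ∈ Set.Icc 0 t, P (k + 1) s ≤ A * B ^ k * G * (Z k s * X k s ^ β))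
    (hX₀ : ∀ s ∈ Set.Icc 0 t, X 0 s ≤ 2 * k₀ * a s) (hP₀ : ∀ s ∈ Set.Icc 0 t, P 0 s ≤ C₀ * a s)
    (hBr : 2 * B * r ^ β = 1)
    (hsmall : (1 + 1 / c) * (4 * (1 + C) * A) * G * (1 + k₀ / t) *
      ((1 + 1 / c) * (4 + C * (C₀ + 2)) * (1 + k₀ / t) * ∫ s in 0..t, a s) ^ β ≤ r) (k : ℕ) :
    X k t ≤ (1 + 1 / c) * (4 + C * (C₀ + 2)) * (1 + k₀ / t) * (∫ s in 0..t, a s) * r ^ k := by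
  set D := 1 + 1 / c with hD
  set μ := 1 + k₀ / t with hμ
  set A₀ := ∫ s in 0..t, a s with hA₀
  set e₀ := D * (4 + C * (C₀ + 2)) * μ * A₀ with he₀
  have hD0 : 0 < D := by positivity
  have hμ0 : 0 < μ := by positivity
  have hA₀0 : 0 ≤ A₀ := intervalIntegral.integral_nonneg ht.le na
  have he₀0 : 0 ≤ e₀ := by positivity
  -- This uses `t ≤ 1`: the undifferentiated term `C ∫ X` is absorbed in the cost `k₀ / t` of the
  -- time cut-off.
  have hk1 : k₀ ≤ k₀ / t := by rw [le_div_iff₀ ht]; nlinarith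
  have hDc : ∀ R : ℝ, 0 ≤ R → R ≤ D * R ∧ R / c ≤ D * R := fun R hR => by
    have : 0 ≤ R / c := by positivity
    have e : D * R = R + R / c := by rw [hD]; ring
    constructor <;> linarith
  -- Starting times increasing from `t/2` to `t`; each step costs a factor `2^{k+2} / t` in the
  -- averaging.
  set τ : ℕ → ℝ := fun k => t * (1 - (1 / 2) ^ (k + 1)) with hτ
  have hhalf : ∀ k : ℕ, (0 : ℝ) < (1 / 2) ^ k ∧ ((1 : ℝ) / 2) ^ k ≤ 1 := fun k =>
    ⟨by positivity, pow_le_one₀ (by norm_num) (by norm_num)⟩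
  have hτ0 : ∀ k, 0 ≤ τ k := fun k => mul_nonneg ht.le (by linarith [(hhalf (k + 1)).2])
  have hτt : ∀ k, τ k ≤ t := fun k => by
    have := (hhalf (k + 1)).1
    simp only [hτ]
    nlinarith
  have hτs : ∀ k, τ (k + 1) - τ k = t * (1 / 2) ^ (k + 2) := fun k => by
    simp only [hτ]
    ring
  have hsub : ∀ {u : ℝ}, 0 ≤ u → Set.Icc u t ⊆ Set.Icc 0 t := fun hu => Set.Icc_subset_Icc_left hu
  -- The factor `D = 1 + 1/c` lets a single quantity bound both `sup X` and `∫ Z`.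
  have havg : ∀ k {u w : ℝ}, 0 ≤ u → u < w → w ≤ t → ∀ R : ℝ,
      (w - u)⁻¹ * (∫ s in u..t, X k s) + (∫ s in u..t, C * (P k s + X k s)) ≤ R →
      (∀ s ∈ Set.Icc w t, X k s ≤ D * R) ∧ ∫ s in w..t, Z k s ≤ D * R := by
    intro k u w hu huw hwt R hR
    have hsu := hsub hu
    have key : ∀ y ∈ Set.Icc w t, X k y + c * (∫ s in w..y, Z k s) ≤ R := fun y hy =>
      (energy_average huw hwt hc.le ((cX k).mono hsu) ((((cP k).add (cX k)).const_mul C).mono hsu)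
        ((cZ k).mono hsu) (fun s hs => nX k s (hsu hs))
        (fun s hs => mul_nonneg hC.le (add_nonneg (nP k s (hsu hs)) (nX k s (hsu hs))))
        (fun s hs => nZ k s (hsu hs)) (fun x y hx hxy hy => hE k x y (hu.trans hx) hxy hy)
        hy).trans hR
    have hw0 : 0 ≤ w := hu.trans huw.le
    have hZ0 : ∀ y ∈ Set.Icc w t, 0 ≤ ∫ s in w..y, Z k s := fun y hy =>
      intervalIntegral.integral_nonneg hy.1 fun s hs => nZ k s ⟨hw0.trans hs.1, hs.2.trans hy.2⟩
    have ht' : t ∈ Set.Icc w t := ⟨hwt, le_rfl⟩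
    have hXt := nX k t ⟨ht.le, le_rfl⟩
    have hR0 : 0 ≤ R := (add_nonneg hXt (mul_nonneg hc.le (hZ0 t ht'))).trans (key t ht')
    refine ⟨fun s hs => ?_, ?_⟩
    · have := key s hs
      have := mul_nonneg hc.le (hZ0 s hs)
      linarith [(hDc R hR0).1]
    · refine le_trans ?_ (hDc R hR0).2
      rw [le_div_iff₀ hc]
      linarith [key t ht']
  have hint : ∀ {F : ℝ → ℝ}, ContinuousOn F (Set.Icc 0 t) → ∀ {u}, 0 ≤ u → u ≤ t →
      IntervalIntegrable F volume u t := fun hF u hu hut =>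
    (hF.mono (hsub hu)).intervalIntegrable_of_Icc hut
  -- Both bounds are propagated together, since the next energy is controlled by `∫ Z X^β ≤ (sup
  -- X)^β ∫ Z`, which is of degree `1 + β > 1`.
  have claim : ∀ k, (∀ s ∈ Set.Icc (τ k) t, X k s ≤ e₀ * r ^ k) ∧
      ∫ s in (τ k)..t, Z k s ≤ e₀ * r ^ k := by
    intro k
    induction k with
    | zero =>
      have hτ00 : τ 0 = t / 2 := by simp only [hτ]; ring
      have i1 : ∫ s in 0..t, X 0 s ≤ 2 * k₀ * A₀ := by
        rw [hA₀, ← intervalIntegral.integral_const_mul]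
        exact intervalIntegral.integral_mono_on ht.le (hint (cX 0) le_rfl ht.le)
          ((hint ca le_rfl ht.le).const_mul _) hX₀
      have i2 : ∫ s in 0..t, P 0 s ≤ C₀ * A₀ := by
        rw [hA₀, ← intervalIntegral.integral_const_mul]
        exact intervalIntegral.integral_mono_on ht.le (hint (cP 0) le_rfl ht.le)
          ((hint ca le_rfl ht.le).const_mul _) hP₀
      have hR : (τ 0 - 0)⁻¹ * (∫ s in 0..t, X 0 s) + (∫ s in 0..t, C * (P 0 s + X 0 s)) ≤
          (4 + C * (C₀ + 2)) * μ * A₀ := by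
        rw [intervalIntegral.integral_const_mul, intervalIntegral.integral_add
          (hint (cP 0) le_rfl ht.le) (hint (cX 0) le_rfl ht.le), sub_zero, hτ00]
        have h1 : (t / 2)⁻¹ * (∫ s in 0..t, X 0 s) ≤ 4 * (k₀ / t) * A₀ := by
          calc (t / 2)⁻¹ * (∫ s in 0..t, X 0 s) ≤ (t / 2)⁻¹ * (2 * k₀ * A₀) := by gcongr
            _ = _ := by field_simp; ring
        have h2 : k₀ * A₀ ≤ k₀ / t * A₀ := mul_le_mul_of_nonneg_right hk1 hA₀0
        have h3 : C * ((∫ s in 0..t, P 0 s) + ∫ s in 0..t, X 0 s) ≤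
            C * (C₀ * A₀ + 2 * (k₀ / t * A₀)) := by
          apply mul_le_mul_of_nonneg_left _ hC.le
          linarith
        have h4 : 0 ≤ k₀ / t := by positivity
        have h5 : 0 ≤ A₀ * (4 + C * 2 + C * C₀ * (k₀ / t)) := by positivity
        rw [hμ]
        nlinarith
      have := havg 0 le_rfl (by rw [hτ00]; linarith) (hτt 0) _ hR
      rw [pow_zero, mul_one]
      rw [← mul_assoc, ← mul_assoc] at this
      exact this
    | succ k ih =>
      obtain ⟨ihX, ihZ⟩ := ih
      set e := e₀ * r ^ k with he
      have he0 : 0 ≤ e := by positivity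
      set N := A * B ^ k * G * (e ^ β * e) with hN
      have hN0 : 0 ≤ N := by positivity
      have hZX : ∀ s ∈ Set.Icc (τ k) t, Z k s * X k s ^ β ≤ e ^ β * Z k s := fun s hs => by
        have hs' := hsub (hτ0 k) hs
        rw [mul_comm]
        exact mul_le_mul_of_nonneg_right (Real.rpow_le_rpow (nX k s hs') (ihX s hs) hβ.le)
          (nZ k s hs')
      have iZ := hint (cZ k) (hτ0 k) (hτt k)
      have i1 : ∫ s in (τ k)..t, X (k + 1) s ≤ N * k₀ := by
        calc ∫ s in (τ k)..t, X (k + 1) s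
            ≤ ∫ s in (τ k)..t, A * B ^ k * (G * k₀) * e ^ β * Z k s := by
              refine intervalIntegral.integral_mono_on (hτt k) (hint (cX (k + 1)) (hτ0 k) (hτt k))
                (iZ.const_mul _) fun s hs => (hX k s (hsub (hτ0 k) hs)).trans ?_
              rw [mul_assoc _ (e ^ β)]
              exact mul_le_mul_of_nonneg_left (hZX s hs) (by positivity)
          _ = A * B ^ k * (G * k₀) * e ^ β * ∫ s in (τ k)..t, Z k s :=
              intervalIntegral.integral_const_mul _ _
          _ ≤ A * B ^ k * (G * k₀) * e ^ β * e := by gcongr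
          _ = _ := by rw [hN]; ring
      have i2 : ∫ s in (τ k)..t, P (k + 1) s ≤ N := by
        calc ∫ s in (τ k)..t, P (k + 1) s
            ≤ ∫ s in (τ k)..t, A * B ^ k * G * e ^ β * Z k s := by
              refine intervalIntegral.integral_mono_on (hτt k) (hint (cP (k + 1)) (hτ0 k) (hτt k))
                (iZ.const_mul _) fun s hs => (hP k s (hsub (hτ0 k) hs)).trans ?_
              rw [mul_assoc _ (e ^ β)]
              exact mul_le_mul_of_nonneg_left (hZX s hs) (by positivity)
          _ = A * B ^ k * G * e ^ β * ∫ s in (τ k)..t, Z k s :=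
              intervalIntegral.integral_const_mul _ _
          _ ≤ A * B ^ k * G * e ^ β * e := by gcongr
          _ = _ := by rw [hN]; ring
      have h2k : (1 : ℝ) ≤ 2 ^ (k + 2) := one_le_pow₀ (by norm_num)
      have hR : (τ (k + 1) - τ k)⁻¹ * (∫ s in (τ k)..t, X (k + 1) s) +
          (∫ s in (τ k)..t, C * (P (k + 1) s + X (k + 1) s)) ≤ N * (2 ^ (k + 2) * (1 + C) * μ) := by
        rw [intervalIntegral.integral_const_mul, intervalIntegral.integral_add
          (hint (cP _) (hτ0 k) (hτt k)) (hint (cX _) (hτ0 k) (hτt k)), hτs]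
        have h1 : (t * (1 / 2) ^ (k + 2))⁻¹ * (∫ s in (τ k)..t, X (k + 1) s) ≤
            N * (2 ^ (k + 2) * (k₀ / t)) := by
          calc (t * (1 / 2) ^ (k + 2))⁻¹ * (∫ s in (τ k)..t, X (k + 1) s)
              ≤ (t * (1 / 2) ^ (k + 2))⁻¹ * (N * k₀) := by gcongr
            _ = _ := by
              rw [one_div, inv_pow, mul_inv, inv_inv]
              field_simp
        have h2 : C * ((∫ s in (τ k)..t, P (k + 1) s) + ∫ s in (τ k)..t, X (k + 1) s) ≤
            C * (N + N * (k₀ / t)) := by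
          apply mul_le_mul_of_nonneg_left _ hC.le
          have := mul_le_mul_of_nonneg_left hk1 hN0
          linarith
        have h3 : C * (N + N * (k₀ / t)) ≤ 2 ^ (k + 2) * (C * (N + N * (k₀ / t))) :=
          le_mul_of_one_le_left (by positivity) h2k
        have h4 : 0 ≤ N * 2 ^ (k + 2) := by positivity
        calc _ ≤ N * (2 ^ (k + 2) * (k₀ / t)) + 2 ^ (k + 2) * (C * (N + N * (k₀ / t))) :=
              add_le_add h1 (h2.trans h3)
          _ ≤ N * (2 ^ (k + 2) * (k₀ / t)) + 2 ^ (k + 2) * (C * (N + N * (k₀ / t))) +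
              N * 2 ^ (k + 2) := by linarith
          _ = _ := by rw [hμ]; ring
      have hlt : τ k < τ (k + 1) := by
        have := hτs k
        have := mul_pos ht (hhalf (k + 2)).1
        linarith
      -- The losses `2^k` from the times and `B^k` from the levels are compensated exactly by
      -- `r^{βk}`, because `2 B r^β = 1`. What remains is the smallness hypothesis, which supplies
      -- the extra factor `r`.
      have hfin : D * (N * (2 ^ (k + 2) * (1 + C) * μ)) ≤ e₀ * r ^ (k + 1) := by
        have e1 : e ^ β = e₀ ^ β * (r ^ β) ^ k := by
          rw [he, Real.mul_rpow he₀0 (by positivity), ← Real.rpow_natCast, ← Real.rpow_natCast,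
            ← Real.rpow_mul hr.le, ← Real.rpow_mul hr.le, mul_comm β]
        have e2 : D * (N * (2 ^ (k + 2) * (1 + C) * μ)) =
            e * (D * (4 * (1 + C) * A) * G * μ * e₀ ^ β) * (2 * B * r ^ β) ^ k := by
          rw [hN, e1, mul_pow, mul_pow]
          ring
        rw [e2, hBr, one_pow, mul_one, pow_succ, ← mul_assoc e₀]
        exact mul_le_mul_of_nonneg_left hsmall he0
      have := havg (k + 1) (hτ0 k) hlt (hτt (k + 1)) _ hR
      exact ⟨fun s hs => (this.1 s hs).trans hfin, this.2.trans hfin⟩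
  exact (claim k).1 t ⟨hτt k, le_rfl⟩

end

/-! ### The pointwise bound -/

section

open Filter Topology

variable {g : 𝓢(V, ℝ)} {p m : ℝ}

theorem betaExp_pos (hm : 9 / 2 < m) : 0 < betaExp m := by
  rw [betaExp, sub_pos, div_lt_div_iff₀ (by linarith) (by norm_num)]
  linarith

theorem nine_half_lt (hp : 3 / 2 < p) (hm : 9 / 2 * ((p - 1) / (p - 3 / 2)) < m) : 9 / 2 < m := by
  have h : 1 < (p - 1) / (p - 3 / 2) := by rw [lt_div_iff₀ (by linarith)]; linarith
  linarith

theorem gammaExp_pos (hp : 3 / 2 < p) (hm : 9 / 2 * ((p - 1) / (p - 3 / 2)) < m) :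
    0 < gammaExp p m := by
  have h1 := nine_half_lt hp hm
  have h2 : 0 < p - 3 / 2 := by linarith
  have h3 : 9 * (p - 1) / (2 * (p - 3 / 2)) = 9 / 2 * ((p - 1) / (p - 3 / 2)) := by
    field_simp
  rw [gammaExp, h3]
  have : 0 < m - 9 / 2 * ((p - 1) / (p - 3 / 2)) := by linarith
  positivity

/-! ### Choice of levels and of the threshold -/

/-- The truncation levels. -/
def level (K : ℝ) (k : ℕ) : ℝ := K * (1 - (1 / 2) ^ (k + 1))

theorem half_le_level {K : ℝ} (hK : 0 < K) (k : ℕ) : K / 2 ≤ level K k := by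
  have h : (1 / 2 : ℝ) ^ (k + 1) ≤ 1 / 2 := by
    have : (1 / 2 : ℝ) ^ k ≤ 1 := pow_le_one₀ (by norm_num) (by norm_num)
    rw [pow_succ]
    linarith
  rw [level]
  nlinarith

theorem level_pos {K : ℝ} (hK : 0 < K) (k : ℕ) : 0 < level K k :=
  lt_of_lt_of_le (by positivity) (half_le_level hK k)

theorem level_lt {K : ℝ} (hK : 0 < K) (k : ℕ) : level K k < K := by
  have : (0 : ℝ) < (1 / 2) ^ (k + 1) := by positivity
  rw [level]
  nlinarith

/-- With `q = 2^{-(k+2)}` this is `1 - 2q ≤ (1 - q)²`; it supplies the relative gap `q` between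
consecutive levels. -/
theorem level_le_mul_level_succ {K : ℝ} (hK : 0 < K) (k : ℕ) :
    level K k ≤ (1 - (1 / 2) ^ (k + 2)) * level K (k + 1) := by
  rw [level, level]
  have e : (1 / 2 : ℝ) ^ (k + 1) = 2 * (1 / 2) ^ (k + 2) := by ring
  have e' : (1 / 2 : ℝ) ^ (k + 1 + 1) = (1 / 2) ^ (k + 2) := by ring
  rw [e, e']
  nlinarith [mul_nonneg hK.le (sq_nonneg ((1 / 2 : ℝ) ^ (k + 2)))]

/-- The growth factor of the iteration. -/
def iterBase (m : ℝ) : ℝ := 4 ^ (2 + 2 * betaExp m)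

/-- The constant of the iteration. -/
def iterConst (p m M₁ : ℝ) : ℝ :=
  (p + 3) * 2 ^ (1 + gammaExp p m) * iterBase m ^ 2 * M₁ ^ (3 / m)

theorem ratio_rpow_eq (m : ℝ) (k : ℕ) :
    (((1 / 2 : ℝ) ^ (k + 2)) ^ 2)⁻¹ ^ (2 + 2 * betaExp m) = iterBase m ^ 2 * iterBase m ^ k := by
  have e : (((1 / 2 : ℝ) ^ (k + 2)) ^ 2)⁻¹ = 4 ^ (k + 2) := by
    rw [← pow_mul, mul_comm (k + 2) 2, pow_mul, ← inv_pow]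
    norm_num
  rw [e, iterBase, ← pow_add, ← Real.rpow_natCast, ← Real.rpow_natCast, ← Real.rpow_mul (by norm_num),
    ← Real.rpow_mul (by norm_num), add_comm 2 k, mul_comm]

theorem level_rpow_neg_le {K e : ℝ} (hK : 0 < K) (he : 0 ≤ e) (k : ℕ) :
    level K k ^ (-e) ≤ 2 ^ e * K ^ (-e) := by
  refine (Real.rpow_le_rpow_of_nonpos (by positivity) (half_le_level hK k) (by linarith)).trans ?_
  rw [Real.div_rpow hK.le (by norm_num), Real.rpow_neg (by norm_num : (0 : ℝ) ≤ 2), div_inv_eq_mul,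
    mul_comm]

theorem level_step {M₁ M₂ K : ℝ} (hp : 3 / 2 < p) (hm : 9 / 2 < m) (hγ : 0 < gammaExp p m)
    (hK : 0 < K) (hB : Bounds m M₁ M₂ g) (k : ℕ) :
    dgX p (level K (k + 1)) g ≤ iterConst p m M₁ * iterBase m ^ k *
        (K ^ (-gammaExp p m) * K⁻¹) * (dgZ p (level K k) g * dgX p (level K k) g ^ betaExp m) ∧
      dgP p (level K (k + 1)) g ≤ iterConst p m M₁ * iterBase m ^ k *
        K ^ (-gammaExp p m) * (dgZ p (level K k) g * dgX p (level K k) g ^ betaExp m) := by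
  have hβ := betaExp_pos hm
  have hq : (0 : ℝ) < (1 / 2) ^ (k + 2) := by positivity
  have h1 := dgX_level_le hp hm hβ hγ (level_pos hK k) hq (level_le_mul_level_succ hK k)
    (level_pos hK (k + 1)) hB
  have h2 := dgP_level_le hp hm hβ hγ (level_pos hK k) hq (level_le_mul_level_succ hK k)
    (level_pos hK (k + 1)) hB
  rw [ratio_rpow_eq] at h1 h2
  have l1 := level_rpow_neg_le hK (e := 1 + gammaExp p m) (by linarith) (k + 1)
  have l2 := level_rpow_neg_le hK hγ.le (k + 1)
  have e1 : K ^ (-(1 + gammaExp p m)) = K ^ (-gammaExp p m) * K⁻¹ := by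
    rw [neg_add_rev, Real.rpow_add hK, Real.rpow_neg_one]
  rw [e1] at l1
  have hM : 0 ≤ M₁ := le_trans (integral_nonneg fun v => mul_nonneg (hB.nonneg v)
    (regPow_one_pos _ v).le) hB.moment_le
  have hb : 0 ≤ iterBase m := by unfold iterBase; positivity
  have hZ : 0 ≤ dgZ p (level K k) g := dgZ_nonneg hB.nonneg
  have hX : 0 ≤ dgX p (level K k) g ^ betaExp m := Real.rpow_nonneg (dgX_nonneg hB.nonneg) _
  have hM' : 0 ≤ M₁ ^ (3 / m) := Real.rpow_nonneg hM _
  set W := iterBase m ^ 2 * iterBase m ^ k *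
    (dgZ p (level K k) g * dgX p (level K k) g ^ betaExp m * M₁ ^ (3 / m)) with hW
  have hW0 : 0 ≤ W := by positivity
  have hg0 : 0 ≤ K ^ (-gammaExp p m) := by positivity
  constructor
  · refine h1.trans ((mul_le_mul_of_nonneg_right l1 hW0).trans ?_)
    have e2 : iterConst p m M₁ * iterBase m ^ k * (K ^ (-gammaExp p m) * K⁻¹) *
        (dgZ p (level K k) g * dgX p (level K k) g ^ betaExp m) =
        (p + 3) * (2 ^ (1 + gammaExp p m) * (K ^ (-gammaExp p m) * K⁻¹) * W) := by
      rw [iterConst, hW]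
      ring
    rw [e2]
    exact le_mul_of_one_le_left (by positivity) (by linarith)
  · refine h2.trans ?_
    have l3 : (2 : ℝ) ^ gammaExp p m ≤ 2 ^ (1 + gammaExp p m) :=
      Real.rpow_le_rpow_of_exponent_le (by norm_num) (by linarith)
    have hp3 : 0 ≤ p + 3 := by linarith
    calc (p + 3) * (level K (k + 1) ^ (-gammaExp p m) * W)
        ≤ (p + 3) * ((2 ^ (1 + gammaExp p m) * K ^ (-gammaExp p m)) * W) := by
          gcongr
          exact l2.trans (by gcongr)
      _ = _ := by rw [iterConst, hW]; ring

/-- The zeroth level is `K/2`, above which `gᵖ ≤ (2/K) g^{p+1}`. Only here does the quantity `∫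
f^{p+1}` enter. -/
theorem initial_step {K : ℝ} (hp : 3 / 2 < p) (hK : 0 < K) (hg : ∀ v, 0 ≤ g v) :
    dgX p (level K 0) g ≤ 2 * K⁻¹ * ∫ v, g v ^ (p + 1) ∧
      dgP p (level K 0) g ≤ (p + 3) * ∫ v, g v ^ (p + 1) := by
  have hl := level_pos hK 0
  have hi : Integrable fun v => g v ^ (p + 1) :=
    ((linBound_rpow (show 0 < p by linarith)).rapid hg).integrable
  have hp1 : p + 1 ≠ 0 := by linarith
  constructor
  · rw [dgX, ← integral_const_mul]
    refine integral_mono (integrable_enPhi p hl hg) (hi.const_mul _) fun v => ?_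
    have hv := hg v
    rcases le_or_gt (g v) (level K 0) with h | h
    · rw [enPhi_eq_zero h]
      positivity
    · refine (enPhi_le hl hv).trans ?_
      have h1 : K / 2 ≤ g v := (half_le_level hK 0).trans h.le
      have h2 : 1 ≤ 2 * K⁻¹ * g v := by
        calc 1 = 2 * K⁻¹ * (K / 2) := by field_simp
          _ ≤ _ := by gcongr
      rw [Real.rpow_add_one' hv hp1]
      calc g v ^ p ≤ (2 * K⁻¹ * g v) * g v ^ p := le_mul_of_one_le_left (by positivity) h2
        _ = _ := by ring
  · rw [dgP, ← integral_const_mul]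
    refine integral_mono (rapid_enPsi_mul p hl hg).integrable (hi.const_mul _) fun v => ?_
    have hv := hg v
    rw [Real.rpow_add_one' hv hp1, ← mul_assoc]
    exact mul_le_mul_of_nonneg_right (enPsi_nonneg_and_le hp hl hv).2 hv

/-- All levels stay below `K`, so the energy at level `K` is below every term of a null sequence. It
vanishes, and continuity turns the almost everywhere statement into a pointwise one. -/
theorem le_of_dgX_tendsto {K : ℝ} (hK : 0 < K) (hg : ∀ v, 0 ≤ g v) {e r : ℝ} (hr0 : 0 ≤ r)
    (hr1 : r < 1) (h : ∀ k, dgX p (level K k) g ≤ e * r ^ k) (v : V) : g v ≤ K := by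
  have hle : ∀ k, dgX p K g ≤ dgX p (level K k) g := fun k => by
    refine integral_mono (integrable_enPhi p hK hg) (integrable_enPhi p (level_pos hK k) hg)
      fun w => ?_
    have hw := hg w
    have := level_lt hK k
    simp only [enPhi, trunc]
    gcongr
  have hlim : Tendsto (fun k => e * r ^ k) atTop (𝓝 (e * 0)) :=
    (tendsto_pow_atTop_nhds_zero_of_lt_one hr0 hr1).const_mul e
  rw [mul_zero] at hlim
  have h0 : dgX p K g ≤ 0 := ge_of_tendsto' hlim fun k => (hle k).trans (h k)
  have hz : dgX p K g = 0 := le_antisymm h0 (dgX_nonneg hg)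
  have hnn : ∀ w, 0 ≤ enPhi p K (g w) := fun w => enPhi_nonneg (hg w)
  rw [dgX, integral_eq_zero_iff_of_nonneg hnn (integrable_enPhi p hK hg)] at hz
  have hc : Continuous fun w => enPhi p K (g w) := (continuous_trunc 3 _ hK).comp g.continuous
  have hz' := (Continuous.ae_eq_iff_eq volume hc continuous_const).1 hz
  by_contra hv
  rw [not_le] at hv
  have h1 : enPhi p K (g v) = 0 := congrFun hz' v
  rw [enPhi, trunc_of_lt hv] at h1
  have : 0 < (g v - K) ^ 4 * g v ^ (p - 4) :=
    mul_pos (pow_pos (by linarith) 4) (Real.rpow_pos_of_pos (hK.trans hv) _)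
  linarith

/-- `K` dominates each summand of the threshold separately; raising the two inequalities to the
powers `γ` and `1 + γ + β` removes the roots. -/
theorem threshold_bounds {W A₀ K t β γ : ℝ} (hW : 0 ≤ W) (hA₀ : 0 ≤ A₀) (hK : 0 < K) (ht : 0 < t)
    (hβ : 0 < β) (hγ : 0 < γ)
    (h : (W ^ (1 / γ) + W ^ (1 / (1 + γ + β))) *
      (A₀ ^ (β / γ) + A₀ ^ (β / (1 + γ + β)) * t ^ (-((1 + β) / (1 + γ + β)))) ≤ K) :
    W * A₀ ^ β * K ^ (-γ) ≤ 1 ∧ W * A₀ ^ β * (K ^ (-(1 + γ + β)) * t ^ (-(1 + β))) ≤ 1 := by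
  have hs : 0 < 1 + γ + β := by linarith
  have p1 : 0 ≤ W ^ (1 / γ) := Real.rpow_nonneg hW _
  have p2 : 0 ≤ W ^ (1 / (1 + γ + β)) := Real.rpow_nonneg hW _
  have p3 : 0 ≤ A₀ ^ (β / γ) := Real.rpow_nonneg hA₀ _
  have p4 : 0 ≤ A₀ ^ (β / (1 + γ + β)) * t ^ (-((1 + β) / (1 + γ + β))) := by positivity
  have h1 : W ^ (1 / γ) * A₀ ^ (β / γ) ≤ K := by nlinarith
  have h2 : W ^ (1 / (1 + γ + β)) * (A₀ ^ (β / (1 + γ + β)) *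
      t ^ (-((1 + β) / (1 + γ + β)))) ≤ K := by nlinarith
  have h3 : W * A₀ ^ β ≤ K ^ γ := by
    have := Real.rpow_le_rpow (by positivity) h1 hγ.le
    rw [Real.mul_rpow p1 p3, ← Real.rpow_mul hW, ← Real.rpow_mul hA₀, one_div_mul_cancel hγ.ne',
      Real.rpow_one, div_mul_cancel₀ _ hγ.ne'] at this
    exact this
  have h4 : W * (A₀ ^ β * t ^ (-(1 + β))) ≤ K ^ (1 + γ + β) := by
    have := Real.rpow_le_rpow (by positivity) h2 hs.le
    rw [Real.mul_rpow p2 p4, Real.mul_rpow (by positivity) (by positivity), ← Real.rpow_mul hW,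
      ← Real.rpow_mul hA₀, ← Real.rpow_mul ht.le, one_div_mul_cancel hs.ne',
      Real.rpow_one, div_mul_cancel₀ _ hs.ne', neg_mul, div_mul_cancel₀ _ hs.ne'] at this
    exact this
  refine ⟨?_, ?_⟩
  · rw [Real.rpow_neg hK.le, ← div_eq_mul_inv, div_le_one (by positivity)]
    exact h3
  · rw [Real.rpow_neg hK.le]
    calc W * A₀ ^ β * ((K ^ (1 + γ + β))⁻¹ * t ^ (-(1 + β)))
        = W * (A₀ ^ β * t ^ (-(1 + β))) / K ^ (1 + γ + β) := by rw [div_eq_mul_inv]; ring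
      _ ≤ 1 := by rw [div_le_one (by positivity)]; exact h4

/-- The constant in front of the threshold. -/
def thresholdConst (Λ₁ Λ₀ r β γ : ℝ) : ℝ :=
  (Λ₁ * Λ₀ ^ β * 2 ^ (1 + β) / r) ^ (1 / γ) + (Λ₁ * Λ₀ ^ β * 2 ^ (1 + β) / r) ^ (1 / (1 + γ + β))

/-- Above the threshold, the smallness condition of the iteration holds. -/
theorem threshold_small {Λ₁ Λ₀ r A₀ K t β γ : ℝ} (hΛ₁ : 0 ≤ Λ₁) (hΛ₀ : 0 ≤ Λ₀) (hr : 0 < r)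
    (hA₀ : 0 ≤ A₀) (hK : 0 < K) (ht : 0 < t) (hβ : 0 < β) (hγ : 0 < γ)
    (h : thresholdConst Λ₁ Λ₀ r β γ *
      (A₀ ^ (β / γ) + A₀ ^ (β / (1 + γ + β)) * t ^ (-((1 + β) / (1 + γ + β)))) ≤ K) :
    Λ₁ * K ^ (-γ) * (1 + K⁻¹ / t) * (Λ₀ * (1 + K⁻¹ / t) * A₀) ^ β ≤ r := by
  obtain ⟨h1, h2⟩ := threshold_bounds (W := Λ₁ * Λ₀ ^ β * 2 ^ (1 + β) / r) (by positivity) hA₀ hK ht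
    hβ hγ h
  set μ := 1 + K⁻¹ / t with hμ
  have hμ0 : 0 < μ := by positivity
  have e : Λ₁ * K ^ (-γ) * μ * (Λ₀ * μ * A₀) ^ β =
      Λ₁ * Λ₀ ^ β * A₀ ^ β * (K ^ (-γ) * μ ^ (1 + β)) := by
    rw [Real.mul_rpow (by positivity) hA₀, Real.mul_rpow hΛ₀ hμ0.le, Real.rpow_add hμ0,
      Real.rpow_one]
    ring
  rw [e]
  -- If `tK ≥ 1`, the factor `1 + 1/(tK)` is at most `2` and the condition on `K^{-γ}` suffices. If
  -- `tK < 1`, it is at most `2/(tK)`, whose power `1 + β` yields the exponents `1 + γ + β` of `K`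
  -- and `1 + β` of `t`.
  rcases le_or_gt 1 (t * K) with hc | hc
  · have hμ2 : μ ≤ 2 := by
      have : K⁻¹ / t ≤ 1 := by
        rw [div_le_one ht, inv_le_iff_one_le_mul₀ hK]
        exact hc
      linarith
    have h3 : μ ^ (1 + β) ≤ 2 ^ (1 + β) := Real.rpow_le_rpow hμ0.le hμ2 (by linarith)
    calc Λ₁ * Λ₀ ^ β * A₀ ^ β * (K ^ (-γ) * μ ^ (1 + β))
        ≤ Λ₁ * Λ₀ ^ β * A₀ ^ β * (K ^ (-γ) * 2 ^ (1 + β)) := by gcongr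
      _ = r * (Λ₁ * Λ₀ ^ β * 2 ^ (1 + β) / r * A₀ ^ β * K ^ (-γ)) := by field_simp
      _ ≤ r * 1 := by gcongr
      _ = r := mul_one r
  · have hμ2 : μ ≤ 2 * (K⁻¹ * t⁻¹) := by
      have : 1 ≤ K⁻¹ * t⁻¹ := by
        rw [← mul_inv, mul_comm]
        exact (one_le_inv₀ (by positivity)).2 hc.le
      rw [hμ, div_eq_mul_inv]
      linarith
    have h3 : μ ^ (1 + β) ≤ 2 ^ (1 + β) * (K ^ (-(1 + β)) * t ^ (-(1 + β))) := by
      refine (Real.rpow_le_rpow hμ0.le hμ2 (by linarith)).trans (le_of_eq ?_)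
      rw [Real.mul_rpow (by norm_num) (by positivity), Real.mul_rpow (by positivity)
        (by positivity), Real.inv_rpow hK.le, Real.inv_rpow ht.le, Real.rpow_neg hK.le,
        Real.rpow_neg ht.le]
    have e2 : K ^ (-(1 + γ + β)) = K ^ (-γ) * K ^ (-(1 + β)) := by
      rw [← Real.rpow_add hK]
      congr 1
      ring
    rw [e2] at h2
    calc Λ₁ * Λ₀ ^ β * A₀ ^ β * (K ^ (-γ) * μ ^ (1 + β))
        ≤ Λ₁ * Λ₀ ^ β * A₀ ^ β * (K ^ (-γ) * (2 ^ (1 + β) * (K ^ (-(1 + β)) * t ^ (-(1 + β))))) := by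
          gcongr
      _ = r * (Λ₁ * Λ₀ ^ β * 2 ^ (1 + β) / r * A₀ ^ β *
          (K ^ (-γ) * K ^ (-(1 + β)) * t ^ (-(1 + β)))) := by field_simp
      _ ≤ r * 1 := by gcongr
      _ = r := mul_one r

/-- The pointwise bound on solutions. -/
theorem exists_pointwise_bound (p m M : ℝ) (hp : 3 / 2 < p)
    (hm : 9 / 2 * ((p - 1) / (p - 3 / 2)) < m) (hM : 0 < M) :
    ∃ C₁ : ℝ, 0 ≤ C₁ ∧ ∀ (f_in : 𝓢(V, ℝ)) (T : EReal) (f : ℝ → 𝓢(V, ℝ)),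
      IsNormalized f_in → weightedL1Norm m f_in ≤ M → absEntropy f_in ≤ M →
      IsSchwartzSolution T f_in f → ∀ t : ℝ, 0 < t → t ≤ 1 → (t : EReal) < T → ∀ K : ℝ, 0 < K →
        C₁ * (controlQuantity p f t ^ (betaExp m / gammaExp p m)
            + controlQuantity p f t ^ (betaExp m / (1 + gammaExp p m + betaExp m))
              * t ^ (-((1 + betaExp m) / (1 + gammaExp p m + betaExp m)))) ≤ K →
        ∀ v, f t v ≤ K := by
  have hm' := nine_half_lt hp hm
  have hβ := betaExp_pos hm'
  have hγ := gammaExp_pos hp hm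
  obtain ⟨c, C, hc, hC, hen⟩ := exists_energy_inequality (entropyBound M) hp
  set A := iterConst p m (momentBound m M) with hA
  set B := iterBase m with hB
  have hM₁ : 0 ≤ momentBound m M := mul_nonneg hM.le (Real.exp_pos _).le
  have hB1 : 1 ≤ B := Real.one_le_rpow (by norm_num) (by linarith)
  have hA0 : 0 ≤ A := by
    rw [hA, iterConst]
    have : 0 ≤ p + 3 := by linarith
    have := Real.rpow_nonneg hM₁ (3 / m)
    positivity
  -- The ratio for which the superlinear gain `r^β` balances the geometric losses; it is less than
  -- one because `2B > 1`.
  set r : ℝ := (2 * B) ^ (-(1 / betaExp m)) with hr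
  have h2B : 1 < 2 * B := by linarith
  have hr0 : 0 < r := Real.rpow_pos_of_pos (by linarith) _
  have hr1 : r < 1 := Real.rpow_lt_one_of_one_lt_of_neg h2B (by
    have : 0 < 1 / betaExp m := by positivity
    linarith)
  have hBr : 2 * B * r ^ betaExp m = 1 := by
    rw [hr, ← Real.rpow_mul (by linarith), neg_mul, one_div_mul_cancel hβ.ne', Real.rpow_neg_one,
      mul_inv_cancel₀ (by linarith)]
  set Λ₁ := (1 + 1 / c) * (4 * (1 + C) * A) with hΛ₁
  set Λ₀ := (1 + 1 / c) * (4 + C * ((p + 3) + 2)) with hΛ₀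
  have hp3 : 0 ≤ p + 3 := by linarith
  refine ⟨thresholdConst Λ₁ Λ₀ r (betaExp m) (gammaExp p m), by unfold thresholdConst; positivity,
    fun f_in T f hN hw he hf t ht ht1 htT K hK hthr => ?_⟩
  have hbd : ∀ s ∈ Set.Icc 0 t, Bounds m (momentBound m M) (entropyBound M) (f s) := fun s hs =>
    hf.bounds (by linarith) hN hw he hs.1 (hs.2.trans ht1)
      (lt_of_le_of_lt (EReal.coe_le_coe_iff.2 hs.2) htT)
  have hpos := hf.nonneg_of_mem htT
  have ca : ContinuousOn (fun s => ∫ v, f s v ^ (p + 1)) (Set.Icc 0 t) :=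
    hf.continuousOn_integral htT (linBound_rpow (by linarith))
  have na : ∀ s ∈ Set.Icc 0 t, 0 ≤ ∫ v, f s v ^ (p + 1) := fun s hs =>
    integral_nonneg fun v => Real.rpow_nonneg (hpos s hs v) _
  have hA₀ : 0 ≤ controlQuantity p f t := intervalIntegral.integral_nonneg ht.le na
  have hsmall := threshold_small (by positivity) (by positivity) hr0 hA₀ hK ht hβ hγ hthr
  have hl := fun k => level_pos hK k
  refine le_of_dgX_tendsto (p := p) hK (hpos t ⟨ht.le, le_rfl⟩) hr0.le hr1 fun k =>
    deGiorgi_iteration (X := fun k s => dgX p (level K k) (f s))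
      (P := fun k s => dgP p (level K k) (f s)) (Z := fun k s => dgZ p (level K k) (f s))
      (a := fun s => ∫ v, f s v ^ (p + 1)) (c := c) (C := C) (A := A) (B := B) (k₀ := K⁻¹)
      (G := K ^ (-gammaExp p m)) (C₀ := p + 3) ht ht1 hc hC hA0 (by linarith) (by positivity)
      (by positivity) hβ hp3 hr0 (fun k => hf.continuousOn_dgX htT (hl k))
      (fun k => hf.continuousOn_dgP htT (hl k)) (fun k => hf.continuousOn_dgZ htT (hl k)) ca
      (fun k s hs => dgX_nonneg (hpos s hs)) (fun k s hs => dgP_nonneg hp (hl k) (hpos s hs))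
      (fun k s hs => dgZ_nonneg (hpos s hs)) na ?_
      (fun k s hs => (level_step hp hm' hγ hK (hbd s hs) k).1)
      (fun k s hs => (level_step hp hm' hγ hK (hbd s hs) k).2)
      (fun s hs => (initial_step hp hK (hpos s hs)).1)
      (fun s hs => (initial_step hp hK (hpos s hs)).2) hBr hsmall k
  intro k x y hx hxy hy
  have hsub : Set.Icc x y ⊆ Set.Icc 0 t := Set.Icc_subset_Icc hx hy
  have hd : ∀ s ∈ Set.Ioo x y, ∃ X' : ℝ, HasDerivAt (fun s => dgX p (level K k) (f s)) X' s ∧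
      X' ≤ -(c * dgZ p (level K k) (f s)) +
        C * (dgP p (level K k) (f s) + dgX p (level K k) (f s)) := fun s hs =>
    hen hf (hl k) (hx.trans_lt hs.1) (coe_lt_of_mem (hs.2.trans_le hy) htT)
      (hbd s (hsub (Set.Ioo_subset_Icc_self hs)))
  -- The derivative is needed only inside the interval; continuity up to the endpoints allows the
  -- initial time `0`.
  refine intervalIntegral.sub_le_integral_of_hasDeriv_right_of_le hxy
    ((hf.continuousOn_dgX htT (hl k)).mono hsub)
    (g' := fun s => deriv (fun s => dgX p (level K k) (f s)) s) (fun s hs => ?_) ?_ fun s hs => ?_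
  · obtain ⟨X', h, _⟩ := hd s hs
    exact h.differentiableAt.hasDerivAt.hasDerivWithinAt
  · refine ContinuousOn.integrableOn_Icc (ContinuousOn.mono ?_ hsub)
    exact ((hf.continuousOn_dgZ htT (hl k)).const_mul c).neg.add
      (((hf.continuousOn_dgP htT (hl k)).add (hf.continuousOn_dgX htT (hl k))).const_mul C)
  · obtain ⟨X', h, hle⟩ := hd s hs
    rw [h.deriv]
    exact hle

end

end LandauCoulomb

end

theorem proposition4p1 (p m M : ℝ) (hp : 3 / 2 < p)
    (hm : 9 / 2 * ((p - 1) / (p - 3 / 2)) < m) (hM : 0 < M) :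
    ∃ C : ℝ, ∀ (f_in : 𝓢(V, ℝ)) (Tstar : EReal) (f : ℝ → 𝓢(V, ℝ)),
      (∀ v, 0 ≤ f_in v) →
      IsNormalized f_in →
      weightedL1Norm m f_in ≤ M →
      absEntropy f_in ≤ M →
      IsSchwartzSolution Tstar f_in f →
      ∀ t : ℝ, 0 < t → (t : EReal) < min 1 Tstar →
        eLpNorm (f t) ⊤ volume ≤ ENNReal.ofReal
          (C * (controlQuantity p f t ^ (betaExp m / gammaExp p m)
            + controlQuantity p f t ^ (betaExp m / (1 + gammaExp p m + betaExp m))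
              * t ^ (-((1 + betaExp m) / (1 + gammaExp p m + betaExp m))))) := by
  obtain ⟨C₁, hC₁, h⟩ := exists_pointwise_bound p m M hp hm hM
  refine ⟨C₁, fun f_in Tstar f _ hN hw he hf t ht htT => ?_⟩
  obtain ⟨ht1, htT⟩ := lt_min_iff.1 htT
  have ht1 : t < 1 := by exact_mod_cast ht1
  have hpos := hf.nonneg_of_mem htT
  have hA₀ : 0 ≤ controlQuantity p f t := intervalIntegral.integral_nonneg ht.le fun s hs =>
    integral_nonneg fun v => Real.rpow_nonneg (hpos s hs v) _
  rw [eLpNorm_exponent_top]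
  refine eLpNormEssSup_le_of_ae_bound (Filter.Eventually.of_forall fun v => ?_)
  rw [Real.norm_of_nonneg (hpos t ⟨ht.le, le_rfl⟩ v)]
  -- The iteration needs a positive level, whereas the bound itself could be zero; it is therefore
  -- run at every larger `K`.
  refine le_of_forall_gt_imp_ge_of_dense fun K hK => ?_
  exact h f_in Tstar f hN hw he hf t ht ht1.le htT K
    (lt_of_le_of_lt (by positivity) hK) hK.le v
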